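/- Let $\mathbb{T}=\mathbb{R}/\mathbb{Z}$, identified with the unit circle via $x\mapsto e^{2\pi i x}$, and let $\sigma(x)=2x$ on $\mathbb{T}$. A leaf $\overline{ab}$ is the closed chord with endpoints $a,b\in\mathbb{T}$ (possibly $a=b$); two distinct leaves are unlinked if they meet at most in an endpoint of both. For $\theta\in\mathbb{T}$ let $\ell_\theta$ be the diameter with endpoints $\theta$ and $\theta'=\theta+\tfrac12$. Put $\mathcal{L}^\theta_0=\{\ell_\theta\}$, and let $\mathcal{L}^\theta_{n+1}$ consist of the leaves of $\mathcal{L}^\theta_n$ together with all leaves $\overline{ab}$ such that $\overline{\sigma(a)\sigma(b)}\in\mathcal{L}^\theta_n$ and $\overline{ab}$ is unlinked with every leaf of $\mathcal{L}^\theta_n$. Let $\mathcal{L}=\mathcal{L}^\theta_\infty=\overline{\bigcup_n\mathcal{L}^\theta_n}$ be the closure in the space of (possibly degenerate) leaves, i.e. with respect to convergence of endpoints, and let $\mathcal{L}^*\subset\mathbb{C}$ be the union of $\mathbb{T}$ and all leaves of $\mathcal{L}$. For $x,y\in\mathbb{T}$ write $x\sim_{\mathcal{L}}y$ if there is a continuum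 (nonempty compact connected set, possibly a single point) $K\subset\mathcal{L}^*$ containing $x$ and $y$ such that $K\cap\mathbb{T}$ is countable. A lamination is an equivalence relation on $\mathbb{T}$ whose graph is closed in $\mathbb{T}\times\mathbb{T}$, whose classes are nowhere dense, and whose distinct classes have disjoint convex hulls in the plane. It is invariant if $\sigma(C)$ is a class for every class $C$, and non-degenerate if not all points of $\mathbb{T}$ are equivalent. **Theorem (Test for Non-Degeneracy).** Let $\theta\in\mathbb{T}$ be such that the diameter $\ell_\theta$ is not vertical, i.e. $\theta\notin\{\tfrac14,\tfrac34\}$, and such that $\sigma(\theta)$ is not a periodic point of $\sigma$. Then $\sim_{\mathcal{L}^\theta_\infty}$ is a non-degenerate invariant lamination. -/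

import Mathlib

namespace QuadLam

/-- The angle doubling map on `𝕋 = ℝ / ℤ`. -/
def sigma (x : UnitAddCircle) : UnitAddCircle := 2 • x

/-- The point `x' = x + 1/2` of `𝕋` opposite to `x`. -/
noncomputable def opp (x : UnitAddCircle) : UnitAddCircle := x + ((1 / 2 : ℝ) : UnitAddCircle)

/-- The point `exp (2 π i x)` of the unit circle in the plane that corresponds to `x ∈ 𝕋`. -/
noncomputable def pt (x : UnitAddCircle) : ℂ := (AddCircle.toCircle x : ℂ)

/-- The leaf (chord of the unit disk, possibly degenerate) with the given pair of endpoints.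
Leaves are recorded by ordered pairs of endpoints; the sets of leaves used below contain
a pair exactly when they contain the reversed pair. -/
noncomputable def chord (l : UnitAddCircle × UnitAddCircle) : Set ℂ :=
  segment ℝ (pt l.1) (pt l.2)

/-- Two distinct leaves are unlinked: they meet at most in an endpoint of both of them. -/
def Unlinked (l m : UnitAddCircle × UnitAddCircle) : Prop :=
  chord l ∩ chord m ⊆ {pt l.1, pt l.2} ∩ {pt m.1, pt m.2}

/-- The finite pullback laminations of the critical diameter with endpoints `θ`, `θ + 1/2`:
at each step all preimage leaves that are unlinked with the leaves present so far are added. -/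
def pullback (θ : UnitAddCircle) : ℕ → Set (UnitAddCircle × UnitAddCircle)
  | 0 => {(θ, opp θ), (opp θ, θ)}
  | n + 1 => pullback θ n ∪
      {l | (sigma l.1, sigma l.2) ∈ pullback θ n ∧ ∀ m ∈ pullback θ n, Unlinked l m}

/-- The Thurston pullback geometric lamination: all precritical leaves together with their
limit leaves (possibly degenerate). -/
def pullbackLamination (θ : UnitAddCircle) : Set (UnitAddCircle × UnitAddCircle) :=
  closure (⋃ n, pullback θ n)

/-- The union of the unit circle and of all leaves of a family of leaves. -/
def support (L : Set (UnitAddCircle × UnitAddCircle)) : Set ℂ :=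
  Metric.sphere 0 1 ∪ ⋃ l ∈ L, chord l

/-- A continuum (nonempty compact connected set) inside the support of `L` that meets the unit
circle in a countable set. -/
structure IsOmegaContinuum (L : Set (UnitAddCircle × UnitAddCircle)) (K : Set ℂ) : Prop where
  subset_support : K ⊆ support L
  isCompact : IsCompact K
  isConnected : IsConnected K
  countable : (K ∩ Metric.sphere 0 1).Countable

theorem pt_mem_sphere (x : UnitAddCircle) : pt x ∈ Metric.sphere (0 : ℂ) 1 := by
  rw [mem_sphere_zero_iff_norm]
  exact Circle.norm_coe _

theorem isOmegaContinuum_singleton (L : Set (UnitAddCircle × UnitAddCircle))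
    (x : UnitAddCircle) : IsOmegaContinuum L {pt x} where
  subset_support := by
    rintro _ rfl
    exact Or.inl (pt_mem_sphere x)
  isCompact := isCompact_singleton
  isConnected := isConnected_singleton
  countable := (Set.countable_singleton _).mono Set.inter_subset_left

theorem IsOmegaContinuum.union {L : Set (UnitAddCircle × UnitAddCircle)} {K H : Set ℂ}
    (hK : IsOmegaContinuum L K) (hH : IsOmegaContinuum L H) {z : ℂ} (hzK : z ∈ K)
    (hzH : z ∈ H) : IsOmegaContinuum L (K ∪ H) where
  subset_support := Set.union_subset hK.subset_support hH.subset_support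
  isCompact := hK.isCompact.union hH.isCompact
  isConnected := hK.isConnected.union ⟨z, hzK, hzH⟩ hH.isConnected
  countable := by
    rw [Set.union_inter_distrib_right]
    exact hK.countable.union hH.countable

/-- The equivalence relation on `𝕋` induced by a family of leaves `L`: two points are equivalent
when some `ω`-continuum contains both. -/
def inducedSetoid (L : Set (UnitAddCircle × UnitAddCircle)) : Setoid UnitAddCircle where
  r x y := ∃ K : Set ℂ, IsOmegaContinuum L K ∧ pt x ∈ K ∧ pt y ∈ K
  iseqv :=
    { refl := fun x => ⟨{pt x}, isOmegaContinuum_singleton L x, rfl, rfl⟩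
      symm := fun ⟨K, hK, hx, hy⟩ => ⟨K, hK, hy, hx⟩
      trans := fun ⟨K, hK, hx, hy⟩ ⟨H, hH, hy', hz⟩ =>
        ⟨K ∪ H, hK.union hH hy hy', Or.inl hx, Or.inr hz⟩ }

/-- Laminations: closed equivalence relations on `𝕋` with nowhere dense, pairwise unlinked
classes (the convex hulls of distinct classes are disjoint). -/
structure IsLamination (s : Setoid UnitAddCircle) : Prop where
  isClosed_graph : IsClosed {p : UnitAddCircle × UnitAddCircle | s p.1 p.2}
  isNowhereDense : ∀ C ∈ s.classes, IsNowhereDense C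
  unlinked : ∀ A ∈ s.classes, ∀ B ∈ s.classes, A ≠ B →
    Disjoint (convexHull ℝ (pt '' A)) (convexHull ℝ (pt '' B))

/-- Invariance under angle doubling: the image of every class is a class. -/
def IsInvariant (s : Setoid UnitAddCircle) : Prop :=
  ∀ C ∈ s.classes, sigma '' C ∈ s.classes

/-- Not all points of `𝕋` are identified. -/
def IsNondegenerate (s : Setoid UnitAddCircle) : Prop :=
  ∃ x y : UnitAddCircle, ¬ s x y

end QuadLam

/-!
The equivalence relation induced by the pullback lamination of a diameter is described through
symbolic dynamics.

The endpoints `θ`, `θ + 1/2` of the diameter cut the circle into two closed half circles, and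
`fiber θ s` is the set of points with itinerary `s`; its convex hull is called a gap. Since the
critical value `σ(θ)` is not periodic, an orbit meets the diameter at most once. Hence the leaves
of the finite pullback laminations are exactly the precritical leaves (`Leaf`), they are pairwise
disjoint, distinct gaps do not cross (`fiber_eq_of_cross`), and two points lie in a common gap if
and only if no precritical leaf separates them (`exists_leaf_cross`).

Finite and infinite gaps behave differently. A finite gap has at most one precritical edge
(`leaf_eq_of_finite`), and all of its points are equivalent, because its edges are limits of
precritical leaves (`rel_of_finite`). All edges of an infinite gap are precritical
(`leaf_of_edge`): by the absence of wandering triangles (`exists_shift_eq_of_triangle`) its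
itinerary is eventually periodic; an edge that is not precritical would then return to itself
under an iterate of the doubling map, and this return map, which is monotone and expanding, would
fix the whole gap, although it has only finitely many fixed points. So infinite gaps have no
isolated points (`preperfect_fiber`).

Call two points directly related (`Rel`) if they coincide, bound a precritical leaf, or belong to
a common finite gap. This relation is closed, is mapped into itself by the doubling map, and can
be lifted; two directly related pairs that cross lie in one finite gap. The main point is that the
equivalence relation is the composition of `Rel` with itself (`rel_iff`); closedness, invariance,
unlinkedness and nondegeneracy follow from this, and classes are nowhere dense because a class
with interior points would be mapped onto the circle by an iterate of the doubling map.

For `exists_rel_rel`, let a continuum `K` with countable trace on the circle join `x` and `y`.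

* A connected subset of the support that passes from one side of a diagonal of a gap to the other
  contains an endpoint of the diagonal (`mem_of_cross_gap`). As infinite gaps have uncountably
  many points in each open arc that they meet, no infinite gap has points on both arcs between `x`
  and `y` (`finite_of_cross`).
* The precritical leaves that separate `x` and `y` are linearly ordered. If there is none, or only
  one, then the claim follows directly. Two adjacent ones would be sides of a gap, infinite by
  `leaf_eq_of_finite`, that has points on both arcs.
* If these leaves were densely ordered, then `K` would contain a point of the circle in every
  strip between two of them (`exists_mem_strip`), and a nested sequence of strips would contradict
  countability (`false_of_strips`). A strip is met because it contains a precritical leaf with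
  both endpoints on one side (`exists_leaf_side`), which produces a gap between two limit leaves
  in the strip.

The last step is the only one that uses that the diameter is not vertical (`not_strip`). In a
strip without such a leaf all leaves would be parallel. Doubling the strip until it contains the
diameter, cutting it there, and doubling again leads to a strip whose two arcs meet at a point,
and this forces all precritical leaves to separate the critical value from one and the same point,
which is then its own image and the image of the critical value. That point is `0`, hence `2 σ(θ)
= 0` and `θ = ± 1/4`.
-/

namespace QuadLam

variable {θ a b c d e x y z w : UnitAddCircle} {s t : ℕ → Bool} {n m : ℕ}

/-! ### Arcs of the circle -/

/-- The length, in `[0, 1)`, of the counterclockwise arc of `𝕋` from `a` to `x`. -/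
noncomputable def arc (a x : UnitAddCircle) : ℝ := (AddCircle.equivIco 1 0 (x - a) : ℝ)

theorem arc_nonneg (a x : UnitAddCircle) : 0 ≤ arc a x := (AddCircle.equivIco 1 0 (x - a)).2.1

theorem arc_lt_one (a x : UnitAddCircle) : arc a x < 1 := by
  have := (AddCircle.equivIco 1 0 (x - a)).2.2
  simpa [arc] using this

theorem coe_arc (a x : UnitAddCircle) : ((arc a x : ℝ) : UnitAddCircle) = x - a :=
  AddCircle.coe_equivIco

theorem arc_eq_of_coe {t : ℝ} (h0 : 0 ≤ t) (h1 : t < 1) (h : (t : UnitAddCircle) = x - a) :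
    arc a x = t := by
  rw [← coe_arc] at h
  exact ((AddCircle.coe_eq_coe_iff_of_mem_Ico (p := (1 : ℝ)) (a := 0) ⟨h0, by simpa using h1⟩
    ⟨arc_nonneg a x, by simpa using arc_lt_one a x⟩).1 h).symm

theorem add_coe_arc (a x : UnitAddCircle) : a + ((arc a x : ℝ) : UnitAddCircle) = x := by
  rw [coe_arc]; abel

theorem arc_add_coe {t : ℝ} (h0 : 0 ≤ t) (h1 : t < 1) : arc a (a + (t : UnitAddCircle)) = t :=
  arc_eq_of_coe h0 h1 (by abel)

theorem coe_one_eq_zero : ((1 : ℝ) : UnitAddCircle) = 0 := AddCircle.coe_period 1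

@[simp] theorem arc_self (a : UnitAddCircle) : arc a a = 0 :=
  arc_eq_of_coe le_rfl one_pos (by simp)

theorem arc_inj : arc c x = arc c y ↔ x = y := by
  refine ⟨fun h => ?_, fun h => h ▸ rfl⟩
  rw [← add_coe_arc c x, h, add_coe_arc]

theorem arc_eq_zero : arc a x = 0 ↔ x = a := by
  rw [← arc_self a, arc_inj]

theorem arc_pos : 0 < arc a x ↔ x ≠ a := by
  rw [Ne, ← arc_eq_zero]
  exact ⟨fun h => h.ne', fun h => lt_of_le_of_ne (arc_nonneg _ _) (Ne.symm h)⟩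

/-- Change of base point for arcs. -/
theorem arc_cases (c x z : UnitAddCircle) :
    (arc c x ≤ arc c z ∧ arc x z = arc c z - arc c x) ∨
      (arc c z < arc c x ∧ arc x z = arc c z - arc c x + 1) := by
  have h1 := arc_nonneg c x
  have h2 := arc_lt_one c x
  have h3 := arc_nonneg c z
  have h4 := arc_lt_one c z
  rcases le_or_gt (arc c x) (arc c z) with h | h
  · refine Or.inl ⟨h, arc_eq_of_coe (by linarith) (by linarith) ?_⟩
    rw [AddCircle.coe_sub, coe_arc, coe_arc]; abel
  · refine Or.inr ⟨h, arc_eq_of_coe (by linarith) (by linarith) ?_⟩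
    rw [AddCircle.coe_add, AddCircle.coe_sub, coe_arc, coe_arc, coe_one_eq_zero]; abel

theorem arc_sigma (a x : UnitAddCircle) :
    (arc a x < 1 / 2 ∧ arc (sigma a) (sigma x) = 2 * arc a x) ∨
      (1 / 2 ≤ arc a x ∧ arc (sigma a) (sigma x) = 2 * arc a x - 1) := by
  have h1 := arc_nonneg a x
  have h2 := arc_lt_one a x
  rcases lt_or_ge (arc a x) (1 / 2) with h | h
  · refine Or.inl ⟨h, arc_eq_of_coe (by linarith) (by linarith) ?_⟩
    rw [two_mul, AddCircle.coe_add, coe_arc, sigma, sigma]; abel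
  · refine Or.inr ⟨h, arc_eq_of_coe (by linarith) (by linarith) ?_⟩
    rw [two_mul, AddCircle.coe_sub, AddCircle.coe_add, coe_arc, coe_one_eq_zero, sigma, sigma]; abel

theorem coe_half_add_half :
    ((1 / 2 : ℝ) : UnitAddCircle) + ((1 / 2 : ℝ) : UnitAddCircle) = 0 := by
  rw [← AddCircle.coe_add, ← coe_one_eq_zero]; norm_num

@[simp] theorem opp_opp (x : UnitAddCircle) : opp (opp x) = x := by
  rw [opp, opp, add_assoc, coe_half_add_half, add_zero]

@[simp] theorem sigma_opp (x : UnitAddCircle) : sigma (opp x) = sigma x := by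
  rw [sigma, opp, nsmul_add, two_nsmul ((1 / 2 : ℝ) : UnitAddCircle), coe_half_add_half, add_zero,
    sigma]

theorem arc_opp_self (x : UnitAddCircle) : arc x (opp x) = 1 / 2 :=
  arc_add_coe (by norm_num) (by norm_num)

theorem opp_ne (x : UnitAddCircle) : opp x ≠ x := by
  rw [← arc_pos, arc_opp_self]; norm_num

theorem arc_opp (c x : UnitAddCircle) :
    (arc c x < 1 / 2 ∧ arc c (opp x) = arc c x + 1 / 2) ∨
      (1 / 2 ≤ arc c x ∧ arc c (opp x) = arc c x - 1 / 2) := by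
  have h1 := arc_nonneg c x
  have h2 := arc_lt_one c x
  have h3 := arc_nonneg c (opp x)
  have h4 := arc_lt_one c (opp x)
  have h5 := arc_opp_self x
  rcases arc_cases c x (opp x) with ⟨h, h'⟩ | ⟨h, h'⟩
  · exact Or.inl ⟨by linarith, by linarith⟩
  · exact Or.inr ⟨by linarith, by linarith⟩

theorem sigma_eq_iff : sigma x = sigma y ↔ x = y ∨ x = opp y := by
  constructor
  · intro h
    have h0 : arc (sigma y) (sigma x) = 0 := arc_eq_zero.2 h
    rcases arc_sigma y x with ⟨-, h'⟩ | ⟨-, h'⟩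
    · exact Or.inl (arc_eq_zero.1 (by linarith))
    · right
      rw [← arc_inj (c := y), arc_opp_self]; linarith
  · rintro (rfl | rfl) <;> simp

/-! ### Cyclic order and linked pairs -/

/-- The point `z` lies in the open counterclockwise arc from `x` to `y`. -/
def Btw (x z y : UnitAddCircle) : Prop := 0 < arc x z ∧ arc x z < arc x y

theorem btw_iff (c : UnitAddCircle) : Btw x z y ↔
    (arc c x < arc c z ∧ arc c z < arc c y) ∨ (arc c y < arc c x ∧ arc c x < arc c z) ∨
      (arc c z < arc c y ∧ arc c y < arc c x) := by
  have h1 := arc_nonneg c x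
  have h2 := arc_lt_one c x
  have h3 := arc_nonneg c y
  have h4 := arc_lt_one c y
  have h5 := arc_nonneg c z
  have h6 := arc_lt_one c z
  unfold Btw
  rcases arc_cases c x y with h | h <;> rcases arc_cases c x z with h' | h' <;>
    grind

/-- The pairs `x, y` and `z, w` are linked: `z` and `w` lie in different components of
`𝕋 ∖ {x, y}`. -/
def Cross (x y z w : UnitAddCircle) : Prop :=
  (Btw x z y ∧ Btw y w x) ∨ (Btw x w y ∧ Btw y z x)

/-- Linkedness of pairs of real numbers. -/
def CrossR (p q r t : ℝ) : Prop :=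
  (p < r ∧ r < q ∧ (t < p ∨ q < t)) ∨ (p < t ∧ t < q ∧ (r < p ∨ q < r)) ∨
    (q < r ∧ r < p ∧ (t < q ∨ p < t)) ∨ (q < t ∧ t < p ∧ (r < q ∨ p < r))

theorem cross_iff (c : UnitAddCircle) :
    Cross x y z w ↔ CrossR (arc c x) (arc c y) (arc c z) (arc c w) := by
  unfold Cross CrossR
  rw [btw_iff c, btw_iff c, btw_iff c, btw_iff c]
  grind

theorem Cross.symm (h : Cross x y z w) : Cross z w x y := by
  rw [cross_iff 0] at *
  unfold CrossR at *
  grind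

theorem Cross.swap_left (h : Cross x y z w) : Cross y x z w := by
  rw [cross_iff 0] at *
  unfold CrossR at *
  grind

theorem Cross.swap_right (h : Cross x y z w) : Cross x y w z := by
  rw [cross_iff 0] at *
  unfold CrossR at *
  grind

theorem Cross.ne (h : Cross x y z w) :
    x ≠ y ∧ x ≠ z ∧ x ≠ w ∧ y ≠ z ∧ y ≠ w ∧ z ≠ w := by
  rw [cross_iff 0] at h
  unfold CrossR at h
  refine ⟨?_, ?_, ?_, ?_, ?_, ?_⟩ <;> rintro rfl <;> grind

theorem btw_cases (x z y : UnitAddCircle) (h1 : z ≠ x) (h2 : z ≠ y) (h : x ≠ y) :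
    Btw x z y ∨ Btw y z x := by
  rw [btw_iff x, btw_iff x]
  have := arc_self x
  have h3 := arc_pos.2 h1
  have h4 := arc_pos.2 h.symm
  have h5 : arc x z ≠ arc x y := fun h => h2 (arc_inj.1 h)
  grind

theorem Btw.ne (h : Btw x z y) : x ≠ z ∧ z ≠ y ∧ x ≠ y := by
  unfold Btw at h
  refine ⟨?_, ?_, ?_⟩ <;> rintro rfl <;> simp at h
  linarith [arc_nonneg x z]

theorem Btw.not_symm (h : Btw x z y) : ¬ Btw y z x := by
  rw [btw_iff x] at *
  grind

/-! ### Topology of arcs -/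

theorem isOpen_btw (x y : UnitAddCircle) : IsOpen {z | Btw x z y} := by
  have : {z | Btw x z y} =
      (fun t : ℝ => x + (t : UnitAddCircle)) '' Set.Ioo 0 (arc x y) := by
    ext z
    constructor
    · intro h
      exact ⟨arc x z, h, add_coe_arc x z⟩
    · rintro ⟨t, ⟨h0, h1⟩, rfl⟩
      have := arc_add_coe (a := x) h0.le (h1.trans (arc_lt_one x y))
      exact ⟨by rwa [this], by rwa [this]⟩
  rw [this]
  have h : IsOpenMap (fun t : ℝ => x + (t : UnitAddCircle)) :=
    (Homeomorph.addLeft x).isOpenMap.comp QuotientAddGroup.isOpenMap_coe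
  exact h _ isOpen_Ioo

theorem isOpen_cross (z w : UnitAddCircle) :
    IsOpen {p : UnitAddCircle × UnitAddCircle | Cross p.1 p.2 z w} := by
  have : {p : UnitAddCircle × UnitAddCircle | Cross p.1 p.2 z w} =
      ({x | Btw z x w} ×ˢ {x | Btw w x z}) ∪ ({x | Btw w x z} ×ˢ {x | Btw z x w}) := by
    ext ⟨p, q⟩
    constructor
    · intro h
      rcases Cross.symm h with h | h
      · exact Or.inl h
      · exact Or.inr ⟨h.2, h.1⟩
    · rintro (h | h)
      · exact Cross.symm (Or.inl h)
      · exact Cross.symm (Or.inr ⟨h.2, h.1⟩)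
  rw [this]
  exact ((isOpen_btw z w).prod (isOpen_btw w z)).union
    ((isOpen_btw w z).prod (isOpen_btw z w))

theorem continuousAt_arc (h : x ≠ a) : ContinuousAt (arc a) x := by
  have h1 : ContinuousAt (AddCircle.equivIco (1 : ℝ) 0) (x - a) :=
    AddCircle.continuousAt_equivIco 1 0 (by simpa [sub_eq_zero] using h)
  have h2 : ContinuousAt (fun x : UnitAddCircle => x - a) x := by fun_prop
  exact continuous_subtype_val.continuousAt.comp
    (ContinuousAt.comp (f := fun x : UnitAddCircle => x - a) h1 h2)

theorem continuous_sigma : Continuous sigma := by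
  unfold sigma; fun_prop

theorem exists_sigma_eq (y : UnitAddCircle) : ∃ x, sigma x = y := by
  refine ⟨((arc 0 y / 2 : ℝ) : UnitAddCircle), ?_⟩
  rw [sigma, two_nsmul, ← AddCircle.coe_add, add_halves, coe_arc, sub_zero]

/-! ### The two closed half circles cut off by the critical diameter -/

/-- The initial point of the closed half circle with index `i`: `θ` or `θ + 1/2`. -/
noncomputable def vtx (θ : UnitAddCircle) (i : Bool) : UnitAddCircle := bif i then opp θ else θ

/-- The closed half circle that starts, counterclockwise, at `θ` (index `false`) or at
`θ + 1/2` (index `true`). -/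
def half (θ : UnitAddCircle) (i : Bool) : Set UnitAddCircle := {x | arc (vtx θ i) x ≤ 1 / 2}

@[simp] theorem sigma_vtx (θ : UnitAddCircle) (i : Bool) : sigma (vtx θ i) = sigma θ := by
  cases i <;> simp [vtx]

@[simp] theorem opp_vtx (θ : UnitAddCircle) (i : Bool) : opp (vtx θ i) = vtx θ (!i) := by
  cases i <;> simp [vtx]

theorem sigma_eq_sigma_iff_vtx (i : Bool) : sigma x = sigma θ ↔ x = vtx θ i ∨ x = vtx θ (!i) := by
  rw [sigma_eq_iff]
  cases i <;> simp [vtx, or_comm]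

theorem vtx_mem_half (θ : UnitAddCircle) (i j : Bool) : vtx θ i ∈ half θ j := by
  have h : i = j ∨ i = !j := by cases i <;> cases j <;> simp
  rcases h with rfl | rfl
  · simp [half]
  · rw [half, Set.mem_ofPred_eq, ← opp_vtx, arc_opp_self]

theorem mem_half_not (i : Bool) :
    x ∈ half θ (!i) ↔ x = vtx θ i ∨ 1 / 2 ≤ arc (vtx θ i) x := by
  rw [half, Set.mem_ofPred_eq, ← arc_eq_zero]
  have h2 := arc_opp_self (vtx θ i)
  rw [opp_vtx] at h2
  have h3 := arc_nonneg (vtx θ i) x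
  have h4 := arc_lt_one (vtx θ i) x
  rcases arc_cases (vtx θ i) (vtx θ (!i)) x with h | h <;> rw [h.2, h2] <;> rw [h2] at h <;> grind

theorem mem_half_or (θ x : UnitAddCircle) (i : Bool) : x ∈ half θ i ∨ x ∈ half θ (!i) := by
  rw [mem_half_not]
  rcases le_total (arc (vtx θ i) x) (1 / 2) with h | h
  · exact Or.inl h
  · exact Or.inr (Or.inr h)

/-- The two closed half circles meet exactly in the endpoints of the diameter. -/
theorem sigma_eq_of_mem_half {i : Bool} (h : x ∈ half θ i) (h' : x ∈ half θ (!i)) :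
    sigma x = sigma θ := by
  rw [sigma_eq_sigma_iff_vtx i]
  rcases (mem_half_not i).1 h' with h' | h'
  · exact Or.inl h'
  · right
    rw [← arc_inj (c := vtx θ i), ← opp_vtx, arc_opp_self]
    exact le_antisymm h h'

/-- The doubling map on a closed half circle, in coordinates. -/
theorem arc_sigma_half {i : Bool} (h : x ∈ half θ i) :
    (arc (vtx θ i) x < 1 / 2 ∧ arc (sigma θ) (sigma x) = 2 * arc (vtx θ i) x) ∨
      (arc (vtx θ i) x = 1 / 2 ∧ x = vtx θ (!i) ∧ arc (sigma θ) (sigma x) = 0) := by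
  have h' : arc (vtx θ i) x ≤ 1 / 2 := h
  have := arc_sigma (vtx θ i) x
  rw [sigma_vtx] at this
  rcases this with h1 | h1
  · exact Or.inl h1
  · have h2 : arc (vtx θ i) x = 1 / 2 := le_antisymm h' h1.1
    refine Or.inr ⟨h2, ?_, by linarith⟩
    rw [← arc_inj (c := vtx θ i), ← opp_vtx, arc_opp_self, h2]

theorem isClosed_half (θ : UnitAddCircle) (i : Bool) : IsClosed (half θ i) := by
  have : half θ i = {x | Btw (vtx θ (!i)) x (vtx θ i)}ᶜ := by
    ext x
    have h2 := arc_opp_self (vtx θ i)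
    rw [opp_vtx] at h2
    have h3 := arc_nonneg (vtx θ i) x
    simp only [half, Set.mem_ofPred_eq, Set.mem_compl_iff]
    rw [btw_iff (vtx θ i), h2, arc_self]
    grind
  rw [this]
  exact (isOpen_btw _ _).isClosed_compl

/-- The inverse branch of the doubling map with values in the half circle of index `i`. -/
noncomputable def lift (θ : UnitAddCircle) (i : Bool) (y : UnitAddCircle) : UnitAddCircle :=
  vtx θ i + ((arc (sigma θ) y / 2 : ℝ) : UnitAddCircle)

theorem arc_lift (θ : UnitAddCircle) (i : Bool) (y : UnitAddCircle) :
    arc (vtx θ i) (lift θ i y) = arc (sigma θ) y / 2 :=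
  arc_add_coe (by linarith [arc_nonneg (sigma θ) y]) (by linarith [arc_lt_one (sigma θ) y])

theorem lift_mem_half (θ : UnitAddCircle) (i : Bool) (y : UnitAddCircle) :
    lift θ i y ∈ half θ i := by
  rw [half, Set.mem_ofPred_eq, arc_lift]
  linarith [arc_lt_one (sigma θ) y]

@[simp] theorem sigma_lift (θ : UnitAddCircle) (i : Bool) (y : UnitAddCircle) :
    sigma (lift θ i y) = y := by
  have h := arc_lift θ i y
  have h1 := arc_lt_one (sigma θ) y
  rcases arc_sigma_half (lift_mem_half θ i y) with h' | h'
  · exact arc_inj.1 (h'.2.trans (by linarith))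
  · linarith [h'.1]

theorem eq_of_mem_half {i : Bool} (hx : x ∈ half θ i) (hy : y ∈ half θ i)
    (h : sigma x = sigma y) (hne : sigma x ≠ sigma θ) : x = y := by
  have h1 := arc_sigma_half hx
  have h2 := arc_sigma_half hy
  have h3 : arc (sigma θ) (sigma x) ≠ 0 := fun h' => hne (arc_eq_zero.1 h')
  rw [← arc_inj (c := vtx θ i)]
  rw [h] at h1 h3
  grind

theorem lift_sigma {i : Bool} (hx : x ∈ half θ i) (hne : sigma x ≠ sigma θ) :
    lift θ i (sigma x) = x :=
  eq_of_mem_half (lift_mem_half _ _ _) hx (sigma_lift _ _ _) (by rwa [sigma_lift])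

/-- Two points of one closed half circle with the same image are equal or span the diameter. -/
theorem eq_or_vtx_of_mem_half {i : Bool} (hx : x ∈ half θ i) (hy : y ∈ half θ i)
    (h : sigma x = sigma y) (hne : x ≠ y) :
    (x = vtx θ i ∧ y = vtx θ (!i)) ∨ (x = vtx θ (!i) ∧ y = vtx θ i) := by
  by_cases h0 : sigma x = sigma θ
  · have h1 := (sigma_eq_sigma_iff_vtx i).1 h0
    have h2 := (sigma_eq_sigma_iff_vtx i).1 (h ▸ h0)
    grind
  · exact absurd (eq_of_mem_half hx hy h h0) hne

/-- Pairs of points in opposite closed half circles are not linked. -/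
theorem not_cross_of_half {i : Bool} (hx : x ∈ half θ i) (hy : y ∈ half θ i)
    (hz : z ∈ half θ (!i)) (hw : w ∈ half θ (!i)) : ¬ Cross x y z w := by
  rw [cross_iff (vtx θ i)]
  rw [mem_half_not, ← arc_eq_zero] at hz hw
  have hx' : arc (vtx θ i) x ≤ 1 / 2 := hx
  have hy' : arc (vtx θ i) y ≤ 1 / 2 := hy
  have h1 := arc_nonneg (vtx θ i) x
  have h2 := arc_nonneg (vtx θ i) y
  unfold CrossR
  grind

/-- The doubling map preserves linkedness inside a closed half circle, unless both pairs contain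
an endpoint of the diameter. -/
theorem cross_sigma {i : Bool} (h : Cross x y z w) (hx : x ∈ half θ i) (hy : y ∈ half θ i)
    (hz : z ∈ half θ i) (hw : w ∈ half θ i) :
    Cross (sigma x) (sigma y) (sigma z) (sigma w) ∨
      ((sigma x = sigma θ ∨ sigma y = sigma θ) ∧ (sigma z = sigma θ ∨ sigma w = sigma θ)) := by
  rw [cross_iff (vtx θ i)] at h
  rw [cross_iff (sigma θ), ← arc_eq_zero, ← arc_eq_zero, ← arc_eq_zero, ← arc_eq_zero]
  have h1 := arc_sigma_half hx
  have h2 := arc_sigma_half hy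
  have h3 := arc_sigma_half hz
  have h4 := arc_sigma_half hw
  have k1 := arc_nonneg (vtx θ i) x
  have k2 := arc_nonneg (vtx θ i) y
  have k3 := arc_nonneg (vtx θ i) z
  have k4 := arc_nonneg (vtx θ i) w
  unfold CrossR at *
  rcases h1 with ⟨l1, m1⟩ | ⟨l1, -, m1⟩ <;> rcases h2 with ⟨l2, m2⟩ | ⟨l2, -, m2⟩ <;>
    rcases h3 with ⟨l3, m3⟩ | ⟨l3, -, m3⟩ <;> rcases h4 with ⟨l4, m4⟩ | ⟨l4, -, m4⟩ <;>
    rw [m1, m2, m3, m4] <;> grind (splits := 40)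

/-- Inverse branches preserve linkedness with pairs that avoid the critical value. -/
theorem cross_lift {i : Bool} (hx : x ∈ half θ i) (hy : y ∈ half θ i)
    (h : Cross (sigma x) (sigma y) a b) (ha : a ≠ sigma θ) (hb : b ≠ sigma θ) :
    Cross x y (lift θ i a) (lift θ i b) := by
  rw [cross_iff (sigma θ)] at h
  rw [cross_iff (vtx θ i)]
  have h1 := arc_sigma_half hx
  have h2 := arc_sigma_half hy
  have h3 := arc_pos.2 ha
  have h4 := arc_pos.2 hb
  have h5 := arc_lt_one (sigma θ) a
  have h6 := arc_lt_one (sigma θ) b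
  have h7 : arc (sigma θ) a = 2 * arc (vtx θ i) (lift θ i a) := by rw [arc_lift]; ring
  have h8 : arc (sigma θ) b = 2 * arc (vtx θ i) (lift θ i b) := by rw [arc_lift]; ring
  rw [h7] at h h3 h5
  rw [h8] at h h4 h6
  have e : (1 : ℝ) / 2 * 2 = 1 := by norm_num
  generalize (1 : ℝ) / 2 = s at *
  unfold CrossR at *
  rcases h1 with ⟨l1, m1⟩ | ⟨l1, -, m1⟩ <;> rcases h2 with ⟨l2, m2⟩ | ⟨l2, -, m2⟩ <;>
    rw [m1, m2] at h <;> grind (splits := 40)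

/-- Points that are not in a common closed half circle are separated by the diameter. -/
theorem cross_vtx {i : Bool} (h : ∀ j, ¬ (x ∈ half θ j ∧ y ∈ half θ j)) :
    Cross x y (vtx θ i) (vtx θ (!i)) := by
  rw [cross_iff (vtx θ i), arc_self, ← opp_vtx, arc_opp_self]
  have h1 := h i
  have h2 := h (!i)
  rw [mem_half_not, mem_half_not] at h2
  have h3 := arc_nonneg (vtx θ i) x
  have h4 := arc_nonneg (vtx θ i) y
  simp only [half, Set.mem_ofPred_eq] at h1
  simp only [← arc_eq_zero] at h2
  unfold CrossR
  grind

theorem half_of_not_cross {i : Bool} (h : ¬ Cross x y (vtx θ i) (vtx θ (!i))) :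
    ∃ j, x ∈ half θ j ∧ y ∈ half θ j := by
  by_contra h'
  push Not at h'
  exact h (cross_vtx fun j hj => h' j hj.1 hj.2)

/-! ### Itineraries -/

theorem sigma_iterate (n : ℕ) (x : UnitAddCircle) : sigma^[n] x = (2 ^ n) • x := by
  induction n generalizing x with
  | zero => simp
  | succ n ih => rw [Function.iterate_succ_apply, ih, sigma, pow_succ, mul_smul]

/-- When the critical value `σ(θ)` is not periodic, an orbit passes at most once through the
endpoints of the critical diameter. -/
theorem hit_unique (hper : sigma θ ∉ Function.periodicPts sigma)
    (hn : sigma^[n + 1] x = sigma θ) (hm : sigma^[m + 1] x = sigma θ) : n = m := by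
  have key : ∀ {n m : ℕ}, sigma^[n + 1] x = sigma θ → sigma^[m + 1] x = sigma θ → ¬ n < m := by
    intro n m hn hm hlt
    obtain ⟨k, rfl⟩ := Nat.exists_eq_add_of_lt hlt
    refine hper (Function.mem_periodicPts.2 ⟨k + 1, k.succ_pos, ?_⟩)
    have : n + k + 1 + 1 = (k + 1) + (n + 1) := by ring
    rw [this, Function.iterate_add_apply, hn] at hm
    exact hm
  rcases lt_trichotomy n m with h | h | h
  · exact absurd h (key hn hm)
  · exact h
  · exact absurd h (key hm hn)

theorem sigma_iterate_value_ne (hper : sigma θ ∉ Function.periodicPts sigma) (n : ℕ) :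
    sigma^[n + 1] (sigma θ) ≠ sigma θ := fun h =>
  hper (Function.mem_periodicPts.2 ⟨n + 1, n.succ_pos, h⟩)

/-- The points of `𝕋` that have `s` as an itinerary with respect to the two closed half circles
bounded by `θ` and `θ + 1/2`. An endpoint of the diameter may be given either symbol. The convex
hull of such a set is called the gap with itinerary `s`; it may be a point or a chord. -/
def fiber (θ : UnitAddCircle) (s : ℕ → Bool) : Set UnitAddCircle :=
  {x | ∀ n, sigma^[n] x ∈ half θ (s n)}

/-- The shift map on symbol sequences. -/
def shift (s : ℕ → Bool) : ℕ → Bool := fun n => s (n + 1)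

/-- The symbol sequence `s` preceded by the symbol `i`. -/
def consSeq (i : Bool) (s : ℕ → Bool) : ℕ → Bool := fun n => Nat.casesOn n i s

@[simp] theorem shift_consSeq (i : Bool) (s : ℕ → Bool) : shift (consSeq i s) = s := rfl

@[simp] theorem consSeq_zero (i : Bool) (s : ℕ → Bool) : consSeq i s 0 = i := rfl

theorem shift_iterate (k n : ℕ) (s : ℕ → Bool) : shift^[k] s n = s (n + k) := by
  induction k generalizing s with
  | zero => rfl
  | succ k ih => rw [Function.iterate_succ_apply, ih]; rfl

theorem mem_fiber_iff : x ∈ fiber θ s ↔ x ∈ half θ (s 0) ∧ sigma x ∈ fiber θ (shift s) :=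
  ⟨fun h => ⟨h 0, fun n => h (n + 1)⟩, fun h n => by
    cases n with
    | zero => exact h.1
    | succ n => exact h.2 n⟩

theorem mem_fiber_iterate (h : x ∈ fiber θ s) (k : ℕ) :
    sigma^[k] x ∈ fiber θ (shift^[k] s) := fun n => by
  rw [shift_iterate, ← Function.iterate_add_apply]
  exact h (n + k)

theorem isClosed_fiber (θ : UnitAddCircle) (s : ℕ → Bool) : IsClosed (fiber θ s) := by
  have : fiber θ s = ⋂ n, sigma^[n] ⁻¹' half θ (s n) := by
    ext x; simp [fiber]
  rw [this]
  exact isClosed_iInter fun n => (isClosed_half θ _).preimage (continuous_sigma.iterate n)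

/-- The points `x` and `y` have a common itinerary. -/
def Comp (θ x y : UnitAddCircle) : Prop := ∃ s, x ∈ fiber θ s ∧ y ∈ fiber θ s

theorem Comp.symm (h : Comp θ x y) : Comp θ y x := by
  obtain ⟨s, h1, h2⟩ := h
  exact ⟨s, h2, h1⟩

/-- Points that pairwise have common itineraries all have a common itinerary. There are only two
symbols, so at each time two points without a common symbol would have to exist otherwise. -/
theorem exists_fiber_of_pairwise {A : Set UnitAddCircle}
    (h : ∀ x ∈ A, ∀ y ∈ A, Comp θ x y) : ∃ s, A ⊆ fiber θ s := by
  have : ∀ n, ∃ i, ∀ x ∈ A, sigma^[n] x ∈ half θ i := by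
    intro n
    by_contra hc
    push Not at hc
    obtain ⟨x, hx, hx'⟩ := hc false
    obtain ⟨y, hy, hy'⟩ := hc true
    obtain ⟨s, h1, h2⟩ := h x hx y hy
    have h1 := h1 n
    have h2 := h2 n
    cases hs : s n <;> rw [hs] at h1 h2 <;> contradiction
  choose s hs using this
  exact ⟨s, fun x hx n => hs n x hx⟩

theorem exists_mem_fiber (θ x : UnitAddCircle) : ∃ s, x ∈ fiber θ s := by
  have : ∀ n, ∃ i, sigma^[n] x ∈ half θ i := fun n =>
    (mem_half_or θ (sigma^[n] x) false).elim (fun h => ⟨_, h⟩) (fun h => ⟨_, h⟩)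
  choose s hs using this
  exact ⟨s, hs⟩

theorem bool_eq_not {i j : Bool} (h : i ≠ j) : j = !i := by
  cases i <;> cases j <;> simp_all

theorem fiber_unique (hx : x ∈ fiber θ s) (hx' : x ∈ fiber θ t)
    (h : ∀ n, sigma^[n + 1] x ≠ sigma θ) : s = t := by
  funext n
  by_contra hne
  have h1 := hx n
  have h2 := hx' n
  rw [bool_eq_not hne] at h2
  apply h n
  rw [Function.iterate_succ_apply']
  exact sigma_eq_of_mem_half h1 h2

theorem fiber_unique_value (hper : sigma θ ∉ Function.periodicPts sigma)
    (h : sigma θ ∈ fiber θ s) (h' : sigma θ ∈ fiber θ t) : s = t :=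
  fiber_unique h h' (sigma_iterate_value_ne hper)

/-- Linked pairs with itineraries `s` and `t` have `s = t`: the convex hulls of distinct sets
`fiber θ s` do not cross each other. -/
theorem fiber_eq_of_cross (hper : sigma θ ∉ Function.periodicPts sigma)
    (hx : x ∈ fiber θ s) (hy : y ∈ fiber θ s) (hz : z ∈ fiber θ t) (hw : w ∈ fiber θ t)
    (h : Cross x y z w) : s = t := by
  have key : ∀ (n : ℕ) (s t : ℕ → Bool) (x y z w : UnitAddCircle), x ∈ fiber θ s →
      y ∈ fiber θ s → z ∈ fiber θ t → w ∈ fiber θ t → Cross x y z w → s n = t n := by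
    intro n
    induction n with
    | zero =>
      intro s t x y z w hx hy hz hw h
      by_contra hne
      have hz := hz 0
      have hw := hw 0
      rw [bool_eq_not hne] at hz hw
      exact not_cross_of_half (hx 0) (hy 0) hz hw h
    | succ n ih =>
      intro s t x y z w hx hy hz hw h
      have h0 : s 0 = t 0 := by
        by_contra hne
        have hz := hz 0
        have hw := hw 0
        rw [bool_eq_not hne] at hz hw
        exact not_cross_of_half (hx 0) (hy 0) hz hw h
      have hx1 := mem_fiber_iff.1 hx
      have hy1 := mem_fiber_iff.1 hy
      have hz1 := mem_fiber_iff.1 hz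
      have hw1 := mem_fiber_iff.1 hw
      rw [← h0] at hz1 hw1
      rcases cross_sigma h hx1.1 hy1.1 hz1.1 hw1.1 with h' | ⟨h1, h2⟩
      · exact ih (shift s) (shift t) _ _ _ _ hx1.2 hy1.2 hz1.2 hw1.2 h'
      · have e1 : sigma θ ∈ fiber θ (shift s) := by
          rcases h1 with h1 | h1 <;> rw [← h1]
          exacts [hx1.2, hy1.2]
        have e2 : sigma θ ∈ fiber θ (shift t) := by
          rcases h2 with h2 | h2 <;> rw [← h2]
          exacts [hz1.2, hw1.2]
        exact congrFun (fiber_unique_value hper e1 e2) n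
  funext n
  exact key n s t x y z w hx hy hz hw h

/-! ### Precritical leaves -/

/-- The pair `a, b` is a precritical leaf of level `n`: the two points lie in a common closed half
circle at all times before `n`, and at time `n` they are the endpoints of the diameter. -/
def Lev (θ : UnitAddCircle) : ℕ → UnitAddCircle → UnitAddCircle → Prop
  | 0, a, b => (a = θ ∧ b = opp θ) ∨ (a = opp θ ∧ b = θ)
  | n + 1, a, b => (∃ i, a ∈ half θ i ∧ b ∈ half θ i) ∧ Lev θ n (sigma a) (sigma b)

/-- The pair `a, b` is a precritical leaf. -/
def Leaf (θ a b : UnitAddCircle) : Prop := ∃ n, Lev θ n a b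

theorem Lev.symm (h : Lev θ n a b) : Lev θ n b a := by
  induction n generalizing a b with
  | zero => exact h.elim (fun h => Or.inr ⟨h.2, h.1⟩) (fun h => Or.inl ⟨h.2, h.1⟩)
  | succ n ih =>
    obtain ⟨⟨i, h1, h2⟩, h⟩ := h
    exact ⟨⟨i, h2, h1⟩, ih h⟩

theorem Leaf.symm (h : Leaf θ a b) : Leaf θ b a := h.imp fun _ h => h.symm

theorem lev_vtx (θ : UnitAddCircle) (i : Bool) : Lev θ 0 (vtx θ i) (vtx θ (!i)) := by
  cases i
  · exact Or.inl ⟨rfl, rfl⟩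
  · exact Or.inr ⟨rfl, rfl⟩

theorem Lev.hit (h : Lev θ n a b) : sigma^[n + 1] a = sigma θ := by
  induction n generalizing a b with
  | zero => rcases h with h | h <;> simp [h.1]
  | succ n ih => exact ih h.2

theorem Lev.ne (h : Lev θ n a b) : a ≠ b := by
  induction n generalizing a b with
  | zero =>
    rcases h with ⟨rfl, rfl⟩ | ⟨rfl, rfl⟩
    exacts [(opp_ne _).symm, opp_ne _]
  | succ n ih => exact fun hab => ih h.2 (congrArg sigma hab)

theorem Leaf.ne (h : Leaf θ a b) : a ≠ b := h.elim fun _ h => h.ne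

theorem Leaf.ne_value (hper : sigma θ ∉ Function.periodicPts sigma) (h : Leaf θ a b) :
    a ≠ sigma θ := by
  rintro rfl
  obtain ⟨n, h⟩ := h
  exact sigma_iterate_value_ne hper n h.hit

/-- Endpoints of precritical leaves are not periodic. -/
theorem Leaf.not_periodic (hper : sigma θ ∉ Function.periodicPts sigma) (h : Leaf θ a b)
    (hm : 0 < m) : sigma^[m] a ≠ a := by
  intro ha
  obtain ⟨n, h⟩ := h
  have h1 : sigma^[(n + m) + 1] a = sigma θ := by
    rw [show n + m + 1 = (n + 1) + m by ring, Function.iterate_add_apply, ha]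
    exact h.hit
  have := hit_unique hper h.hit h1
  omega

theorem Lev.unique (hper : sigma θ ∉ Function.periodicPts sigma) (h : Lev θ n a b)
    (h' : Lev θ m a c) : n = m ∧ b = c := by
  obtain rfl := hit_unique hper h.hit h'.hit
  refine ⟨rfl, ?_⟩
  induction n generalizing a b c with
  | zero =>
    rcases h with ⟨rfl, rfl⟩ | ⟨rfl, rfl⟩ <;> rcases h' with ⟨h1, rfl⟩ | ⟨h1, rfl⟩
    · rfl
    · exact absurd h1.symm (opp_ne _)
    · exact absurd h1 (opp_ne _)
    · rfl
  | succ n ih =>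
    have hit := h.hit
    have hitb := h.symm.hit
    obtain ⟨⟨i, h1, h2⟩, h⟩ := h
    obtain ⟨⟨j, h3, h4⟩, h'⟩ := h'
    have hbc := ih h h'
    have hij : i = j := by
      by_contra hne
      rw [bool_eq_not hne] at h3
      have := hit_unique (n := 0) hper (sigma_eq_of_mem_half h1 h3) hit
      omega
    subst hij
    refine eq_of_mem_half h2 h4 hbc fun hv => ?_
    have := hit_unique (n := 0) hper hv hitb
    omega

theorem Leaf.unique (hper : sigma θ ∉ Function.periodicPts sigma) (h : Leaf θ a b)
    (h' : Leaf θ a c) : b = c := by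
  obtain ⟨n, h⟩ := h
  obtain ⟨m, h'⟩ := h'
  exact (h.unique hper h').2

/-- A point that is mapped to the critical diameter is an endpoint of a precritical leaf. -/
theorem exists_lev_of_hit (h : sigma^[n + 1] a = sigma θ) : ∃ b, Lev θ n a b := by
  induction n generalizing a with
  | zero =>
    have h : sigma a = sigma θ := h
    rcases (sigma_eq_sigma_iff_vtx false).1 h with h | h
    · exact ⟨_, h ▸ lev_vtx θ false⟩
    · exact ⟨_, h ▸ lev_vtx θ true⟩
  | succ n ih =>
    obtain ⟨b, hb⟩ := ih (a := sigma a) h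
    obtain ⟨s, hs⟩ := exists_mem_fiber θ a
    exact ⟨lift θ (s 0) b, ⟨s 0, hs 0, lift_mem_half _ _ _⟩, by rwa [sigma_lift]⟩

theorem Lev.lift (h : Lev θ n a b) (i : Bool) : Lev θ (n + 1) (lift θ i a) (lift θ i b) :=
  ⟨⟨i, lift_mem_half _ _ _, lift_mem_half _ _ _⟩, by rwa [sigma_lift, sigma_lift]⟩

theorem Leaf.lift (h : Leaf θ a b) (i : Bool) : Leaf θ (lift θ i a) (lift θ i b) :=
  h.elim fun _ h => ⟨_, h.lift i⟩

/-- A precritical leaf lies in two different sets of points with a common itinerary, one for each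
of its sides. -/
theorem Leaf.exists_fibers (h : Leaf θ a b) :
    ∃ s t, s ≠ t ∧ a ∈ fiber θ s ∧ b ∈ fiber θ s ∧ a ∈ fiber θ t ∧ b ∈ fiber θ t := by
  obtain ⟨n, h⟩ := h
  induction n generalizing a b with
  | zero =>
    obtain ⟨s, hs⟩ := exists_mem_fiber θ (sigma θ)
    have key : ∀ i j : Bool, vtx θ i ∈ fiber θ (consSeq j s) := fun i j =>
      mem_fiber_iff.2 ⟨vtx_mem_half θ i j, by simpa using hs⟩
    have hab : ∃ i j, a = vtx θ i ∧ b = vtx θ j := by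
      rcases h with ⟨rfl, rfl⟩ | ⟨rfl, rfl⟩
      exacts [⟨false, true, rfl, rfl⟩, ⟨true, false, rfl, rfl⟩]
    obtain ⟨i, j, rfl, rfl⟩ := hab
    exact ⟨consSeq false s, consSeq true s, fun h => by simpa using congrFun h 0,
      key _ _, key _ _, key _ _, key _ _⟩
  | succ n ih =>
    obtain ⟨⟨i, h1, h2⟩, h⟩ := h
    obtain ⟨s, t, hst, a1, a2, a3, a4⟩ := ih h
    exact ⟨consSeq i s, consSeq i t, fun h => hst (congrArg shift h),
      mem_fiber_iff.2 ⟨h1, a1⟩, mem_fiber_iff.2 ⟨h2, a2⟩, mem_fiber_iff.2 ⟨h1, a3⟩,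
      mem_fiber_iff.2 ⟨h2, a4⟩⟩

theorem Leaf.comp (h : Leaf θ a b) : Comp θ a b := by
  obtain ⟨s, t, -, h1, h2, -⟩ := h.exists_fibers
  exact ⟨s, h1, h2⟩

theorem leaf_of_mem_half {i : Bool} (hx : x ∈ half θ i) (hy : y ∈ half θ i)
    (h : sigma x = sigma y) (hne : x ≠ y) : Leaf θ x y := by
  rcases eq_or_vtx_of_mem_half hx hy h hne with ⟨rfl, rfl⟩ | ⟨rfl, rfl⟩
  · exact ⟨0, lev_vtx θ i⟩
  · exact ⟨0, (lev_vtx θ i).symm⟩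

theorem leaf_of_sigma {i : Bool} (hx : x ∈ half θ i) (hy : y ∈ half θ i)
    (h : Leaf θ (sigma x) (sigma y)) : Leaf θ x y :=
  h.elim fun n h => ⟨n + 1, ⟨i, hx, hy⟩, h⟩

/-- Two distinct points with two common itineraries span a precritical leaf. -/
theorem leaf_of_two_fibers (hst : s ≠ t)
    (hxs : x ∈ fiber θ s) (hys : y ∈ fiber θ s) (hxt : x ∈ fiber θ t) (hyt : y ∈ fiber θ t)
    (hne : x ≠ y) : Leaf θ x y := by
  obtain ⟨n, hn⟩ := Function.ne_iff.1 hst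
  clear hst
  induction n generalizing s t x y with
  | zero =>
    have h1 := hxt 0
    have h2 := hyt 0
    rw [bool_eq_not hn] at h1 h2
    exact leaf_of_mem_half (hxs 0) (hys 0) ((sigma_eq_of_mem_half (hxs 0) h1).trans
      (sigma_eq_of_mem_half (hys 0) h2).symm) hne
  | succ n ih =>
    rw [mem_fiber_iff] at hxs hys hxt hyt
    by_cases hσ : sigma x = sigma y
    · exact leaf_of_mem_half hxs.1 hys.1 hσ hne
    · exact leaf_of_sigma hxs.1 hys.1 (ih hxs.2 hys.2 hxt.2 hyt.2 hσ hn)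

/-- Two distinct points with a common itinerary whose orbits merge span a precritical leaf. -/
theorem leaf_of_iterate_eq (hxs : x ∈ fiber θ s) (hys : y ∈ fiber θ s)
    (hne : x ≠ y) (h : sigma^[n] x = sigma^[n] y) : Leaf θ x y := by
  induction n generalizing s x y with
  | zero => exact absurd h hne
  | succ n ih =>
    rw [mem_fiber_iff] at hxs hys
    by_cases hσ : sigma x = sigma y
    · exact leaf_of_mem_half hxs.1 hys.1 hσ hne
    · exact leaf_of_sigma hxs.1 hys.1 (ih hxs.2 hys.2 hσ h)

theorem Leaf.not_cross_comp (hper : sigma θ ∉ Function.periodicPts sigma) (h : Leaf θ a b)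
    (hxy : Comp θ x y) : ¬ Cross a b x y := by
  intro hc
  obtain ⟨s, hx, hy⟩ := hxy
  obtain ⟨t, u, htu, h1, h2, h3, h4⟩ := h.exists_fibers
  exact htu ((fiber_eq_of_cross hper h1 h2 hx hy hc).trans
    (fiber_eq_of_cross hper h3 h4 hx hy hc).symm)

theorem Leaf.not_cross (hper : sigma θ ∉ Function.periodicPts sigma) (h : Leaf θ a b)
    (h' : Leaf θ c d) : ¬ Cross a b c d := h.not_cross_comp hper h'.comp

/-- Points without a common itinerary are separated by a precritical leaf: pull the diameter back
from the first time at which it separates the two orbits. -/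
theorem exists_leaf_cross (hper : sigma θ ∉ Function.periodicPts sigma) (h : ¬ Comp θ x y) :
    ∃ a b, Leaf θ a b ∧ Cross x y a b := by
  have : ∃ n, ∀ i, ¬ (sigma^[n] x ∈ half θ i ∧ sigma^[n] y ∈ half θ i) := by
    by_contra hc
    push Not at hc
    choose s hs using hc
    exact h ⟨s, fun n => (hs n).1, fun n => (hs n).2⟩
  obtain ⟨n, hn⟩ := this
  clear h
  induction n generalizing x y with
  | zero => exact ⟨_, _, ⟨0, lev_vtx θ false⟩, cross_vtx hn⟩
  | succ n ih =>
    by_cases h0 : ∃ i, x ∈ half θ i ∧ y ∈ half θ i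
    · obtain ⟨i, hx, hy⟩ := h0
      obtain ⟨a, b, hab, hc⟩ := ih (x := sigma x) (y := sigma y) hn
      exact ⟨_, _, hab.lift i,
        cross_lift hx hy hc (hab.ne_value hper) (hab.symm.ne_value hper)⟩
    · push Not at h0
      exact ⟨_, _, ⟨0, lev_vtx θ false⟩, cross_vtx fun i hi => h0 i hi.1 hi.2⟩

theorem comp_of_not_cross (hper : sigma θ ∉ Function.periodicPts sigma)
    (h : ∀ a b, Leaf θ a b → ¬ Cross x y a b) : Comp θ x y := by
  by_contra hc
  obtain ⟨a, b, h1, h2⟩ := exists_leaf_cross hper hc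
  exact h a b h1 h2

theorem comp_self (θ x : UnitAddCircle) : Comp θ x x := by
  obtain ⟨s, hs⟩ := exists_mem_fiber θ x
  exact ⟨s, hs, hs⟩

/-- The relation of having a common itinerary is closed. -/
theorem isClosed_comp (θ : UnitAddCircle) :
    IsClosed {p : UnitAddCircle × UnitAddCircle | Comp θ p.1 p.2} := by
  have : {p : UnitAddCircle × UnitAddCircle | Comp θ p.1 p.2} =
      ⋂ n, (fun p : UnitAddCircle × UnitAddCircle => (sigma^[n] p.1, sigma^[n] p.2)) ⁻¹'
        ((half θ false ×ˢ half θ false) ∪ (half θ true ×ˢ half θ true)) := by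
    ext ⟨x, y⟩
    simp only [Set.mem_ofPred_eq, Set.mem_iInter, Set.mem_preimage, Set.mem_union, Set.mem_prod]
    constructor
    · rintro ⟨s, hx, hy⟩ n
      have h1 := hx n
      have h2 := hy n
      cases hs : s n <;> rw [hs] at h1 h2
      · exact Or.inl ⟨h1, h2⟩
      · exact Or.inr ⟨h1, h2⟩
    · intro h
      have : ∀ n, ∃ i, sigma^[n] x ∈ half θ i ∧ sigma^[n] y ∈ half θ i := fun n =>
        (h n).elim (fun h => ⟨_, h⟩) (fun h => ⟨_, h⟩)
      choose s hs using this
      exact ⟨s, fun n => (hs n).1, fun n => (hs n).2⟩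
  rw [this]
  refine isClosed_iInter fun n => IsClosed.preimage ?_ ?_
  · exact ((continuous_sigma.iterate n).comp continuous_fst).prodMk
      ((continuous_sigma.iterate n).comp continuous_snd)
  · exact ((isClosed_half _ _).prod (isClosed_half _ _)).union
      ((isClosed_half _ _).prod (isClosed_half _ _))

/-- Every open arc contains an endpoint of a precritical leaf. -/
theorem exists_leaf_btw (hxy : x ≠ y) : ∃ a b, Leaf θ a b ∧ Btw x a y := by
  have hl : 0 < arc x y := arc_pos.2 hxy.symm
  obtain ⟨n, hn⟩ := pow_unbounded_of_one_lt (1 / arc x y) (one_lt_two : (1 : ℝ) < 2)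
  rw [div_lt_iff₀ hl] at hn
  have h2 : (0 : ℝ) < 2 ^ n := by positivity
  set τ := arc (sigma^[n + 1] x) (sigma θ) with hτ
  have hτ0 : 0 ≤ τ := arc_nonneg _ _
  have hτ1 : τ < 1 := arc_lt_one _ _
  set t : ℝ := (τ + 1) / 2 ^ (n + 1) with ht
  have h3 : (2 : ℝ) ^ (n + 1) = 2 ^ n * 2 := pow_succ _ _
  have ht0 : 0 < t := by positivity
  have ht1 : t < arc x y := by
    rw [ht, div_lt_iff₀ (by positivity), h3]; nlinarith
  have hA := arc_add_coe (a := x) ht0.le (ht1.trans (arc_lt_one x y))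
  have hit : sigma^[n + 1] (x + (t : UnitAddCircle)) = sigma θ := by
    rw [sigma_iterate, smul_add, ← AddCircle.coe_nsmul, ← sigma_iterate]
    have : ((2 ^ (n + 1)) • t : ℝ) = τ + 1 := by
      rw [nsmul_eq_mul, ht]; push_cast; field_simp
    rw [this, AddCircle.coe_add, coe_one_eq_zero, add_zero, hτ, add_coe_arc]
  obtain ⟨b, hb⟩ := exists_lev_of_hit hit
  exact ⟨_, b, ⟨_, hb⟩, by rwa [hA], by rwa [hA]⟩

/-! ### Chords of the unit disk -/

theorem pt_injective : Function.Injective pt := fun _ _ h =>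
  AddCircle.injective_toCircle one_ne_zero (Subtype.ext h)

theorem continuous_pt : Continuous pt := by
  unfold pt
  exact continuous_subtype_val.comp AddCircle.continuous_toCircle

theorem exists_pt_eq {k : ℂ} (hk : k ∈ Metric.sphere (0 : ℂ) 1) : ∃ x, pt x = k := by
  have h1 : ‖k‖ = 1 := by simpa using hk
  refine ⟨((Complex.arg k / (2 * Real.pi) : ℝ) : UnitAddCircle), ?_⟩
  have hpi := Real.pi_ne_zero
  rw [pt, AddCircle.toCircle_apply_mk, Circle.coe_exp]
  have := Complex.norm_mul_exp_arg_mul_I k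
  rw [h1] at this
  rw [show 2 * Real.pi / 1 * (Complex.arg k / (2 * Real.pi)) = Complex.arg k by field_simp]
  simpa using this

theorem pt_coe_re (t : ℝ) : (pt (t : UnitAddCircle)).re = Real.cos (2 * Real.pi * t) := by
  rw [pt, AddCircle.toCircle_apply_mk, Circle.coe_exp, Complex.exp_ofReal_mul_I_re, div_one]

theorem pt_coe_im (t : ℝ) : (pt (t : UnitAddCircle)).im = Real.sin (2 * Real.pi * t) := by
  rw [pt, AddCircle.toCircle_apply_mk, Circle.coe_exp, Complex.exp_ofReal_mul_I_im, div_one]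

/-- The affine functional that vanishes on the line through `pt a` and `pt b`. It is negative on
the arc from `a` to `b` and positive on the arc from `b` to `a`. -/
noncomputable def side (a b : UnitAddCircle) (k : ℂ) : ℝ :=
  (k.im - (pt a).im) * ((pt b).re - (pt a).re) - (k.re - (pt a).re) * ((pt b).im - (pt a).im)

theorem side_pt (a b x : UnitAddCircle) : side a b (pt x) =
    4 * Real.sin (Real.pi * arc a x) * Real.sin (Real.pi * arc a b) *
      Real.sin (Real.pi * arc a x - Real.pi * arc a b) := by
  obtain ⟨α, rfl⟩ := QuotientAddGroup.mk_surjective a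
  have hx : x = ((α + arc (α : UnitAddCircle) x : ℝ) : UnitAddCircle) := by
    rw [AddCircle.coe_add, coe_arc]; abel
  have hb : b = ((α + arc (α : UnitAddCircle) b : ℝ) : UnitAddCircle) := by
    rw [AddCircle.coe_add, coe_arc]; abel
  change side (α : UnitAddCircle) b (pt x) = 4 * Real.sin (Real.pi * arc (α : UnitAddCircle) x) *
    Real.sin (Real.pi * arc (α : UnitAddCircle) b) *
      Real.sin (Real.pi * arc (α : UnitAddCircle) x - Real.pi * arc (α : UnitAddCircle) b)
  generalize arc (α : UnitAddCircle) x = ξ at *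
  generalize arc (α : UnitAddCircle) b = β at *
  subst hx hb
  simp only [side, pt_coe_re, pt_coe_im]
  rw [show 2 * Real.pi * (α + ξ) = 2 * Real.pi * α + 2 * (Real.pi * ξ) by ring,
    show 2 * Real.pi * (α + β) = 2 * Real.pi * α + 2 * (Real.pi * β) by ring]
  simp only [Real.cos_add, Real.sin_add, Real.sin_sub, Real.cos_two_mul, Real.sin_two_mul]
  generalize 2 * Real.pi * α = A
  generalize Real.pi * ξ = u
  generalize Real.pi * β = v
  have hA := Real.sin_sq_add_cos_sq A
  have hu : Real.cos u ^ 2 = 1 - Real.sin u ^ 2 := by linarith [Real.sin_sq_add_cos_sq u]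
  have hv : Real.cos v ^ 2 = 1 - Real.sin v ^ 2 := by linarith [Real.sin_sq_add_cos_sq v]
  rw [hu, hv]
  linear_combination (4 * Real.sin u * Real.sin v *
    (Real.sin u * Real.cos v - Real.cos u * Real.sin v)) * hA

theorem side_neg (h : Btw a x b) : side a b (pt x) < 0 := by
  obtain ⟨h1, h2⟩ := h
  have h3 := arc_lt_one a b
  have hpi := Real.pi_pos
  rw [side_pt]
  have k1 : 0 < Real.sin (Real.pi * arc a x) :=
    Real.sin_pos_of_pos_of_lt_pi (by positivity) (by nlinarith)
  have k2 : 0 < Real.sin (Real.pi * arc a b) :=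
    Real.sin_pos_of_pos_of_lt_pi (mul_pos hpi (h1.trans h2)) (by nlinarith)
  have k3 : Real.sin (Real.pi * arc a x - Real.pi * arc a b) < 0 :=
    Real.sin_neg_of_neg_of_neg_pi_lt (by nlinarith) (by nlinarith)
  exact mul_neg_of_pos_of_neg (by positivity) k3

theorem side_pos (h : Btw b x a) : 0 < side a b (pt x) := by
  have hab := h.ne
  rw [btw_iff a, arc_self] at h
  have h0 : 0 < arc a b := arc_pos.2 hab.2.2
  have h1 := arc_nonneg a x
  have h4 : arc a b < arc a x := by grind
  have h3 := arc_lt_one a x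
  have hpi := Real.pi_pos
  rw [side_pt]
  have k1 : 0 < Real.sin (Real.pi * arc a x) :=
    Real.sin_pos_of_pos_of_lt_pi (mul_pos hpi (h0.trans h4)) (by nlinarith)
  have k2 : 0 < Real.sin (Real.pi * arc a b) :=
    Real.sin_pos_of_pos_of_lt_pi (by positivity) (by nlinarith)
  have k3 : 0 < Real.sin (Real.pi * arc a x - Real.pi * arc a b) :=
    Real.sin_pos_of_pos_of_lt_pi (by nlinarith) (by nlinarith)
  positivity

@[simp] theorem side_left (a b : UnitAddCircle) : side a b (pt a) = 0 := by simp [side]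

@[simp] theorem side_right (a b : UnitAddCircle) : side a b (pt b) = 0 := by
  simp only [side]; ring

theorem continuous_side (a b : UnitAddCircle) : Continuous (side a b) := by
  unfold side; fun_prop

theorem side_combo (a b : UnitAddCircle) (p q : ℂ) {u v : ℝ} (h : u + v = 1) :
    side a b (u • p + v • q) = u * side a b p + v * side a b q := by
  obtain rfl : v = 1 - u := by linarith
  simp only [side, Complex.add_re, Complex.add_im, Complex.real_smul, Complex.mul_re,
    Complex.mul_im, Complex.ofReal_re, Complex.ofReal_im]
  ring

theorem combo_neg {u v f g : ℝ} (hu : 0 ≤ u) (hv : 0 ≤ v) (huv : u + v = 1) (hf : f < 0)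
    (hg : g < 0) : u * f + v * g < 0 := by
  rcases hu.eq_or_lt with rfl | hu
  · obtain rfl : v = 1 := by linarith
    linarith
  · nlinarith [mul_nonneg hv (neg_nonneg.2 hg.le), mul_pos hu (neg_pos.2 hf)]

/-- Points of a chord on the closed negative side of a line, when both endpoints are on the closed
nonnegative side and only `pt z` may lie on the line. -/
theorem eq_pt_of_side_nonpos {k : ℂ} (hk : k ∈ segment ℝ (pt d) (pt e))
    (hd : 0 ≤ side a b (pt d)) (he : 0 ≤ side a b (pt e)) (h : side a b k ≤ 0)
    (hd' : side a b (pt d) = 0 → d = z) (he' : side a b (pt e) = 0 → e = z) : k = pt z := by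
  obtain ⟨u, v, hu, hv, huv, rfl⟩ := hk
  rw [side_combo _ _ _ _ huv] at h
  have h1 := mul_nonneg hu hd
  have h2 := mul_nonneg hv he
  have h3 : u * side a b (pt d) = 0 := by linarith
  have h4 : v * side a b (pt e) = 0 := by linarith
  rcases mul_eq_zero.1 h3 with h3 | h3
  · obtain rfl : v = 1 := by linarith
    rw [he' (by linarith), h3]; simp
  · rw [hd' h3]
    rcases mul_eq_zero.1 h4 with h4 | h4
    · obtain rfl : u = 1 := by linarith
      rw [h4]; simp
    · rw [he' h4, ← add_smul, huv, one_smul]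

theorem chords_disjoint (h : ¬ Cross a b c d) (hac : a ≠ c) (had : a ≠ d) (hbc : b ≠ c)
    (hbd : b ≠ d) (hcd : c ≠ d) : Disjoint (chord (a, b)) (chord (c, d)) := by
  rw [Set.disjoint_left]
  rintro k ⟨u, v, hu, hv, huv, rfl⟩ ⟨u', v', hu', hv', huv', hk⟩
  have hk := congrArg (side c d) hk
  rw [side_combo _ _ _ _ huv, side_combo _ _ _ _ huv'] at hk
  simp only [side_left, side_right, mul_zero, add_zero] at hk
  rcases btw_cases c a d hac had hcd with h1 | h1 <;>
    rcases btw_cases c b d hbc hbd hcd with h2 | h2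
  · have := combo_neg hu hv huv (side_neg h1) (side_neg h2)
    linarith
  · exact h (Cross.symm (Or.inl ⟨h1, h2⟩))
  · exact h (Cross.symm (Or.inr ⟨h2, h1⟩))
  · have := combo_neg hu hv huv (neg_neg_of_pos (side_pos h1)) (neg_neg_of_pos (side_pos h2))
    linarith

theorem exists_mem_chords (h : Cross a b c d) : ∃ k, k ∈ chord (a, b) ∧ k ∈ chord (c, d) := by
  have key : ∀ {f g : ℝ}, (f < 0 ∧ 0 < g) ∨ (0 < f ∧ g < 0) →
      ∃ u v : ℝ, 0 ≤ u ∧ 0 ≤ v ∧ u + v = 1 ∧ u * f + v * g = 0 := by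
    intro f g h
    rcases h with ⟨h1, h2⟩ | ⟨h1, h2⟩
    · refine ⟨g / (g - f), -f / (g - f), div_nonneg h2.le (by linarith),
        div_nonneg (by linarith) (by linarith), ?_, ?_⟩ <;>
        field_simp [show g - f ≠ 0 by linarith] <;> ring
    · refine ⟨-g / (f - g), f / (f - g), div_nonneg (by linarith) (by linarith),
        div_nonneg h1.le (by linarith), ?_, ?_⟩ <;>
        field_simp [show f - g ≠ 0 by linarith] <;> ring
  have sgn : ∀ {a b c d : UnitAddCircle}, Cross a b c d →
      (side c d (pt a) < 0 ∧ 0 < side c d (pt b)) ∨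
        (0 < side c d (pt a) ∧ side c d (pt b) < 0) := by
    intro a b c d h
    rcases h.symm with h | h
    · exact Or.inl ⟨side_neg h.1, side_pos h.2⟩
    · exact Or.inr ⟨side_pos h.2, side_neg h.1⟩
  obtain ⟨u, v, hu, hv, huv, h0⟩ := key (sgn h)
  obtain ⟨u', v', hu', hv', huv', h0'⟩ := key (sgn h.symm)
  refine ⟨u • pt a + v • pt b, ⟨u, v, hu, hv, huv, rfl⟩, u', v', hu', hv', huv', ?_⟩
  -- The two convex combinations lie on both lines, and two distinct lines meet only once.
  have e1 : side c d (u • pt a + v • pt b) = 0 := by rw [side_combo _ _ _ _ huv, h0]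
  have e2 : side a b (u' • pt c + v' • pt d) = 0 := by rw [side_combo _ _ _ _ huv', h0']
  have hne := sgn h
  obtain rfl : v = 1 - u := by linarith
  obtain rfl : v' = 1 - u' := by linarith
  simp only [side, Complex.add_re, Complex.add_im, Complex.real_smul, Complex.mul_re,
    Complex.mul_im, Complex.ofReal_re, Complex.ofReal_im] at e1 e2 hne
  have hD : ((pt b).im - (pt a).im) * ((pt d).re - (pt c).re) -
      ((pt b).re - (pt a).re) * ((pt d).im - (pt c).im) ≠ 0 := by
    intro hD
    rcases hne with hne | hne <;> linarith [hne.1, hne.2]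
  apply Complex.ext
  · simp only [Complex.add_re, Complex.real_smul, Complex.mul_re, Complex.ofReal_re,
      Complex.ofReal_im]
    apply mul_left_cancel₀ hD
    linear_combination (-((pt b).re - (pt a).re)) * e1 - ((pt d).re - (pt c).re) * e2
  · simp only [Complex.add_im, Complex.real_smul, Complex.mul_im, Complex.ofReal_re,
      Complex.ofReal_im]
    apply mul_left_cancel₀ hD
    linear_combination (-((pt b).im - (pt a).im)) * e1 - ((pt d).im - (pt c).im) * e2

/-! ### The pullback lamination in terms of itineraries -/

/-- The finite pullback laminations consist of the precritical leaves of bounded level. -/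
theorem mem_pullback_iff (hper : sigma θ ∉ Function.periodicPts sigma) (n : ℕ)
    (l : UnitAddCircle × UnitAddCircle) : l ∈ pullback θ n ↔ ∃ k ≤ n, Lev θ k l.1 l.2 := by
  induction n generalizing l with
  | zero =>
    obtain ⟨a, b⟩ := l
    simp [pullback, Lev]
  | succ n ih =>
    obtain ⟨a, b⟩ := l
    simp only [pullback, Set.mem_union, Set.mem_ofPred_eq, ih]
    constructor
    · rintro (⟨k, hk, h⟩ | ⟨⟨k, hk, h⟩, hu⟩)
      · exact ⟨k, by omega, h⟩
      · refine ⟨k + 1, by omega, ?_, h⟩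
        apply half_of_not_cross (i := false)
        intro hc
        obtain ⟨p, hp, hp'⟩ := exists_mem_chords hc
        have := hu (vtx θ false, vtx θ (!false)) ⟨0, n.zero_le, lev_vtx θ false⟩ ⟨hp, hp'⟩
        obtain ⟨h1, h2⟩ := this
        have hne := hc.ne
        rcases h1 with rfl | h1 <;> rcases h2 with h2 | h2
        · exact hne.2.1 (pt_injective h2)
        · exact hne.2.2.1 (pt_injective h2)
        · exact hne.2.2.2.1 (pt_injective (h1.symm.trans h2))
        · exact hne.2.2.2.2.1 (pt_injective (h1.symm.trans h2))
    · rintro ⟨k, hk, h⟩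
      rcases Nat.lt_or_ge n k with hlt | hge
      · obtain rfl : k = n + 1 := by omega
        refine Or.inr ⟨⟨n, le_rfl, h.2⟩, ?_⟩
        rintro ⟨c, d⟩ ⟨m, hm, hcd⟩
        -- Leaves of different levels have no endpoint in common.
        have hlev : ∀ {p q r : UnitAddCircle}, Lev θ (n + 1) p q → ¬ Lev θ m p r := fun h1 h2 => by
          have := (h1.unique hper h2).1
          omega
        have hdis := chords_disjoint (Leaf.not_cross hper ⟨_, h⟩ ⟨_, hcd⟩)
          (fun h' => hlev h (h' ▸ hcd)) (fun h' => hlev h (h' ▸ hcd.symm))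
          (fun h' => hlev h.symm (h' ▸ hcd)) (fun h' => hlev h.symm (h' ▸ hcd.symm)) hcd.ne
        rintro p ⟨h1, h2⟩
        exact absurd h2 (Set.disjoint_left.1 hdis h1)
      · exact Or.inl ⟨k, hge, h⟩

theorem pullbackLamination_eq (hper : sigma θ ∉ Function.periodicPts sigma) :
    pullbackLamination θ = closure {l | Leaf θ l.1 l.2} := by
  rw [pullbackLamination]
  congr 1
  ext l
  simp only [Set.mem_iUnion, mem_pullback_iff hper]
  exact ⟨fun ⟨_, k, _, h⟩ => ⟨k, h⟩, fun ⟨k, h⟩ => ⟨k, k, le_rfl, h⟩⟩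

theorem Leaf.mem_lamination (hper : sigma θ ∉ Function.periodicPts sigma) (h : Leaf θ a b) :
    (a, b) ∈ pullbackLamination θ := by
  rw [pullbackLamination_eq hper]
  exact subset_closure h

/-- Limit leaves are not linked with pairs that have a common itinerary. -/
theorem not_cross_of_mem_lamination (hper : sigma θ ∉ Function.periodicPts sigma)
    (h : (a, b) ∈ pullbackLamination θ) (hxy : Comp θ x y) : ¬ Cross a b x y := by
  intro hc
  rw [pullbackLamination_eq hper] at h
  obtain ⟨l, hl, hl'⟩ := mem_closure_iff.1 h _ (isOpen_cross x y) hc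
  exact Leaf.not_cross_comp hper hl' hxy hl

/-! ### Continua in the support -/

theorem mem_support_iff {L : Set (UnitAddCircle × UnitAddCircle)} {k : ℂ} :
    k ∈ support L ↔ ∃ d e, (d = e ∨ (d, e) ∈ L) ∧ k ∈ segment ℝ (pt d) (pt e) := by
  simp only [support, Set.mem_union, Set.mem_iUnion]
  constructor
  · rintro (h | ⟨⟨d, e⟩, h, hk⟩)
    · obtain ⟨x, rfl⟩ := exists_pt_eq h
      exact ⟨x, x, Or.inl rfl, by simp⟩
    · exact ⟨d, e, Or.inr h, hk⟩
  · rintro ⟨d, e, rfl | h, hk⟩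
    · rw [segment_same] at hk
      rw [hk]
      exact Or.inl (pt_mem_sphere d)
    · exact Or.inr ⟨(d, e), h, hk⟩

/-- Signs of the three functionals of a triangle on one of its arcs. -/
theorem side_arc (h : Btw a b c) (hd : d = a ∨ d = b ∨ Btw a d b) :
    side a b (pt d) ≤ 0 ∧ (0 ≤ side b c (pt d) ∧ (side b c (pt d) = 0 → d = b)) ∧
      (0 ≤ side c a (pt d) ∧ (side c a (pt d) = 0 → d = a)) := by
  rcases hd with rfl | rfl | hd
  · have : Btw c d b := by rw [btw_iff d] at h ⊢; grind
    have := side_pos this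
    exact ⟨by simp, ⟨this.le, fun h => absurd h this.ne'⟩, by simp, fun _ => rfl⟩
  · have := side_pos h
    exact ⟨by simp, ⟨by simp, fun _ => rfl⟩, this.le, fun h => absurd h this.ne'⟩
  · have h1 : Btw c d b := by
      have := arc_nonneg a d
      simp only [btw_iff a, arc_self] at *; grind
    have h2 : Btw a d c := by
      have := arc_nonneg a d
      rw [btw_iff a, arc_self] at h hd ⊢; grind
    have h1 := side_pos h1
    have h2 := side_pos h2
    exact ⟨(side_neg hd).le, ⟨h1.le, fun h => absurd h h1.ne'⟩, h2.le, fun h => absurd h h2.ne'⟩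

theorem Btw.rotate (h : Btw a b c) : Btw b c a := by
  rw [btw_iff a] at *; grind

/-- A pair that is not linked with any side of a triangle has both points in one closed arc between
two vertices. -/
theorem arc_trichotomy (h : Btw a b c) (h1 : ¬ Cross d e a b) (h2 : ¬ Cross d e b c)
    (h3 : ¬ Cross d e c a) :
    ((d = a ∨ d = b ∨ Btw a d b) ∧ (e = a ∨ e = b ∨ Btw a e b)) ∨
    ((d = b ∨ d = c ∨ Btw b d c) ∧ (e = b ∨ e = c ∨ Btw b e c)) ∨
    ((d = c ∨ d = a ∨ Btw c d a) ∧ (e = c ∨ e = a ∨ Btw c e a)) := by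
  simp only [cross_iff a, btw_iff a, ← arc_inj (c := a), arc_self] at *
  have k1 := arc_nonneg a b
  have k2 := arc_nonneg a c
  have k3 := arc_nonneg a d
  have k4 := arc_nonneg a e
  generalize arc a b = β at *
  generalize arc a c = γ at *
  generalize arc a d = δ at *
  generalize arc a e = ε at *
  have h : 0 < β ∧ β < γ := by grind
  unfold CrossR at *
  have e1 : (δ = 0 ∨ δ = β ∨ (0 < δ ∧ δ < β)) ∨ (β < δ ∧ δ < γ) ∨ δ = γ ∨ γ < δ := by grind
  have e2 : (ε = 0 ∨ ε = β ∨ (0 < ε ∧ ε < β)) ∨ (β < ε ∧ ε < γ) ∨ ε = γ ∨ γ < ε := by grind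
  rcases e1 with (e1 | e1 | e1) | e1 | e1 | e1 <;> rcases e2 with (e2 | e2 | e2) | e2 | e2 | e2 <;>
    grind (splits := 20)

/-- A connected subset of the support that meets both sides of an edge or a diagonal `a, b` of a
gap contains one of its endpoints: the interior of the triangle `a, b, c` is disjoint from the
support, so near the chord there is no way around the endpoints. -/
theorem mem_of_cross_gap (hper : sigma θ ∉ Function.periodicPts sigma) {K : Set ℂ}
    (hK : IsPreconnected K) (hKs : K ⊆ support (pullbackLamination θ)) (ha : a ∈ fiber θ s)
    (hb : b ∈ fiber θ s) (hc : c ∈ fiber θ s) (hca : c ≠ a) (hcb : c ≠ b) (hx : pt x ∈ K)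
    (hy : pt y ∈ K) (h : Cross x y a b) : pt a ∈ K ∨ pt b ∈ K := by
  wlog habc : Btw a b c generalizing a b
  · have hab := h.ne.2.2.2.2.2
    have hbac : Btw b a c := by
      rcases btw_cases a c b hca hcb hab with h' | h'
      · exact h'.rotate.rotate
      · exact absurd h'.rotate.rotate habc
    exact (this hb ha hcb hca h.swap_right hbac).symm
  have key : ∀ k ∈ K, ∃ d e, k ∈ segment ℝ (pt d) (pt e) ∧
      (((d = a ∨ d = b ∨ Btw a d b) ∧ (e = a ∨ e = b ∨ Btw a e b)) ∨
      ((d = b ∨ d = c ∨ Btw b d c) ∧ (e = b ∨ e = c ∨ Btw b e c)) ∨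
      ((d = c ∨ d = a ∨ Btw c d a) ∧ (e = c ∨ e = a ∨ Btw c e a))) := by
    intro k hk
    obtain ⟨d, e, hde, hk⟩ := mem_support_iff.1 (hKs hk)
    refine ⟨d, e, hk, ?_⟩
    have hnc : ∀ {p q}, p ∈ fiber θ s → q ∈ fiber θ s → ¬ Cross d e p q := by
      intro p q hp hq hcr
      rcases hde with rfl | hde
      · exact hcr.ne.1 rfl
      · exact not_cross_of_mem_lamination hper hde ⟨s, hp, hq⟩ hcr
    exact arc_trichotomy habc (hnc ha hb) (hnc hb hc) (hnc hc ha)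
  have hcv : ∀ {p q d e : UnitAddCircle} {k : ℂ}, k ∈ segment ℝ (pt d) (pt e) →
      side p q (pt d) ≤ 0 → side p q (pt e) ≤ 0 → side p q k ≤ 0 := by
    rintro p q d e k ⟨u, v, hu, hv, huv, rfl⟩ h1 h2
    rw [side_combo _ _ _ _ huv]
    nlinarith
  have hbca := habc.rotate
  have hcab := hbca.rotate
  rw [isPreconnected_closed_iff] at hK
  have hneg : ∀ p q, IsClosed {k | side p q k ≤ 0} := fun p q =>
    isClosed_le (continuous_side p q) continuous_const
  have hxy : ∃ p q, pt p ∈ K ∧ pt q ∈ K ∧ Btw a p b ∧ Btw b q a := by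
    rcases h.symm with h | h
    exacts [⟨x, y, hx, hy, h⟩, ⟨y, x, hy, hx, h⟩]
  obtain ⟨p, q, hp, hq, hp', hq'⟩ := hxy
  have hq2 : (q = b ∨ q = c ∨ Btw b q c) ∨ (q = c ∨ q = a ∨ Btw c q a) := by
    have := arc_nonneg a q
    simp only [btw_iff a, ← arc_inj (c := a), arc_self] at *
    grind
  obtain ⟨k, hkK, hk1, hk2⟩ := hK {k | side a b k ≤ 0} ({k | side b c k ≤ 0} ∪ {k | side c a k ≤ 0})
    (hneg a b) ((hneg b c).union (hneg c a))
    (by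
      intro k hk
      obtain ⟨d, e, hk, h | h | h⟩ := key k hk
      · exact Or.inl (hcv hk (side_arc habc h.1).1 (side_arc habc h.2).1)
      · exact Or.inr (Or.inl (hcv hk (side_arc hbca h.1).1 (side_arc hbca h.2).1))
      · exact Or.inr (Or.inr (hcv hk (side_arc hcab h.1).1 (side_arc hcab h.2).1)))
    ⟨pt p, hp, (side_neg hp').le⟩
    ⟨pt q, hq, hq2.imp (fun h => (side_arc hbca h).1) (fun h => (side_arc hcab h).1)⟩
  have hkab : k = pt a ∨ k = pt b := by
    obtain ⟨d, e, hk, ⟨hd, he⟩ | ⟨hd, he⟩ | ⟨hd, he⟩⟩ := key k hkK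
    · have hd := side_arc habc hd
      have he := side_arc habc he
      rcases hk2 with hk2 | hk2
      · exact Or.inr (eq_pt_of_side_nonpos hk hd.2.1.1 he.2.1.1 hk2 hd.2.1.2 he.2.1.2)
      · exact Or.inl (eq_pt_of_side_nonpos hk hd.2.2.1 he.2.2.1 hk2 hd.2.2.2 he.2.2.2)
    · have hd := side_arc hbca hd
      have he := side_arc hbca he
      exact Or.inr (eq_pt_of_side_nonpos hk hd.2.2.1 he.2.2.1 hk1 hd.2.2.2 he.2.2.2)
    · have hd := side_arc hcab hd
      have he := side_arc hcab he
      exact Or.inl (eq_pt_of_side_nonpos hk hd.2.1.1 he.2.1.1 hk1 hd.2.1.2 he.2.1.2)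
  rcases hkab with rfl | rfl
  exacts [Or.inl hkK, Or.inr hkK]

/-- A chord is itself a continuum that meets the circle only in its endpoints. -/
theorem rel_of_mem_lamination {L : Set (UnitAddCircle × UnitAddCircle)} (h : (a, b) ∈ L) :
    inducedSetoid L a b := by
  refine ⟨chord (a, b), ⟨?_, ?_, ?_, ?_⟩, left_mem_segment _ _ _, right_mem_segment _ _ _⟩
  · intro k hk
    exact mem_support_iff.2 ⟨a, b, Or.inr h, hk⟩
  · rw [chord, segment_eq_image]
    exact isCompact_Icc.image (by fun_prop)
  · exact ⟨⟨_, left_mem_segment _ _ _⟩, (convex_segment _ _).isPreconnected⟩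
  · refine Set.Countable.mono (s₂ := {pt a, pt b}) ?_ (Set.toFinite _).countable
    rintro k ⟨hk, hk1⟩
    by_contra hne
    simp only [Set.mem_insert_iff, Set.mem_singleton_iff, not_or] at hne
    have hab : pt a ≠ pt b := by
      intro hab
      rw [chord, hab, segment_same] at hk
      exact hne.2 hk
    have ho : k ∈ openSegment ℝ (pt a) (pt b) :=
      mem_openSegment_of_ne_left_right (Ne.symm hne.1) (Ne.symm hne.2) hk
    have := openSegment_subset_ball_of_ne
      (Metric.sphere_subset_closedBall (pt_mem_sphere a))
      (Metric.sphere_subset_closedBall (pt_mem_sphere b)) hab ho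
    rw [Metric.mem_ball] at this
    rw [Metric.mem_sphere] at hk1
    linarith

/-- Unlinked disjoint subsets of the circle have disjoint convex hulls. -/
theorem disjoint_convexHull {A B : Set UnitAddCircle} (hA : IsClosed A) (hA0 : A.Nonempty)
    (hAB : Disjoint A B)
    (h : ∀ a ∈ A, ∀ b ∈ A, ∀ c ∈ B, ∀ d ∈ B, ¬ Cross a b c d) :
    Disjoint (convexHull ℝ (pt '' A)) (convexHull ℝ (pt '' B)) := by
  rcases B.eq_empty_or_nonempty with rfl | ⟨o, ho⟩
  · simp
  have hoA : ∀ x ∈ A, x ≠ o := fun x hx hxo => Set.disjoint_left.1 hAB hx (hxo ▸ ho)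
  have hcont : ContinuousOn (arc o) A := fun x hx =>
    (continuousAt_arc (hoA x hx)).continuousWithinAt
  obtain ⟨p, hp, hpmax⟩ := hA.isCompact.exists_isMaxOn hA0 hcont
  obtain ⟨q, hq, hqmin⟩ := hA.isCompact.exists_isMinOn hA0 hcont
  have hmax : ∀ x ∈ A, arc o x ≤ arc o p := hpmax
  have hmin : ∀ x ∈ A, arc o q ≤ arc o x := hqmin
  rcases eq_or_ne p q with rfl | hpq
  · -- `A` is a single point, an extreme point of the disk.
    have hAp : A = {p} := Set.eq_singleton_iff_unique_mem.2
      ⟨hp, fun x hx => arc_inj.1 (le_antisymm (hmax x hx) (hmin x hx))⟩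
    rw [hAp, Set.image_singleton, convexHull_singleton, Set.disjoint_singleton_left]
    intro hmem
    have hsub : convexHull ℝ (pt '' B) ⊆ {k : ℂ | k.re * (pt p).re + k.im * (pt p).im < 1} := by
      refine convexHull_min ?_ ?_
      · rintro _ ⟨x, hx, rfl⟩
        have hne : pt x ≠ pt p := fun h' =>
          Set.disjoint_left.1 hAB hp (pt_injective h' ▸ hx)
        have h1 : (pt x).re ^ 2 + (pt x).im ^ 2 = 1 := by
          have := pt_mem_sphere x
          rw [mem_sphere_zero_iff_norm] at this
          have h2 := Complex.sq_norm (pt x)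
          rw [this, Complex.normSq_apply] at h2
          nlinarith
        have h2 : (pt p).re ^ 2 + (pt p).im ^ 2 = 1 := by
          have := pt_mem_sphere p
          rw [mem_sphere_zero_iff_norm] at this
          have h2 := Complex.sq_norm (pt p)
          rw [this, Complex.normSq_apply] at h2
          nlinarith
        have h3 : 0 < ((pt x).re - (pt p).re) ^ 2 + ((pt x).im - (pt p).im) ^ 2 := by
          by_contra hcon
          apply hne
          apply Complex.ext <;> nlinarith [sq_nonneg ((pt x).re - (pt p).re),
            sq_nonneg ((pt x).im - (pt p).im)]
        simp only [Set.mem_ofPred_eq]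
        nlinarith
      · have hlin : IsLinearMap ℝ fun k : ℂ => k.re * (pt p).re + k.im * (pt p).im :=
          ⟨fun k l => by simp only [Complex.add_re, Complex.add_im]; ring,
            fun r k => by
              simp only [Complex.real_smul, Complex.mul_re, Complex.mul_im, Complex.ofReal_re,
                Complex.ofReal_im, smul_eq_mul]
              ring⟩
        exact convex_halfSpace_lt hlin 1
    have h1 := hsub hmem
    simp only [Set.mem_ofPred_eq] at h1
    have := pt_mem_sphere p
    rw [mem_sphere_zero_iff_norm] at this
    have h2 := Complex.sq_norm (pt p)
    rw [this, Complex.normSq_apply] at h2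
    linarith
  · -- The hole of `A` around a point of `B` contains all of `B`.
    have hq0 : 0 < arc o q := arc_pos.2 (hoA q hq)
    have hqp : arc o q < arc o p := lt_of_le_of_ne (hmin p hp) fun h => hpq (arc_inj.1 h.symm)
    have hBneg : ∀ x ∈ B, Btw p x q := by
      intro x hx
      by_contra hcon
      apply h q hq p hp o ho x hx
      rw [btw_iff o] at hcon
      rw [cross_iff o, arc_self]
      have h1 : arc o x ≠ arc o p := fun h' =>
        Set.disjoint_left.1 hAB hp (arc_inj.1 h' ▸ hx)
      have h2 : arc o x ≠ arc o q := fun h' =>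
        Set.disjoint_left.1 hAB hq (arc_inj.1 h' ▸ hx)
      unfold CrossR
      grind
    have hApos : ∀ x ∈ A, 0 ≤ side p q (pt x) := by
      intro x hx
      rcases eq_or_ne x p with rfl | h1
      · simp
      rcases eq_or_ne x q with rfl | h2
      · simp
      refine (side_pos ?_).le
      rw [btw_iff o]
      have := hmin x hx
      have := hmax x hx
      have h1 : arc o x ≠ arc o p := fun h' => h1 (arc_inj.1 h')
      have h2 : arc o x ≠ arc o q := fun h' => h2 (arc_inj.1 h')
      grind
    have hAs : convexHull ℝ (pt '' A) ⊆ {k | 0 ≤ side p q k} := by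
      refine convexHull_min ?_ ?_
      · rintro _ ⟨x, hx, rfl⟩
        exact hApos x hx
      · intro k hk l hl u v hu hv huv
        rw [Set.mem_ofPred_eq] at *
        rw [side_combo _ _ _ _ huv]
        positivity
    have hBs : convexHull ℝ (pt '' B) ⊆ {k | side p q k < 0} := by
      refine convexHull_min ?_ ?_
      · rintro _ ⟨x, hx, rfl⟩
        exact side_neg (hBneg x hx)
      · intro k hk l hl u v hu hv huv
        rw [Set.mem_ofPred_eq] at *
        rw [side_combo _ _ _ _ huv]
        exact combo_neg hu hv huv hk hl
    rw [Set.disjoint_left]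
    intro k hk hk'
    have h1 := hAs hk
    have h2 := hBs hk'
    rw [Set.mem_ofPred_eq] at h1 h2
    linarith

end QuadLam

namespace QuadLam

variable {θ a b c d e p q x y z : UnitAddCircle} {s t : ℕ → Bool} {n m : ℕ} {u w : ℝ} {i : Bool}

/-! ### Strips of parallel precritical leaves -/

/-- The arcs of length `u` after `a` and of length `w` before `b` are disjoint and matched by
precritical leaves: every precritical leaf that ends in one of them ends in the other as well. -/
structure Strip (θ a : UnitAddCircle) (u : ℝ) (b : UnitAddCircle) (w : ℝ) : Prop where
  pos_left : 0 < u
  le_left : u ≤ 1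
  pos_right : 0 < w
  le_right : w ≤ 1
  disjoint : ∀ x, 0 < arc a x → arc a x < u → 0 < arc x b → arc x b < w → False
  right_of_left : ∀ p q, Leaf θ p q → 0 < arc a p → arc a p < u → 0 < arc q b ∧ arc q b < w
  left_of_right : ∀ p q, Leaf θ p q → 0 < arc p b → arc p b < w → 0 < arc a q ∧ arc a q < u

theorem exists_leaf_left (θ a : UnitAddCircle) (hu : 0 < u) :
    ∃ p q, Leaf θ p q ∧ 0 < arc a p ∧ arc a p < u := by
  have h1 : 0 < min (u / 2) (1 / 2) := by positivity
  have hA := arc_add_coe (a := a) h1.le (by linarith [min_le_right (u / 2) (1 / 2)])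
  have hne : a ≠ a + ((min (u / 2) (1 / 2) : ℝ) : UnitAddCircle) := by
    intro h
    rw [← h, arc_self] at hA
    linarith
  obtain ⟨p, q, hpq, h2, h3⟩ := exists_leaf_btw (θ := θ) hne
  rw [hA] at h3
  exact ⟨p, q, hpq, h2, by linarith [min_le_left (u / 2) (1 / 2)]⟩

/-- The doubling map carries strips to strips as long as they avoid the endpoints of the
diameter. -/
theorem Strip.push (h : Strip θ a u b w)
    (hA : ∀ x, sigma x = sigma θ → 0 < arc a x → arc a x < u → False)
    (hB : ∀ x, sigma x = sigma θ → 0 < arc x b → arc x b < w → False) :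
    Strip θ (sigma a) (2 * u) (sigma b) (2 * w) := by
  obtain ⟨hu0, hu1, hw0, hw1, hd, hAB, hBA⟩ := h
  have hθ := sigma_vtx θ true
  have hθ' : sigma (vtx θ false) = sigma θ := sigma_vtx θ false
  have hopp : opp (vtx θ false) = vtx θ true := opp_vtx θ false
  have ha1 := hA _ hθ
  have ha2 := hA _ hθ'
  have hb1 := hB _ hθ
  have hb2 := hB _ hθ'
  have o1 := arc_opp a (vtx θ false)
  have o2 := arc_opp b (vtx θ false)
  rw [hopp] at o1 o2
  have n1 := arc_nonneg a (vtx θ false)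
  have n2 := arc_nonneg b (vtx θ false)
  have l1 := arc_lt_one a (vtx θ false)
  have l2 := arc_lt_one b (vtx θ false)
  have eb : ∀ x, x ≠ b → arc x b = 1 - arc b x := by
    intro x hx
    have := arc_pos.2 hx
    rcases arc_cases b x b with h | h
    · rw [arc_self] at h; linarith [h.1]
    · rw [arc_self] at h; linarith [h.2]
  have hu2 : u ≤ 1 / 2 := by
    by_contra hcon
    push Not at hcon
    rcases o1 with ⟨o, o'⟩ | ⟨o, o'⟩
    · rcases n1.eq_or_lt with h0 | h0
      · exact ha1 (by linarith) (by linarith)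
      · exact ha2 h0 (by linarith)
    · rcases o.eq_or_lt with h0 | h0
      · exact ha2 (by linarith) (by linarith)
      · exact ha1 (by linarith) (by linarith)
  have hw2 : w ≤ 1 / 2 := by
    by_contra hcon
    push Not at hcon
    have c1 : vtx θ false ≠ b → arc b (vtx θ false) ≤ 1 - w := by
      intro hne
      by_contra hc
      have := eb _ hne
      exact hb2 (by linarith) (by linarith)
    have c2 : vtx θ true ≠ b → arc b (vtx θ true) ≤ 1 - w := by
      intro hne
      by_contra hc
      have := eb _ hne
      have := arc_lt_one b (vtx θ true)
      exact hb1 (by linarith) (by linarith)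
    by_cases h1 : vtx θ false = b
    · have h2 : vtx θ true ≠ b := by rw [← hopp, ← h1]; exact opp_ne _
      have := c2 h2
      rw [h1, arc_self] at o2
      rcases o2 with o | o <;> linarith [o.1, o.2]
    · have c1 := c1 h1
      have h3 := arc_pos.2 h1
      rcases o2 with ⟨o, o'⟩ | ⟨o, o'⟩
      · have h2 : vtx θ true ≠ b := by
          intro h2
          rw [h2, arc_self] at o'
          linarith
        linarith [c2 h2]
      · linarith
  -- Both arcs lie in one half circle, because some leaf joins them.
  obtain ⟨p, q, hpq, hp0, hp1⟩ := exists_leaf_left θ a hu0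
  obtain ⟨hq0, hq1⟩ := hAB p q hpq hp0 hp1
  obtain ⟨i, hpi, hqi⟩ : ∃ i, p ∈ half θ i ∧ q ∈ half θ i := by
    obtain ⟨s, h1, h2⟩ := hpq.comp
    exact ⟨s 0, h1 0, h2 0⟩
  have hAi : ∀ x, 0 < arc a x → arc a x < u → x ∈ half θ i := by
    intro x hx0 hx1
    obtain ⟨j, hj1, hj2⟩ : ∃ j, x ∈ half θ j ∧ p ∈ half θ j := by
      apply half_of_not_cross (i := false)
      rw [cross_iff a]
      change ¬ CrossR _ _ _ (arc a (vtx θ true))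
      have := arc_nonneg a (vtx θ true)
      unfold CrossR
      grind
    by_cases hij : i = j
    · exact hij ▸ hj1
    · rw [bool_eq_not hij] at hj2
      exact (hA p (sigma_eq_of_mem_half hpi hj2) hp0 hp1).elim
  have hBi : ∀ x, 0 < arc x b → arc x b < w → x ∈ half θ i := by
    intro x hx0 hx1
    obtain ⟨j, hj1, hj2⟩ : ∃ j, x ∈ half θ j ∧ q ∈ half θ j := by
      apply half_of_not_cross (i := false)
      rw [cross_iff b]
      change ¬ CrossR _ _ _ (arc b (vtx θ true))
      have hxb : x ≠ b := by rintro rfl; simp at hx0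
      have hqb : q ≠ b := by rintro rfl; simp at hq0
      have e1 := eb x hxb
      have e2 := eb q hqb
      have e3 : arc b (vtx θ false) ≤ 1 - w := by
        by_cases h1 : vtx θ false = b
        · rw [h1, arc_self]; linarith
        · by_contra hc
          have := eb _ h1
          exact hb2 (by linarith) (by linarith)
      have e4 : arc b (vtx θ true) ≤ 1 - w := by
        by_cases h1 : vtx θ true = b
        · rw [h1, arc_self]; linarith
        · by_contra hc
          have := eb _ h1
          have := arc_lt_one b (vtx θ true)
          exact hb1 (by linarith) (by linarith)
      unfold CrossR
      grind
    by_cases hij : i = j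
    · exact hij ▸ hj1
    · rw [bool_eq_not hij] at hj2
      exact (hB q (sigma_eq_of_mem_half hqi hj2) hq0 hq1).elim
  -- Preimages of points of the image arcs.
  have preA : ∀ P, 0 < arc (sigma a) P → arc (sigma a) P < 2 * u →
      ∃ x, sigma x = P ∧ 0 < arc a x ∧ arc a x < u := by
    intro P h0 h1
    have hx := arc_add_coe (a := a) (t := arc (sigma a) P / 2) (by linarith) (by linarith)
    refine ⟨_, ?_, by rw [hx]; linarith, by rw [hx]; linarith⟩
    rw [← arc_inj (c := sigma a)]
    rcases arc_sigma a (a + ((arc (sigma a) P / 2 : ℝ) : UnitAddCircle)) with h | h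
    · rw [h.2, hx]; ring
    · rw [hx] at h; linarith [h.1]
  have preB : ∀ P, 0 < arc P (sigma b) → arc P (sigma b) < 2 * w →
      ∃ x, sigma x = P ∧ 0 < arc x b ∧ arc x b < w := by
    intro P h0 h1
    set r := arc P (sigma b) / 2 with hr
    set x := b - ((r : ℝ) : UnitAddCircle) with hx
    have hxb : arc x b = r := arc_eq_of_coe (by linarith) (by linarith) (by rw [hx]; abel)
    refine ⟨x, ?_, by linarith, by linarith⟩
    have hs : arc (sigma x) (sigma b) = arc P (sigma b) := by
      rcases arc_sigma x b with h | h
      · rw [h.2, hxb]; linarith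
      · linarith [h.1]
    have h1 := add_coe_arc (sigma x) (sigma b)
    have h2 := add_coe_arc P (sigma b)
    rw [hs] at h1
    exact add_right_cancel (h1.trans h2.symm)
  have hneA : ∀ x, 0 < arc a x → arc a x < u → sigma x ≠ sigma θ := fun x h1 h2 h => hA x h h1 h2
  have hneB : ∀ x, 0 < arc x b → arc x b < w → sigma x ≠ sigma θ := fun x h1 h2 h => hB x h h1 h2
  refine ⟨by linarith, by linarith, by linarith, by linarith, ?_, ?_, ?_⟩
  · intro P h1 h2 h3 h4
    obtain ⟨x, rfl, hx1, hx2⟩ := preA P h1 h2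
    obtain ⟨y, hyx, hy1, hy2⟩ := preB _ h3 h4
    have := eq_of_mem_half (hAi x hx1 hx2) (hBi y hy1 hy2) hyx.symm (hneA x hx1 hx2)
    subst this
    exact hd x hx1 hx2 hy1 hy2
  · intro P Q hPQ h1 h2
    obtain ⟨x, rfl, hx1, hx2⟩ := preA P h1 h2
    have hl := hPQ.lift i
    rw [lift_sigma (hAi x hx1 hx2) (hneA x hx1 hx2)] at hl
    obtain ⟨h3, h4⟩ := hAB _ _ hl hx1 hx2
    have := arc_sigma (lift θ i Q) b
    rw [sigma_lift] at this
    rcases this with h | h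
    · rw [h.2]; exact ⟨by linarith, by linarith⟩
    · linarith [h.1]
  · intro P Q hPQ h1 h2
    obtain ⟨x, rfl, hx1, hx2⟩ := preB P h1 h2
    have hl := hPQ.lift i
    rw [lift_sigma (hBi x hx1 hx2) (hneB x hx1 hx2)] at hl
    obtain ⟨h3, h4⟩ := hBA _ _ hl hx1 hx2
    have := arc_sigma a (lift θ i Q)
    rw [sigma_lift] at this
    rcases this with h | h
    · rw [h.2]; exact ⟨by linarith, by linarith⟩
    · linarith [h.1]

/-- Since arcs double in length, a strip is carried to a strip around the diameter. -/
theorem Strip.reach (h : Strip θ a u b w) : ∃ (k : ℕ) (i : Bool) (u' w' : ℝ),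
    Strip θ (sigma^[k] a) u' (sigma^[k] b) w' ∧
      0 < arc (sigma^[k] a) (vtx θ i) ∧ arc (sigma^[k] a) (vtx θ i) < u' ∧
      0 < arc (vtx θ (!i)) (sigma^[k] b) ∧ arc (vtx θ (!i)) (sigma^[k] b) < w' := by
  obtain ⟨N, hN⟩ := pow_unbounded_of_one_lt (1 / u) (one_lt_two : (1 : ℝ) < 2)
  rw [div_lt_iff₀ h.pos_left] at hN
  induction N generalizing a b u w with
  | zero => linarith [h.le_left]
  | succ N ih =>
    have leaf : ∀ i, Leaf θ (vtx θ i) (vtx θ (!i)) := fun i => ⟨0, lev_vtx θ i⟩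
    by_cases hA : ∃ i, 0 < arc a (vtx θ i) ∧ arc a (vtx θ i) < u
    · obtain ⟨i, h1, h2⟩ := hA
      obtain ⟨h3, h4⟩ := h.right_of_left _ _ (leaf i) h1 h2
      exact ⟨0, i, u, w, h, h1, h2, h3, h4⟩
    by_cases hB : ∃ i, 0 < arc (vtx θ i) b ∧ arc (vtx θ i) b < w
    · obtain ⟨i, h1, h2⟩ := hB
      obtain ⟨h3, h4⟩ := h.left_of_right _ _ (leaf i) h1 h2
      exact (hA ⟨_, h3, h4⟩).elim
    push Not at hA hB
    have crit : ∀ x, sigma x = sigma θ → ∃ i, x = vtx θ i := fun x hx =>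
      ((sigma_eq_sigma_iff_vtx false).1 hx).elim (fun h => ⟨_, h⟩) (fun h => ⟨_, h⟩)
    have hp := h.push
      (fun x hx h1 h2 => by
        obtain ⟨i, rfl⟩ := crit x hx
        linarith [hA i h1])
      (fun x hx h1 h2 => by
        obtain ⟨i, rfl⟩ := crit x hx
        linarith [hB i h1])
    obtain ⟨k, i, u', w', hs, hk⟩ := ih hp (by rw [pow_succ] at hN; linarith)
    exact ⟨k + 1, i, u', w', hs, hk⟩

/-- The part of a strip around the diameter on one side of the diameter. -/
theorem Strip.cut (hper : sigma θ ∉ Function.periodicPts sigma) (h : Strip θ a u b w)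
    (h1 : 0 < arc a (vtx θ i)) (h2 : arc a (vtx θ i) < u) (h3 : 0 < arc (vtx θ (!i)) b)
    (h4 : arc (vtx θ (!i)) b < w) : ∃ u' w', Strip θ (vtx θ i) u' (vtx θ (!i)) w' ∧
      u' ≤ 1 / 2 ∧ w' ≤ 1 / 2 := by
  obtain ⟨hu0, hu1, hw0, hw1, hd, hAB, hBA⟩ := h
  set v := vtx θ i with hv
  have hv' : vtx θ (!i) = opp v := (opp_vtx θ i).symm
  rw [hv'] at h3 h4 ⊢
  have leaf0 : Leaf θ v (opp v) := by rw [← hv']; exact ⟨0, lev_vtx θ i⟩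
  have ov := arc_opp_self v
  -- All arcs are measured from `v`.
  have bA : ∀ x, arc a x = arc v x + arc a v ∨ arc a x = arc v x + arc a v - 1 := by
    intro x
    have h5 := arc_lt_one v x
    have h6 := arc_nonneg v x
    have h7 := arc_nonneg a x
    rcases arc_cases a v x with h | h
    · left; linarith [h.2]
    · right; linarith [h.2]
  have bB : ∀ x, arc x b = arc (opp v) b + 1 / 2 - arc v x ∨
      arc x b = arc (opp v) b + 1 / 2 - arc v x + 1 ∨
      arc x b = arc (opp v) b + 1 / 2 - arc v x - 1 := by
    intro x
    rcases arc_cases v (opp v) b with h | h <;> rcases arc_cases v x b with h' | h' <;>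
      rw [ov] at h
    · left; linarith [h.2, h'.2]
    · right; left; linarith [h.2, h'.2]
    · right; right; linarith [h.2, h'.2]
    · left; linarith [h.2, h'.2]
  have hvB : ¬ (0 < arc v b ∧ arc v b < w) := fun h => hd v h1 h2 h.1 h.2
  have hoA : ¬ (0 < arc a (opp v) ∧ arc a (opp v) < u) := fun h => hd _ h.1 h.2 h3 h4
  have bo := bA (opp v)
  rw [ov] at bo
  have bv := bB v
  rw [arc_self] at bv
  have nA := fun x => arc_nonneg a x
  have lA := fun x => arc_lt_one a x
  have nB := fun x => arc_nonneg x b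
  have lB := fun x => arc_lt_one x b
  have hu' : u - arc a v ≤ 1 / 2 := by
    by_contra hc
    apply hoA
    have := lA (opp v)
    have := nA (opp v)
    rcases bo with bo | bo
    · exact ⟨by linarith, by linarith⟩
    · linarith
  have hw' : w - arc (opp v) b ≤ 1 / 2 := by
    by_contra hc
    apply hvB
    have := lB v
    rcases bv with bv | bv | bv
    · exact ⟨by linarith, by linarith⟩
    · linarith
    · linarith [nB v, lB (opp v)]
  have toA : ∀ x, 0 < arc v x → arc v x < u - arc a v → 0 < arc a x ∧ arc a x < u := by
    intro x hx1 hx2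
    rcases bA x with h | h
    · exact ⟨by linarith, by linarith⟩
    · linarith [nA x]
  have eo : ∀ x, 0 < arc x (opp v) → arc x (opp v) ≤ 1 / 2 → arc x (opp v) = 1 / 2 - arc v x := by
    intro x hx1 hx2
    rcases arc_cases v x (opp v) with h | h <;> rw [ov] at h
    · exact h.2
    · have := arc_lt_one v x
      linarith [h.2]
  have toB : ∀ x, 0 < arc x (opp v) → arc x (opp v) < w - arc (opp v) b →
      0 < arc x b ∧ arc x b < w := by
    intro x hx1 hx2
    have := eo x hx1 (by linarith)
    rcases bB x with h | h | h
    · exact ⟨by linarith, by linarith⟩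
    · linarith [lB x]
    · linarith [nB x]
  -- Leaves do not leave the half circle that starts at `v`.
  have stay : ∀ p q, Leaf θ p q → 0 < arc v p → arc v p < 1 / 2 →
      0 < arc v q ∧ arc v q < 1 / 2 := by
    intro p q hpq hp1 hp2
    have hnc := Leaf.not_cross hper leaf0 hpq
    rw [cross_iff v, arc_self, ov] at hnc
    have hq1 : arc v q ≠ 0 := by
      intro h
      obtain rfl := arc_eq_zero.1 h
      have := Leaf.unique hper hpq.symm leaf0
      rw [this, ov] at hp2
      exact lt_irrefl _ hp2
    have hq2 : arc v q ≠ 1 / 2 := by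
      intro h
      rw [← ov, arc_inj] at h
      subst h
      have := Leaf.unique hper hpq.symm leaf0.symm
      rw [this, arc_self] at hp1
      exact lt_irrefl _ hp1
    have := arc_nonneg v q
    unfold CrossR at hnc
    grind
  refine ⟨u - arc a v, w - arc (opp v) b, ⟨by linarith, by linarith, by linarith, by linarith,
    ?_, ?_, ?_⟩, hu', hw'⟩
  · intro x hx1 hx2 hx3 hx4
    have h5 := toA x hx1 hx2
    have h6 := toB x hx3 hx4
    exact hd x h5.1 h5.2 h6.1 h6.2
  · intro p q hpq hp1 hp2
    obtain ⟨h5, h6⟩ := toA p hp1 hp2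
    obtain ⟨h7, h8⟩ := hAB p q hpq h5 h6
    obtain ⟨h9, h10⟩ := stay p q hpq hp1 (by linarith)
    have e1 : arc q (opp v) = 1 / 2 - arc v q := by
      rcases arc_cases v q (opp v) with h | h <;> rw [ov] at h
      · exact h.2
      · linarith [h.1]
    rw [e1]
    refine ⟨by linarith, ?_⟩
    rcases bB q with h | h | h
    · linarith
    · rcases bv with bv | bv | bv
      · have : ¬ (arc v b < w) := fun h' => hvB ⟨by linarith, h'⟩
        linarith
      · linarith [lB v, nB (opp v)]
      · linarith
    · rcases bv with bv | bv | bv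
      · linarith [lB v]
      · linarith [lB v]
      · exact (hvB ⟨by linarith, by linarith⟩).elim
  · intro q p hqp hq1 hq2
    obtain ⟨h5, h6⟩ := toB q hq1 hq2
    obtain ⟨h7, h8⟩ := hBA q p hqp h5 h6
    have e1 := eo q hq1 (by linarith)
    have hq0 : 0 < arc v q := by
      have := arc_nonneg v q
      rcases this.eq_or_lt with h | h
      · rw [e1] at hq2; linarith
      · exact h
    obtain ⟨h9, h10⟩ := stay q p hqp hq0 (by linarith)
    refine ⟨h9, ?_⟩
    rcases bA p with h | h
    · linarith
    · rcases bo with bo | bo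
      · linarith [lA (opp v)]
      · exact (hoA ⟨by linarith, by linarith⟩).elim

/-- A strip whose arcs meet at a point `e` and that contains the diameter forces every precritical
leaf to separate the critical value from `σ(e)`. -/
theorem Strip.separates (hper : sigma θ ∉ Function.periodicPts sigma) (h : Strip θ e u e w)
    (he : ∀ p q, Leaf θ p q → p ≠ e)
    (h1 : 0 < arc e (vtx θ i)) (h2 : arc e (vtx θ i) < u) (h3 : 0 < arc (vtx θ (!i)) e)
    (h4 : arc (vtx θ (!i)) e < w) (hpq : Leaf θ p q) : Cross (sigma θ) (sigma e) p q := by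
  obtain ⟨hu0, hu1, hw0, hw1, hd, hAB, hBA⟩ := h
  set v := vtx θ (!i) with hv
  have hv' : vtx θ i = opp v := by rw [hv, opp_vtx, Bool.not_not]
  rw [hv'] at h1 h2
  have ov := arc_opp_self v
  have hopp := arc_cases v e (opp v)
  rw [ov] at hopp
  have hoe : ¬ (0 < arc (opp v) e ∧ arc (opp v) e < w) := fun h => hd _ h1 h2 h.1 h.2
  have hee : arc v e < 1 / 2 := by
    by_contra hc
    apply hoe
    have := arc_cases v (opp v) e
    rw [ov] at this
    have hne : opp v ≠ e := by rintro rfl; simp at h1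
    have := arc_pos.2 hne.symm
    have := arc_nonneg v e
    grind
  have hoe' : arc e (opp v) = 1 / 2 - arc v e := by grind
  -- Points of the open half circle are in one of the two arcs of the strip.
  have key : ∀ p q, Leaf θ p q → p ∈ half θ (!i) → q ∈ half θ (!i) → sigma p ≠ sigma θ →
      sigma q ≠ sigma θ → arc v e < arc v p → arc v q < arc v e := by
    intro p q hpq hp hq hpv hqv hlt
    have hp' : arc v p ≤ 1 / 2 := hp
    have e1 : arc e p = arc v p - arc v e := by
      rcases arc_cases v e p with h | h
      · exact h.2
      · linarith [h.1]
    have hp2 : arc v p ≠ 1 / 2 := by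
      intro h
      rw [← ov, arc_inj] at h
      exact hpv (by rw [h, sigma_opp, hv, sigma_vtx])
    have hp3 : arc v p < 1 / 2 := lt_of_le_of_ne hp' hp2
    obtain ⟨h5, h6⟩ := hAB p q hpq (by linarith) (by linarith)
    by_contra hc
    push Not at hc
    have hq' : arc v q ≤ 1 / 2 := hq
    have hne : arc v q ≠ arc v e := fun h => he q p hpq.symm (arc_inj.1 h)
    have hq2 : arc v q ≠ 1 / 2 := by
      intro h
      rw [← ov, arc_inj] at h
      exact hqv (by rw [h, sigma_opp, hv, sigma_vtx])
    have hq3 : arc v q < 1 / 2 := lt_of_le_of_ne hq' hq2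
    have e2 : arc e q = arc v q - arc v e := by
      rcases arc_cases v e q with h | h
      · exact h.2
      · linarith [h.1]
    have h7 : arc v e < arc v q := lt_of_le_of_ne hc hne.symm
    exact hd q (by linarith) (by linarith) h5 h6
  have key' : ∀ p q, Leaf θ p q → p ∈ half θ (!i) → q ∈ half θ (!i) → sigma p ≠ sigma θ →
      sigma q ≠ sigma θ → arc v p < arc v e → arc v e < arc v q := by
    intro p q hpq hp hq hpv hqv hlt
    have hp1 : 0 < arc v p := arc_pos.2 (by
      rintro rfl
      exact hpv (by rw [hv, sigma_vtx]))
    have e1 : arc p e = arc v e - arc v p := by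
      rcases arc_cases v p e with h | h
      · exact h.2
      · linarith [h.1]
    obtain ⟨h5, h6⟩ := hBA p q hpq (by linarith) (by linarith)
    by_contra hc
    push Not at hc
    have hne : arc v q ≠ arc v e := fun h => he q p hpq.symm (arc_inj.1 h)
    have h7 : arc v q < arc v e := lt_of_le_of_ne hc hne
    have hq1 : 0 < arc v q := arc_pos.2 (by
      rintro rfl
      exact hqv (by rw [hv, sigma_vtx]))
    have e2 : arc q e = arc v e - arc v q := by
      rcases arc_cases v q e with h | h
      · exact h.2
      · linarith [h.1]
    exact hd q h5 h6 (by linarith) (by linarith)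
  have hpv := hpq.lift (!i)
  have hp := lift_mem_half θ (!i) p
  have hq := lift_mem_half θ (!i) q
  have sp : sigma (lift θ (!i) p) ≠ sigma θ := by rw [sigma_lift]; exact hpq.ne_value hper
  have sq : sigma (lift θ (!i) q) ≠ sigma θ := by rw [sigma_lift]; exact hpq.symm.ne_value hper
  have k1 := key _ _ hpv hp hq sp sq
  have k2 := key' _ _ hpv hp hq sp sq
  have k3 : arc v (lift θ (!i) p) ≠ arc v e := fun h => he _ _ hpv (arc_inj.1 h)
  rw [hv, arc_lift, arc_lift, ← hv] at k1 k2
  rw [hv, arc_lift, ← hv] at k3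
  have he' : arc (sigma θ) (sigma e) = 2 * arc v e := by
    rcases arc_sigma_half (i := !i) (x := e) hee.le with h | h
    · exact h.2
    · exact absurd h.1 hee.ne
  have hp0 : 0 < arc (sigma θ) p := arc_pos.2 (hpq.ne_value hper)
  have hq0 : 0 < arc (sigma θ) q := arc_pos.2 (hpq.symm.ne_value hper)
  rw [cross_iff (sigma θ), arc_self, he']
  unfold CrossR
  rcases lt_or_gt_of_ne k3 with h | h
  · have := k2 h
    exact Or.inl ⟨hp0, by linarith, Or.inr (by linarith)⟩
  · have := k1 h
    exact Or.inr (Or.inl ⟨hq0, by linarith, Or.inr (by linarith)⟩)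

/-- At most one point is separated from a given point by every precritical leaf. -/
theorem eq_of_forall_cross {v : UnitAddCircle} (hx : ∀ p q, Leaf θ p q → Cross v x p q)
    (hy : ∀ p q, Leaf θ p q → Cross v y p q) : x = y := by
  by_contra hne
  wlog hlt : arc v x < arc v y generalizing x y
  · exact this hy hx (Ne.symm hne)
      (lt_of_le_of_ne (not_lt.1 hlt) fun h => hne (arc_inj.1 h.symm))
  obtain ⟨p, q, hpq, hp⟩ := exists_leaf_btw (θ := θ) hne
  have h1 := hx p q hpq
  have h2 := hy p q hpq
  rw [btw_iff v] at hp
  rw [cross_iff v, arc_self] at h1 h2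
  have := arc_nonneg v p
  have := arc_nonneg v q
  have := arc_nonneg v x
  unfold CrossR at h1 h2
  grind

/-- If the points `z` and `y` in different half circles are separated by the preimages of the
leaf `p, q` in the half circle of `z`, then `p, q` separates `σ(z)` from the critical value. -/
theorem cross_value_of_lift (hz : z ∈ half θ i) (hy : y ∈ half θ (!i))
    (hp : p ≠ sigma θ) (hq : q ≠ sigma θ)
    (h : Cross z y (lift θ i p) (lift θ i q)) : Cross (sigma θ) (sigma z) p q := by
  rw [cross_iff (vtx θ i), arc_lift, arc_lift] at h
  rw [mem_half_not, ← arc_eq_zero] at hy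
  have hp0 := arc_pos.2 hp
  have hq0 := arc_pos.2 hq
  have hp1 := arc_lt_one (sigma θ) p
  have hq1 := arc_lt_one (sigma θ) q
  have hz0 := arc_nonneg (vtx θ i) z
  rw [cross_iff (sigma θ), arc_self]
  generalize arc (sigma θ) p = P at *
  generalize arc (sigma θ) q = Q at *
  obtain ⟨P, rfl⟩ : ∃ P', P = 2 * P' := ⟨P / 2, by ring⟩
  obtain ⟨Q, rfl⟩ : ∃ Q', Q = 2 * Q' := ⟨Q / 2, by ring⟩
  rw [mul_div_cancel_left₀ _ two_ne_zero, mul_div_cancel_left₀ _ two_ne_zero] at h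
  have e : (1 : ℝ) / 2 * 2 = 1 := by norm_num
  have hz1 := arc_sigma_half hz
  generalize (1 : ℝ) / 2 = c at *
  unfold CrossR at *
  rcases hz1 with ⟨l, m⟩ | ⟨l, -, m⟩ <;> rw [m] <;> grind (splits := 20)

theorem sigma_coe (r : ℝ) : sigma (r : UnitAddCircle) = ((2 * r : ℝ) : UnitAddCircle) := by
  rw [sigma, two_nsmul, two_mul, AddCircle.coe_add]

/-- If all precritical leaves separate the critical value from a second point, then the diameter is
vertical. -/
theorem not_forall_cross (hper : sigma θ ∉ Function.periodicPts sigma)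
    (hvert : θ ≠ ((1 / 4 : ℝ) : UnitAddCircle) ∧ θ ≠ ((3 / 4 : ℝ) : UnitAddCircle))
    (h : ∀ p q, Leaf θ p q → Cross (sigma θ) y p q) : False := by
  have hhalf : ∀ {x : UnitAddCircle}, (∀ p q, Leaf θ p q → x ≠ p) →
      ∀ i, x ∈ half θ i → x ∉ half θ (!i) := fun {x} hx i h1 h2 => by
    rcases (sigma_eq_sigma_iff_vtx i).1 (sigma_eq_of_mem_half h1 h2) with rfl | rfl
    · exact hx _ _ ⟨0, lev_vtx θ i⟩ rfl
    · exact hx _ _ ⟨0, lev_vtx θ (!i)⟩ rfl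
  have hv : ∀ p q, Leaf θ p q → sigma θ ≠ p := fun p q hpq h => hpq.ne_value hper h.symm
  -- The diameter puts the two points into different half circles `j` and `!j`.
  obtain ⟨j, hj⟩ : ∃ j, sigma θ ∈ half θ j :=
    (mem_half_or θ (sigma θ) false).elim (fun h => ⟨_, h⟩) (fun h => ⟨_, h⟩)
  have hyj : y ∈ half θ (!j) := by
    have hc := h _ _ ⟨0, lev_vtx θ j⟩
    by_contra hy
    have hy' := (mem_half_or θ y j).resolve_right hy
    exact not_cross_of_half hj hy' (vtx_mem_half θ _ _) (vtx_mem_half θ _ _) hc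
  have h1 : ∀ p q, Leaf θ p q → Cross (sigma θ) (sigma (sigma θ)) p q := fun p q hpq =>
    cross_value_of_lift hj hyj (hpq.ne_value hper) (hpq.symm.ne_value hper) (h _ _ (hpq.lift j))
  have h2 : ∀ p q, Leaf θ p q → Cross (sigma θ) (sigma y) p q := fun p q hpq =>
    cross_value_of_lift hyj (by rwa [Bool.not_not]) (hpq.ne_value hper) (hpq.symm.ne_value hper)
      (h _ _ (hpq.lift (!j))).swap_left
  have e1 := eq_of_forall_cross h h1
  have e2 := eq_of_forall_cross h h2
  have hy0 : y = 0 := by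
    have : y + y = y := by rw [← two_nsmul]; exact e2.symm
    simpa using this
  rw [hy0] at e1
  have e3 : sigma (sigma θ) = sigma 0 := by rw [← e1]; simp [sigma]
  rcases sigma_eq_iff.1 e3 with h0 | h0
  · exact sigma_iterate_value_ne hper 0 (by
      change sigma (sigma θ) = sigma θ
      rw [← e1, h0])
  · have e4 : sigma θ = sigma ((1 / 4 : ℝ) : UnitAddCircle) := by
      rw [h0, sigma_coe, opp, zero_add]; norm_num
    rcases sigma_eq_iff.1 e4 with h5 | h5
    · exact hvert.1 h5
    · apply hvert.2
      rw [h5, opp, ← AddCircle.coe_add]; norm_num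

/-- Strips of parallel leaves occur only for the vertical diameter. -/
theorem not_strip (hper : sigma θ ∉ Function.periodicPts sigma)
    (hvert : θ ≠ ((1 / 4 : ℝ) : UnitAddCircle) ∧ θ ≠ ((3 / 4 : ℝ) : UnitAddCircle))
    (h : Strip θ a u b w) : False := by
  obtain ⟨k, i, u', w', hs, h1, h2, h3, h4⟩ := h.reach
  obtain ⟨u₁, w₁, hc, hu, hw⟩ := hs.cut hper h1 h2 h3 h4
  -- The cut strip is mapped to a strip whose two arcs meet at the critical value.
  have hcap : Strip θ (sigma θ) (2 * u₁) (sigma θ) (2 * w₁) := by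
    have := hc.push (fun x hx h5 h6 => ?_) (fun x hx h5 h6 => ?_)
    · rwa [sigma_vtx, sigma_vtx] at this
    · rcases (sigma_eq_sigma_iff_vtx i).1 hx with rfl | rfl
      · simp at h5
      · rw [← opp_vtx, arc_opp_self] at h6; linarith
    · rcases (sigma_eq_sigma_iff_vtx i).1 hx with rfl | rfl
      · rw [← opp_vtx, arc_opp_self] at h6; linarith
      · simp at h5
  obtain ⟨k, i, u', w', hs, h1, h2, h3, h4⟩ := hcap.reach
  refine not_forall_cross hper hvert fun p q hpq => hs.separates hper ?_ h1 h2 h3 h4 hpq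
  rintro p q ⟨n, hn⟩ rfl
  have := hn.hit
  rw [← Function.iterate_add_apply, show n + 1 + k = (n + k) + 1 by ring] at this
  exact sigma_iterate_value_ne hper _ this

end QuadLam

namespace QuadLam

variable {θ a b c d e p q x y z w : UnitAddCircle} {s t : ℕ → Bool} {n m k N : ℕ} {i : Bool}

/-! ### Finite and infinite gaps -/

theorem fiber_finite_of_shift (h : (fiber θ (shift s)).Finite) : (fiber θ s).Finite := by
  have hsub : fiber θ s ⊆ sigma ⁻¹' fiber θ (shift s) := fun x hx => (mem_fiber_iff.1 hx).2
  refine Set.Finite.subset (Set.Finite.preimage' h fun y _ => ?_) hsub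
  obtain ⟨x, rfl⟩ := exists_sigma_eq y
  refine Set.Finite.subset (Set.toFinite {x, opp x}) fun z hz => ?_
  exact sigma_eq_iff.1 hz

theorem shift_finite_of_fiber (h : (fiber θ s).Finite) : (fiber θ (shift s)).Finite := by
  refine (h.image sigma).subset fun y hy => ⟨lift θ (s 0) y, ?_, sigma_lift _ _ _⟩
  exact mem_fiber_iff.2 ⟨lift_mem_half _ _ _, by rwa [sigma_lift]⟩

theorem fiber_infinite_iterate (h : (fiber θ s).Infinite) (k : ℕ) :
    (fiber θ (shift^[k] s)).Infinite := by
  induction k generalizing s with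
  | zero => exact h
  | succ k ih => exact ih fun hf => h (fiber_finite_of_shift hf)

theorem fiber_finite_iterate (h : (fiber θ s).Finite) (k : ℕ) :
    (fiber θ (shift^[k] s)).Finite := by
  induction k generalizing s with
  | zero => exact h
  | succ k ih => exact ih (shift_finite_of_fiber h)

/-- A gap that contains the critical value and returns to itself is infinite: its return map is
injective on the orbit of the critical value, which is not periodic. -/
theorem fiber_infinite_of_return (hper : sigma θ ∉ Function.periodicPts sigma)
    (hv : sigma θ ∈ fiber θ t) (hk : 0 < k) (ht : shift^[k] t = t) : (fiber θ t).Infinite := by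
  intro hfin
  have hmem : ∀ {x}, x ∈ fiber θ t → ∀ j, sigma^[k * j] x ∈ fiber θ t := by
    intro x hx j
    have h1 := mem_fiber_iterate hx (k * j)
    rwa [Function.iterate_mul, Function.iterate_fixed ht] at h1
  refine Set.infinite_of_injective_forall_mem (f := fun j => sigma^[k * j] (sigma θ)) ?_
    (hmem hv) hfin
  have key : ∀ i j, i < j → sigma^[k * i] (sigma θ) ≠ sigma^[k * j] (sigma θ) := by
    intro i j hij h
    obtain ⟨r, rfl⟩ := Nat.exists_eq_add_of_lt hij
    rw [show k * (i + r + 1) = k * i + k * (r + 1) by ring, Function.iterate_add_apply] at h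
    by_cases hne : sigma θ = sigma^[k * (r + 1)] (sigma θ)
    · exact hper (Function.mem_periodicPts.2 ⟨k * (r + 1), by positivity, hne.symm⟩)
    · exact (leaf_of_iterate_eq hv (hmem hv _) hne h).ne_value hper rfl
  intro i j h
  rcases lt_trichotomy i j with h' | h' | h'
  · exact absurd h (key i j h')
  · exact h'
  · exact absurd h.symm (key j i h')

theorem Lev.iterate (h : Lev θ n a b) : (sigma^[n] a = θ ∧ sigma^[n] b = opp θ) ∨
    (sigma^[n] a = opp θ ∧ sigma^[n] b = θ) := by
  induction n generalizing a b with
  | zero => exact h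
  | succ n ih => exact ih h.2

/-- A finite gap has at most one precritical edge. -/
theorem leaf_eq_of_finite (hper : sigma θ ∉ Function.periodicPts sigma)
    (hs : (fiber θ s).Finite) (h : Leaf θ a b) (h' : Leaf θ c d) (ha : a ∈ fiber θ s)
    (hb : b ∈ fiber θ s) (hc : c ∈ fiber θ s) : c = a ∨ c = b := by
  obtain ⟨n, hn⟩ := h
  obtain ⟨m, hm⟩ := h'
  have key : ∀ {n m : ℕ} {a b c d : UnitAddCircle}, Lev θ n a b → Lev θ m c d →
      a ∈ fiber θ s → c ∈ fiber θ s → ¬ n < m := by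
    intro n m a b c d hn hm ha hc hlt
    have h1 := mem_fiber_iterate ha (n + 1)
    have h2 := mem_fiber_iterate hc (m + 1)
    rw [hn.hit] at h1
    rw [hm.hit] at h2
    have h3 := fiber_unique_value hper h1 h2
    refine fiber_infinite_of_return hper (k := m - n) h1 (by omega) ?_ (fiber_finite_iterate hs _)
    rw [← Function.iterate_add_apply, show m - n + (n + 1) = m + 1 by omega, h3]
  have hnm : n = m := le_antisymm (not_lt.1 (key hm hn hc ha)) (not_lt.1 (key hn hm ha hc))
  subst hnm
  have hcases : sigma^[n] c = sigma^[n] a ∨ sigma^[n] c = sigma^[n] b := by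
    rcases hn.iterate with h1 | h1 <;> rcases hm.iterate with h2 | h2 <;>
      rw [h1.1, h1.2, h2.1] <;> simp
  by_contra hne
  push Not at hne
  rcases hcases with h1 | h1
  · have h2 := leaf_of_iterate_eq hc ha hne.1 h1
    exact hne.2 (Leaf.unique hper h2.symm ⟨n, hn⟩)
  · have h2 := leaf_of_iterate_eq hc hb hne.2 h1
    exact hne.1 (Leaf.unique hper h2.symm ⟨n, hn.symm⟩)

/-! ### Absence of wandering triangles -/

/-- The distance on the circle, measured in arc length. -/
noncomputable def cdist (x y : UnitAddCircle) : ℝ := min (arc x y) (1 - arc x y)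

theorem cdist_base (c x y : UnitAddCircle) :
    cdist x y = min |arc c x - arc c y| (1 - |arc c x - arc c y|) := by
  unfold cdist
  rcases arc_cases c x y with h | h <;> rw [h.2]
  · rw [abs_sub_comm, abs_of_nonneg (by linarith)]
  · rw [abs_of_nonneg (by linarith), min_comm]
    congr 1 <;> ring

theorem cdist_comm (x y : UnitAddCircle) : cdist x y = cdist y x := by
  rw [cdist_base x, cdist_base x y x, abs_sub_comm]

theorem cdist_pos (h : x ≠ y) : 0 < cdist x y := by
  have h0 := arc_pos.2 h.symm
  have h1 := arc_lt_one x y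
  exact lt_min h0 (by linarith)

theorem cdist_sigma (x y : UnitAddCircle) :
    (cdist x y ≤ 1 / 4 ∧ cdist (sigma x) (sigma y) = 2 * cdist x y) ∨
      (1 / 4 ≤ cdist x y ∧ cdist (sigma x) (sigma y) = 1 - 2 * cdist x y) := by
  unfold cdist
  have h0 := arc_nonneg x y
  have h1 := arc_lt_one x y
  rcases arc_sigma x y with ⟨h, h'⟩ | ⟨h, h'⟩ <;> rw [h']
  · rw [min_eq_left (by linarith : arc x y ≤ 1 - arc x y)]
    rcases le_total (arc x y) (1 / 4) with h2 | h2
    · exact Or.inl ⟨h2, min_eq_left (by linarith)⟩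
    · exact Or.inr ⟨h2, by rw [min_eq_right (by linarith)]⟩
  · rw [min_eq_right (by linarith : 1 - arc x y ≤ arc x y)]
    rcases le_total (1 - arc x y) (1 / 4) with h2 | h2
    · exact Or.inl ⟨h2, by rw [min_eq_right (by linarith)]; ring⟩
    · exact Or.inr ⟨h2, by rw [min_eq_left (by linarith)]; ring⟩

/-- A triangle that is not linked with either of two antipodal long chords has a side that is short
compared with the distance of these chords from being diameters, or no side that is longer than
they are. -/
theorem thin_strip {δ P Q R : ℝ} (hδ : 0 < δ) (hδ' : δ < 1 / 4) (hP : 0 ≤ P) (hP' : P < 1)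
    (hQ : 0 ≤ Q) (hQ' : Q < 1) (hR : 0 ≤ R) (hR' : R < 1)
    (h1 : ∀ {X Y : ℝ}, (X = P ∨ X = Q ∨ X = R) → (Y = P ∨ Y = Q ∨ Y = R) →
      ¬ CrossR 0 (1 / 2 - δ) X Y ∧ ¬ CrossR (1 / 2) (1 - δ) X Y)
    (hPQ : 1 / 2 - δ < min |P - Q| (1 - |P - Q|))
    (hPR : 2 * δ ≤ min |P - R| (1 - |P - R|)) (hQR : 2 * δ ≤ min |Q - R| (1 - |Q - R|)) :
    False := by
  rw [lt_min_iff] at hPQ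
  rw [le_min_iff] at hPR hQR
  -- A vertex strictly under one of the chords would force the long side under that chord.
  have under : ∀ {X Y l r : ℝ}, l < X → X < r → ¬ CrossR l r X Y → l ≤ Y ∧ Y ≤ r := by
    intro X Y l r k1 k2 k3
    unfold CrossR at k3
    constructor
    · by_contra hc
      exact k3 (Or.inl ⟨k1, k2, Or.inl (by linarith)⟩)
    · by_contra hc
      exact k3 (Or.inl ⟨k1, k2, Or.inr (by linarith)⟩)
  have out : ∀ {X : ℝ}, (X = P ∨ X = Q ∨ X = R) →
      ¬ (0 < X ∧ X < 1 / 2 - δ) ∧ ¬ (1 / 2 < X ∧ X < 1 - δ) := by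
    intro X hX
    constructor
    · rintro ⟨k1, k2⟩
      have u1 := under k1 k2 (h1 hX (Or.inl rfl)).1
      have u2 := under k1 k2 (h1 hX (Or.inr (Or.inl rfl))).1
      have : |P - Q| ≤ 1 / 2 - δ := by
        rw [abs_le]; constructor <;> linarith [u1.1, u1.2, u2.1, u2.2]
      linarith [hPQ.1]
    · rintro ⟨k1, k2⟩
      have u1 := under k1 k2 (h1 hX (Or.inl rfl)).2
      have u2 := under k1 k2 (h1 hX (Or.inr (Or.inl rfl))).2
      have : |P - Q| ≤ 1 / 2 - δ := by
        rw [abs_le]; constructor <;> linarith [u1.1, u1.2, u2.1, u2.2]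
      linarith [hPQ.1]
  have oP := out (Or.inl rfl)
  have oQ := out (Or.inr (Or.inl rfl))
  have oR := out (Or.inr (Or.inr rfl))
  have cl : ∀ {X : ℝ}, 0 ≤ X → (¬ (0 < X ∧ X < 1 / 2 - δ) ∧ ¬ (1 / 2 < X ∧ X < 1 - δ)) →
      X = 0 ∨ (1 / 2 - δ ≤ X ∧ X ≤ 1 / 2) ∨ 1 - δ ≤ X := by
    intro X h0 ⟨k1, k2⟩
    by_contra hc
    push Not at hc
    have h0' : 0 < X := lt_of_le_of_ne h0 (Ne.symm hc.1)
    have h2 : 1 / 2 - δ ≤ X := by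
      by_contra h; exact k1 ⟨h0', by linarith⟩
    have h3 := hc.2.1 h2
    exact k2 ⟨h3, hc.2.2⟩
  have mid : ∀ {X Y : ℝ}, (1 / 2 - δ ≤ X ∧ X ≤ 1 / 2) → (1 / 2 - δ ≤ Y ∧ Y ≤ 1 / 2) →
      |X - Y| ≤ δ := by
    intro X Y k1 k2
    rw [abs_le]
    constructor <;> linarith [k1.1, k1.2, k2.1, k2.2]
  have far : ∀ {X Y : ℝ}, X < 1 → Y < 1 → (X = 0 ∨ 1 - δ ≤ X) → (Y = 0 ∨ 1 - δ ≤ Y) →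
      |X - Y| ≤ δ ∨ 1 - δ ≤ |X - Y| := by
    intro X Y k1 k2 k3 k4
    rcases k3 with rfl | k3 <;> rcases k4 with rfl | k4
    · left; simpa using hδ.le
    · right; rw [abs_sub_comm, sub_zero]; exact k4.trans (le_abs_self _)
    · right; rw [sub_zero]; exact k3.trans (le_abs_self _)
    · left; rw [abs_le]; constructor <;> linarith
  have cP := or_left_comm.1 (cl hP oP)
  have cQ := or_left_comm.1 (cl hQ oQ)
  have cR := or_left_comm.1 (cl hR oR)
  have nPR : ∀ {t : ℝ}, 2 * δ ≤ t ∧ 2 * δ ≤ 1 - t → ¬ (t ≤ δ ∨ 1 - δ ≤ t) := by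
    rintro t ⟨k1, k2⟩ (h | h) <;> linarith
  have nPQ : ¬ (|P - Q| ≤ δ ∨ 1 - δ ≤ |P - Q|) := by
    rintro (h | h) <;> linarith [hPQ.1, hPQ.2]
  -- Two of the three vertices lie in the same end of the strip.
  rcases cP with cP | cP <;> rcases cQ with cQ | cQ
  · exact nPQ (Or.inl (mid cP cQ))
  · rcases cR with cR | cR
    · exact nPR hPR (Or.inl (mid cP cR))
    · exact nPR hQR (far hQ' hR' cQ cR)
  · rcases cR with cR | cR
    · exact nPR hQR (Or.inl (mid cQ cR))
    · exact nPR hPR (far hP' hR' cP cR)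
  · exact nPQ (far hP' hQ' cP cQ)

theorem opp_mem_half (hx : x ∈ half θ i) : opp x ∈ half θ (!i) := by
  have h : arc (vtx θ (!i)) (opp x) = arc (vtx θ i) x := by
    refine arc_eq_of_coe (arc_nonneg _ _) (arc_lt_one _ _) ?_
    rw [coe_arc, ← opp_vtx, opp, opp]
    abel
  rw [half, Set.mem_ofPred_eq, h]
  exact hx

/-- A triangle with a common itinerary whose vertices never merge has an eventually periodic
itinerary. Otherwise its images are pairwise unlinked, so their shortest sides tend to zero.
Whenever a shortest side is shorter than all earlier ones, it is the image of a long side close to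
the diameter. At the next such time the triangle lies in the thin strip between that long side and
its antipode, hence it already has a side that is too short. -/
theorem exists_shift_eq_of_triangle (hper : sigma θ ∉ Function.periodicPts sigma)
    (hx : x ∈ fiber θ s) (hy : y ∈ fiber θ s) (hz : z ∈ fiber θ s)
    (hxy : ∀ n, sigma^[n] x ≠ sigma^[n] y) (hxz : ∀ n, sigma^[n] x ≠ sigma^[n] z)
    (hyz : ∀ n, sigma^[n] y ≠ sigma^[n] z) : ∃ m k, m < k ∧ shift^[m] s = shift^[k] s := by
  by_contra hcon
  have hinj : ∀ m k, shift^[m] s = shift^[k] s → m = k := by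
    intro m k h
    rcases lt_trichotomy m k with h' | h' | h'
    · exact absurd ⟨m, k, h', h⟩ hcon
    · exact h'
    · exact absurd ⟨k, m, h', h.symm⟩ hcon
  have hmem : ∀ {p}, (p = x ∨ p = y ∨ p = z) → ∀ n, sigma^[n] p ∈ fiber θ (shift^[n] s) := by
    rintro p (rfl | rfl | rfl) n
    exacts [mem_fiber_iterate hx n, mem_fiber_iterate hy n, mem_fiber_iterate hz n]
  have hnc : ∀ {p q p' q'}, (p = x ∨ p = y ∨ p = z) → (q = x ∨ q = y ∨ q = z) →
      (p' = x ∨ p' = y ∨ p' = z) → (q' = x ∨ q' = y ∨ q' = z) → ∀ n m, n ≠ m →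
      ¬ Cross (sigma^[n] p) (sigma^[n] q) (sigma^[m] p') (sigma^[m] q') :=
    fun h1 h2 h3 h4 n m hnm hc =>
      hnm (hinj n m (fiber_eq_of_cross hper (hmem h1 n) (hmem h2 n) (hmem h3 m) (hmem h4 m) hc))
  -- Corresponding vertices of different images are distinct.
  have hne : ∀ {p}, (p = x ∨ p = y ∨ p = z) → ∀ n m, n < m → sigma^[n] p ≠ sigma^[m] p := by
    intro p hp n m hnm h
    have h1 := hmem hp n
    have h2 := hmem hp m
    rw [← h] at h2
    have : ¬ ∀ k, sigma^[k + 1] (sigma^[n] p) ≠ sigma θ := fun hk =>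
      hnm.ne (hinj n m (fiber_unique h1 h2 hk))
    push Not at this
    obtain ⟨k, hk⟩ := this
    obtain ⟨b, hb⟩ := exists_lev_of_hit hk
    refine Leaf.not_periodic hper ⟨k, hb⟩ (m := m - n) (by omega) ?_
    rw [← Function.iterate_add_apply, show m - n + n = m by omega, h]
  set M : ℕ → ℝ := fun n => min (cdist (sigma^[n] x) (sigma^[n] y))
    (min (cdist (sigma^[n] x) (sigma^[n] z)) (cdist (sigma^[n] y) (sigma^[n] z))) with hM
  have hMpos : ∀ n, 0 < M n := fun n =>
    lt_min (cdist_pos (hxy n)) (lt_min (cdist_pos (hxz n)) (cdist_pos (hyz n)))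
  -- The shortest sides are not bounded below: two nearby large triangles are linked.
  have hsmall : ∀ c > 0, ∃ n, M n < c := by
    intro c hc
    by_contra hbig
    push Not at hbig
    obtain ⟨N, hN⟩ := exists_nat_gt (1 / c)
    have hN0 : (0 : ℝ) < N := lt_trans (by positivity) hN
    rw [div_lt_iff₀ hc] at hN
    set cell : UnitAddCircle → ℕ := fun p => ⌊N * arc 0 p⌋₊ with hcell
    have hcl : ∀ p, cell p < N := by
      intro p
      rw [hcell, Nat.floor_lt (mul_nonneg hN0.le (arc_nonneg _ _))]
      nlinarith [arc_lt_one 0 p]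
    have hclose : ∀ p q, cell p = cell q → arc 0 p < arc 0 q + c ∧ arc 0 q < arc 0 p + c := by
      intro p q h
      have f1 := Nat.floor_le (mul_nonneg hN0.le (arc_nonneg 0 p))
      have f2 := Nat.floor_le (mul_nonneg hN0.le (arc_nonneg 0 q))
      have f3 := Nat.lt_floor_add_one ((N : ℝ) * arc 0 p)
      have f4 := Nat.lt_floor_add_one ((N : ℝ) * arc 0 q)
      have h' : (⌊(N : ℝ) * arc 0 p⌋₊ : ℝ) = ⌊(N : ℝ) * arc 0 q⌋₊ := by exact_mod_cast h
      constructor <;> nlinarith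
    obtain ⟨n, m, hnm, heq⟩ := Finite.exists_ne_map_eq_of_infinite
      (fun n : ℕ => ((⟨cell (sigma^[n] x), hcl _⟩ : Fin N), (⟨cell (sigma^[n] y), hcl _⟩ : Fin N),
        (⟨cell (sigma^[n] z), hcl _⟩ : Fin N)))
    simp only [Prod.mk.injEq, Fin.mk.injEq] at heq
    obtain ⟨ex, ey, ez⟩ := heq
    have hne' : ∀ {p}, (p = x ∨ p = y ∨ p = z) → arc 0 (sigma^[n] p) ≠ arc 0 (sigma^[m] p) := by
      intro p hp h
      rcases lt_or_gt_of_ne hnm with h' | h'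
      · exact hne hp n m h' (arc_inj.1 h)
      · exact hne hp m n h' (arc_inj.1 h).symm
    have cl := hclose _ _ ex
    have cl' := hclose _ _ ey
    have cl'' := hclose _ _ ez
    -- Two vertices are moved in the same direction.
    have lk : ∀ {p q}, (p = x ∨ p = y ∨ p = z) → (q = x ∨ q = y ∨ q = z) →
        c ≤ cdist (sigma^[n] p) (sigma^[n] q) → c ≤ cdist (sigma^[m] p) (sigma^[m] q) →
        cell (sigma^[n] p) = cell (sigma^[m] p) → cell (sigma^[n] q) = cell (sigma^[m] q) →
        (arc 0 (sigma^[n] p) < arc 0 (sigma^[m] p) ↔ arc 0 (sigma^[n] q) < arc 0 (sigma^[m] q)) →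
        False := by
      intro p q hp hq d1 d2 c1 c2 hiff
      have h1 := hnc hp hq hp hq n m hnm
      rw [cross_iff 0] at h1
      rw [cdist_base 0, le_min_iff, le_abs] at d1 d2
      have k1 := hclose _ _ c1
      have k2 := hclose _ _ c2
      have n1 := hne' hp
      have n2 := hne' hq
      generalize arc 0 (sigma^[n] p) = A at *
      generalize arc 0 (sigma^[n] q) = B at *
      generalize arc 0 (sigma^[m] p) = A' at *
      generalize arc 0 (sigma^[m] q) = B' at *
      apply h1
      unfold CrossR
      rcases lt_or_gt_of_ne n1 with h | h
      · have h' := hiff.1 h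
        rcases d1.1 with d | d
        · exact Or.inr (Or.inr (Or.inr ⟨h', by linarith [k2.2], Or.inr h⟩))
        · exact Or.inl ⟨h, by linarith [k1.2], Or.inr h'⟩
      · have h' : B' < B := lt_of_le_of_ne (not_lt.1 fun h' => (hiff.2 h').not_gt h) n2.symm
        rcases d1.1 with d | d
        · exact Or.inr (Or.inr (Or.inl ⟨by linarith [k1.1], h, Or.inl h'⟩))
        · exact Or.inr (Or.inl ⟨by linarith [k2.1], h', Or.inl h⟩)
    have b1 := le_min_iff.1 (hbig n)
    have b2 := le_min_iff.1 (hbig m)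
    have b3 := le_min_iff.1 b1.2
    have b4 := le_min_iff.1 b2.2
    have l1 := lk (p := x) (q := y) (by simp) (by simp) b1.1 b2.1 ex ey
    have l2 := lk (p := x) (q := z) (by simp) (by simp) b3.1 b4.1 ex ez
    have l3 := lk (p := y) (q := z) (by simp) (by simp) b3.2 b4.2 ey ez
    tauto
  -- Times at which the shortest side is shorter than before.
  have record : ∀ c, 0 < c → c ≤ M 0 → ∃ n, M (n + 1) < c ∧ ∀ i ≤ n, c ≤ M i := by
    intro c hc hc0
    classical
    have hex := hsmall c hc
    have h1 := Nat.find_spec hex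
    have h2 := fun i => Nat.find_min (m := i) hex
    generalize Nat.find hex = r at h1 h2
    cases r with
    | zero => exact absurd h1 (not_lt.2 hc0)
    | succ n => exact ⟨n, h1, fun i hi => not_lt.1 (h2 i (Nat.lt_succ_of_le hi))⟩
  -- At such a time one side is long, and the third vertex is not close to it.
  have long : ∀ n, M (n + 1) < M n → ∃ p q r, (p = x ∨ p = y ∨ p = z) ∧
      (q = x ∨ q = y ∨ q = z) ∧ (r = x ∨ r = y ∨ r = z) ∧
      cdist (sigma^[n] p) (sigma^[n] q) = 1 / 2 - M (n + 1) / 2 ∧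
      M n ≤ cdist (sigma^[n] p) (sigma^[n] q) ∧
      M n ≤ cdist (sigma^[n] p) (sigma^[n] r) ∧ M n ≤ cdist (sigma^[n] q) (sigma^[n] r) := by
    intro n hn
    have b1 := le_min_iff.1 (le_refl (M n))
    have b2 := le_min_iff.1 b1.2
    have step : ∀ {p q}, M n ≤ cdist (sigma^[n] p) (sigma^[n] q) →
        M (n + 1) = cdist (sigma^[n + 1] p) (sigma^[n + 1] q) →
        cdist (sigma^[n] p) (sigma^[n] q) = 1 / 2 - M (n + 1) / 2 := by
      intro p q h1 h2
      rw [Function.iterate_succ_apply', Function.iterate_succ_apply'] at h2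
      have := hMpos n
      rcases cdist_sigma (sigma^[n] p) (sigma^[n] q) with h | h <;> linarith [h.2]
    have hmin : M (n + 1) = cdist (sigma^[n + 1] x) (sigma^[n + 1] y) ∨
        M (n + 1) = cdist (sigma^[n + 1] x) (sigma^[n + 1] z) ∨
        M (n + 1) = cdist (sigma^[n + 1] y) (sigma^[n + 1] z) := by
      rcases min_choice (cdist (sigma^[n + 1] x) (sigma^[n + 1] y))
        (min (cdist (sigma^[n + 1] x) (sigma^[n + 1] z))
          (cdist (sigma^[n + 1] y) (sigma^[n + 1] z))) with h | h
      · exact Or.inl h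
      · rcases min_choice (cdist (sigma^[n + 1] x) (sigma^[n + 1] z))
          (cdist (sigma^[n + 1] y) (sigma^[n + 1] z)) with h' | h'
        · exact Or.inr (Or.inl (h.trans h'))
        · exact Or.inr (Or.inr (h.trans h'))
    rcases hmin with h | h | h
    · exact ⟨x, y, z, by simp, by simp, by simp, step b1.1 h, b1.1, b2.1, b2.2⟩
    · exact ⟨x, z, y, by simp, by simp, by simp, step b2.1 h, b2.1, b1.1,
        by rw [cdist_comm]; exact b2.2⟩
    · exact ⟨y, z, x, by simp, by simp, by simp, step b2.2 h, b2.2,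
        by rw [cdist_comm]; exact b1.1, by rw [cdist_comm]; exact b2.1⟩
  obtain ⟨n, hn, hn'⟩ := record (M 0) (hMpos 0) le_rfl
  obtain ⟨m, hm, hm'⟩ := record (M (n + 1)) (hMpos _) hn.le
  have hnm : n < m := by
    by_contra h
    have := hn' (m + 1)
    rcases (not_lt.1 h).eq_or_lt with h' | h'
    · rw [h'] at hm; exact lt_irrefl _ hm
    · linarith [this h']
  obtain ⟨a, b, -, ha, hb, -, hab, hab', -⟩ := long n (by linarith [hn' n le_rfl])
  obtain ⟨p, q, r, hp, hq, hr, hpq, hpq', hpr, hqr⟩ := long m (by linarith [hm' m le_rfl])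
  set δ := M (n + 1) / 2 with hδ
  have hδ0 : 0 < δ := by have := hMpos (n + 1); positivity
  have hδ1 : δ < 1 / 4 := by
    have := hn' n le_rfl
    linarith
  -- Orient the long side so that its arc is shorter than a half circle.
  obtain ⟨a, b, ha, hb, hab⟩ : ∃ a b, (a = x ∨ a = y ∨ a = z) ∧ (b = x ∨ b = y ∨ b = z) ∧
      arc (sigma^[n] a) (sigma^[n] b) = 1 / 2 - δ := by
    have hsym := arc_cases (sigma^[n] a) (sigma^[n] b) (sigma^[n] a)
    rw [arc_self] at hsym
    unfold cdist at hab
    rcases min_choice (arc (sigma^[n] a) (sigma^[n] b)) (1 - arc (sigma^[n] a) (sigma^[n] b))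
      with h | h
    · exact ⟨a, b, ha, hb, by rw [← hab, h]⟩
    · refine ⟨b, a, hb, ha, ?_⟩
      rw [← hab, h]
      rw [h] at hab
      rcases hsym with h' | h' <;> linarith [h'.1, h'.2]
  set A := sigma^[n] a with hA
  set B := sigma^[n] b with hB
  have hAs := hmem ha n
  have hBs := hmem hb n
  have flip : ∀ {X}, X ∈ fiber θ (shift^[n] s) →
      opp X ∈ fiber θ (consSeq (!(shift^[n] s 0)) (shift^[n + 1] s)) := by
    intro X hX
    have h1 := mem_fiber_iff.1 hX
    refine mem_fiber_iff.2 ⟨opp_mem_half h1.1, ?_⟩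
    rw [sigma_opp, shift_consSeq, Function.iterate_succ_apply']
    exact h1.2
  have hoA : arc A (opp A) = 1 / 2 := arc_opp_self A
  have hoB : arc A (opp B) = 1 - δ := by
    rcases arc_opp A B with h | h <;> linarith [h.1, h.2]
  refine thin_strip (P := arc A (sigma^[m] p)) (Q := arc A (sigma^[m] q))
    (R := arc A (sigma^[m] r)) hδ0 hδ1 (arc_nonneg _ _) (arc_lt_one _ _) (arc_nonneg _ _)
    (arc_lt_one _ _) (arc_nonneg _ _) (arc_lt_one _ _) ?_ ?_ ?_ ?_
  · have hX : ∀ {X : ℝ}, (X = arc A (sigma^[m] p) ∨ X = arc A (sigma^[m] q) ∨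
        X = arc A (sigma^[m] r)) → ∃ f, (f = x ∨ f = y ∨ f = z) ∧ X = arc A (sigma^[m] f) := by
      rintro X (rfl | rfl | rfl)
      exacts [⟨p, hp, rfl⟩, ⟨q, hq, rfl⟩, ⟨r, hr, rfl⟩]
    intro X Y h1 h2
    obtain ⟨f, hf, rfl⟩ := hX h1
    obtain ⟨g, hg, rfl⟩ := hX h2
    constructor
    · have h3 := hnc ha hb hf hg n m hnm.ne
      rwa [cross_iff A, ← hA, arc_self, ← hB, hab] at h3
    · intro h3
      rw [← hoA, ← hoB, ← cross_iff] at h3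
      have h4 := fiber_eq_of_cross hper (flip hAs) (flip hBs) (hmem hf m) (hmem hg m) h3
      have h5 := congrArg shift h4
      rw [shift_consSeq, ← Function.iterate_succ_apply' shift m] at h5
      exact hnm.ne (by have := hinj _ _ h5; omega)
  · rw [← cdist_base, hpq]
    linarith
  · rw [← cdist_base]
    have := hm' m le_rfl
    linarith
  · rw [← cdist_base]
    have := hm' m le_rfl
    linarith

/-! ### Edges of infinite gaps -/

/-- The pair `p, q` is an edge of the gap with itinerary `s`: both points belong to the gap, and no
point of the gap lies in the open arc from `p` to `q`. -/
structure Edge (θ : UnitAddCircle) (s : ℕ → Bool) (p q : UnitAddCircle) : Prop where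
  left_mem : p ∈ fiber θ s
  right_mem : q ∈ fiber θ s
  ne : p ≠ q
  hole : ∀ x ∈ fiber θ s, ¬ Btw p x q

theorem exists_shift_eq (hper : sigma θ ∉ Function.periodicPts sigma)
    (hs : (fiber θ s).Infinite) : ∃ m k, m < k ∧ shift^[m] s = shift^[k] s := by
  have hfin : ∀ x, {y | y = x ∨ Leaf θ x y}.Finite := by
    intro x
    have h1 : {y | Leaf θ x y}.Subsingleton := fun y hy z hz => Leaf.unique hper hy hz
    exact (Set.finite_singleton x).union h1.finite
  obtain ⟨x, hx⟩ := hs.nonempty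
  obtain ⟨y, hy, hy'⟩ := (hs.sdiff (hfin x)).nonempty
  obtain ⟨z, hz, hz'⟩ := (hs.sdiff ((hfin x).union (hfin y))).nonempty
  simp only [Set.mem_ofPred_eq, Set.mem_union, not_or] at hy' hz'
  exact exists_shift_eq_of_triangle hper hx hy hz
    (fun n h => hy'.2 (leaf_of_iterate_eq hx hy (Ne.symm hy'.1) h))
    (fun n h => hz'.1.2 (leaf_of_iterate_eq hx hz (Ne.symm hz'.1.1) h))
    (fun n h => hz'.2.2 (leaf_of_iterate_eq hy hz (Ne.symm hz'.2.1) h))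

theorem exists_mem_fiber_of_shift (hy : y ∈ fiber θ (shift s)) : ∃ x ∈ fiber θ s, sigma x = y :=
  ⟨lift θ (s 0) y, mem_fiber_iff.2 ⟨lift_mem_half _ _ _, by rwa [sigma_lift]⟩, sigma_lift _ _ _⟩

theorem Edge.not_leaf_sigma (h : Edge θ s p q) (hl : ¬ Leaf θ p q) :
    ¬ Leaf θ (sigma p) (sigma q) := fun h' =>
  hl (leaf_of_sigma (h.left_mem 0) (h.right_mem 0) h')

/-- The doubling map sends edges to edges, unless they are precritical. -/
theorem Edge.push (h : Edge θ s p q) (hl : ¬ Leaf θ p q) :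
    Edge θ (shift s) (sigma p) (sigma q) := by
  have hp := mem_fiber_iff.1 h.left_mem
  have hq := mem_fiber_iff.1 h.right_mem
  refine ⟨hp.2, hq.2, fun hσ => hl (leaf_of_mem_half hp.1 hq.1 hσ h.ne), ?_⟩
  intro y hy hb
  obtain ⟨x, hx, rfl⟩ := exists_mem_fiber_of_shift hy
  have hx1 := (mem_fiber_iff.1 hx).1
  apply h.hole x hx
  rw [btw_iff (vtx θ (s 0))]
  rw [btw_iff (sigma θ)] at hb
  have c1 := arc_sigma_half hp.1
  have c2 := arc_sigma_half hq.1
  have c3 := arc_sigma_half hx1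
  have n1 := arc_nonneg (vtx θ (s 0)) p
  have n2 := arc_nonneg (vtx θ (s 0)) q
  have n3 := arc_nonneg (vtx θ (s 0)) x
  have hl' : ¬ (arc (vtx θ (s 0)) p = 0 ∧ q = vtx θ (!(s 0))) := by
    rintro ⟨h1, h2⟩
    rw [arc_eq_zero] at h1
    rw [h1, h2] at hl
    exact hl ⟨0, lev_vtx θ _⟩
  have hl'' : ¬ (arc (vtx θ (s 0)) q = 0 ∧ p = vtx θ (!(s 0))) := by
    rintro ⟨h1, h2⟩
    rw [arc_eq_zero] at h1
    rw [h1, h2] at hl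
    exact hl ⟨0, (lev_vtx θ _).symm⟩
  generalize (1 : ℝ) / 2 = r at *
  rcases c1 with ⟨l1, m1⟩ | ⟨l1, e1, m1⟩ <;> rcases c2 with ⟨l2, m2⟩ | ⟨l2, e2, m2⟩ <;>
    rcases c3 with ⟨l3, m3⟩ | ⟨l3, -, m3⟩ <;> rw [m1, m2, m3] at hb <;> grind

theorem Edge.arc_ne_half (h : Edge θ s p q) (hl : ¬ Leaf θ p q) : arc p q ≠ 1 / 2 := by
  intro h'
  rw [← arc_opp_self, arc_inj] at h'
  exact hl (leaf_of_mem_half (h.left_mem 0) (h.right_mem 0) (by rw [h', sigma_opp]) h.ne)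

/-- A gap has at most one edge whose hole is longer than a half circle. -/
theorem Edge.major_unique {p' q' : UnitAddCircle} (h : Edge θ s p q) (h' : Edge θ s p' q')
    (hm : 1 / 2 < arc p q) (hm' : 1 / 2 < arc p' q') : p = p' ∧ q = q' := by
  have h1 := h.hole p' h'.left_mem
  have h2 := h.hole q' h'.right_mem
  have h3 := h'.hole p h.left_mem
  have h4 := h'.hole q h.right_mem
  have h5 := arc_cases p p' q'
  rw [btw_iff p] at h1 h2 h3 h4
  rw [arc_self] at h1 h2 h3
  rw [← arc_inj (c := p), ← arc_inj (c := p) (x := q), arc_self]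
  have n1 := arc_nonneg p p'
  have n2 := arc_nonneg p q'
  have n3 := arc_lt_one p p'
  have n4 := arc_lt_one p q'
  have n5 := arc_lt_one p q
  have e : (1 : ℝ) / 2 * 2 = 1 := by norm_num
  generalize (1 : ℝ) / 2 = r at *
  have h6 : arc p p' = 0 := by grind
  have h7 : arc p q' ≠ 0 := by grind
  grind

/-- The doubling map is monotone on a gap, with respect to the linear order that starts at the end
of a hole. -/
theorem Edge.monotone (h : Edge θ s p q) (hl : ¬ Leaf θ p q) (hx : x ∈ fiber θ s)
    (hy : y ∈ fiber θ s) (hxy : arc q x ≤ arc q y) :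
    arc (sigma q) (sigma x) ≤ arc (sigma q) (sigma y) := by
  by_contra hc
  push Not at hc
  have hole := h.hole y hy
  rw [btw_iff q, arc_self] at hole
  have hy1 := arc_lt_one q y
  have hp0 := arc_pos.2 h.ne
  have n0 := arc_nonneg q y
  have hxl : arc q x < 1 / 2 := by
    rcases arc_sigma q x with h1 | h1 <;> rcases arc_sigma q y with h2 | h2 <;> linarith
  have hyl : 1 / 2 ≤ arc q y := by
    rcases arc_sigma q x with h1 | h1 <;> rcases arc_sigma q y with h2 | h2 <;> linarith
  have hdiff : arc q y - arc q x < 1 / 2 := by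
    rcases arc_sigma q x with h1 | h1 <;> rcases arc_sigma q y with h2 | h2 <;> linarith
  have hpy : arc q y ≤ arc q p := by grind
  have kx : arc (vtx θ (s 0)) x ≤ 1 / 2 := hx 0
  have ky : arc (vtx θ (s 0)) y ≤ 1 / 2 := hy 0
  have kq : arc (vtx θ (s 0)) q ≤ 1 / 2 := h.right_mem 0
  have kp : arc (vtx θ (s 0)) p ≤ 1 / 2 := h.left_mem 0
  have c1 := arc_cases (vtx θ (s 0)) q x
  have c2 := arc_cases (vtx θ (s 0)) q y
  have c3 := arc_cases (vtx θ (s 0)) q p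
  have n1 := arc_nonneg (vtx θ (s 0)) x
  have n2 := arc_nonneg (vtx θ (s 0)) y
  have n3 := arc_nonneg (vtx θ (s 0)) p
  have n4 := arc_nonneg (vtx θ (s 0)) q
  rcases c2 with ⟨l2, m2⟩ | ⟨l2, m2⟩
  · -- The point `y` is opposite to `q`, so it is the point `p`.
    have hq0 : arc (vtx θ (s 0)) q = 0 := by linarith
    have hp2 : arc (vtx θ (s 0)) p = 1 / 2 := by
      rcases c3 with ⟨l3, m3⟩ | ⟨l3, m3⟩ <;> linarith
    rw [arc_eq_zero] at hq0
    rw [← arc_opp_self, arc_inj] at hp2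
    exact hl (leaf_of_mem_half (h.left_mem 0) (h.right_mem 0) (by rw [hp2, hq0, sigma_opp]) h.ne)
  · rcases c1 with ⟨l1, m1⟩ | ⟨l1, m1⟩ <;> linarith

theorem Edge.iterate (h : Edge θ s p q) (hl : ¬ Leaf θ p q) (k : ℕ) :
    Edge θ (shift^[k] s) (sigma^[k] p) (sigma^[k] q) ∧ ¬ Leaf θ (sigma^[k] p) (sigma^[k] q) := by
  induction k generalizing s p q with
  | zero => exact ⟨h, hl⟩
  | succ k ih => exact ih (h.push hl) (h.not_leaf_sigma hl)

theorem Edge.monotone_iterate (h : Edge θ s p q) (hl : ¬ Leaf θ p q) (hx : x ∈ fiber θ s)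
    (hy : y ∈ fiber θ s) (hxy : arc q x ≤ arc q y) (k : ℕ) :
    arc (sigma^[k] q) (sigma^[k] x) ≤ arc (sigma^[k] q) (sigma^[k] y) := by
  induction k generalizing s p q x y with
  | zero => exact hxy
  | succ k ih =>
    exact ih (h.push hl) (h.not_leaf_sigma hl) (mem_fiber_iff.1 hx).2 (mem_fiber_iff.1 hy).2
      (h.monotone hl hx hy hxy)

/-- Holes shorter than a half circle double in length, so every edge that is not precritical has
images whose hole is longer than a half circle. -/
theorem Edge.exists_major (h : Edge θ s p q) (hl : ¬ Leaf θ p q) :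
    ∃ k, 1 / 2 < arc (sigma^[k] p) (sigma^[k] q) := by
  by_contra hc
  push Not at hc
  have hdouble : ∀ k, arc (sigma^[k] p) (sigma^[k] q) = 2 ^ k * arc p q := by
    intro k
    induction k with
    | zero => simp
    | succ k ih =>
      obtain ⟨h1, h2⟩ := h.iterate hl k
      rw [Function.iterate_succ_apply', Function.iterate_succ_apply']
      rcases arc_sigma (sigma^[k] p) (sigma^[k] q) with h3 | h3
      · rw [h3.2, ih, pow_succ]; ring
      · exact absurd (le_antisymm (hc k) h3.1) (h1.arc_ne_half h2)
  have hpos : 0 < arc p q := arc_pos.2 h.ne.symm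
  obtain ⟨N, hN⟩ := pow_unbounded_of_one_lt (1 / arc p q) (one_lt_two : (1 : ℝ) < 2)
  rw [div_lt_iff₀ hpos] at hN
  have := hc N
  rw [hdouble N] at this
  linarith

/-- If an edge that is not precritical is fixed by a return map of its gap, then the return map
fixes the whole gap: it is monotone and expanding, so orbits of other points would have to land
exactly on a fixed point, which only endpoints of precritical leaves do. -/
theorem Edge.iterate_fixed (hper : sigma θ ∉ Function.periodicPts sigma) (h : Edge θ s p q)
    (hl : ¬ Leaf θ p q) (hN : 0 < N) (hs : shift^[N] s = s) (hq : sigma^[N] q = q)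
    (hx : x ∈ fiber θ s) : sigma^[N] x = x := by
  by_contra hne
  have hq' := hq
  set f := sigma^[N] with hf
  have hmem : ∀ n, f^[n] x ∈ fiber θ s := by
    intro n
    induction n with
    | zero => exact hx
    | succ n ih =>
      rw [Function.iterate_succ_apply']
      have := mem_fiber_iterate ih N
      rwa [hs] at this
  set c : ℕ → ℝ := fun n => arc q (f^[n] x) with hc
  have hstep : ∀ n m, c n ≤ c m → c (n + 1) ≤ c (m + 1) := by
    intro n m hnm
    have := h.monotone_iterate hl (hmem n) (hmem m) hnm N
    rw [← hf, hq] at this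
    simpa only [hc, Function.iterate_succ_apply'] using this
  have hconv : ∃ ζ, Filter.Tendsto c Filter.atTop (nhds ζ) := by
    rcases le_total (c 0) (c 1) with h0 | h0
    · have hmono : Monotone c := monotone_nat_of_le_succ fun n => by
        induction n with
        | zero => exact h0
        | succ n ih => exact hstep _ _ ih
      exact ⟨_, tendsto_atTop_ciSup hmono ⟨1, by
        rintro _ ⟨n, rfl⟩
        exact (arc_lt_one _ _).le⟩⟩
    · have hanti : Antitone c := antitone_nat_of_succ_le fun n => by
        induction n with
        | zero => exact h0
        | succ n ih => exact hstep _ _ ih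
      exact ⟨_, tendsto_atTop_ciInf hanti ⟨0, by
        rintro _ ⟨n, rfl⟩
        exact arc_nonneg _ _⟩⟩
  obtain ⟨ζ, hζ⟩ := hconv
  have hdiff : Filter.Tendsto (fun n => c (n + 1) - c n) Filter.atTop (nhds 0) := by
    have := (hζ.comp (Filter.tendsto_add_atTop_nat 1)).sub hζ
    simpa using this
  -- Successive differences are multiplied by `2 ^ N`, up to integers.
  have hint : ∀ n, ∃ z : ℤ, 2 ^ N * (c (n + 1) - c n) - (c (n + 2) - c (n + 1)) = z := by
    intro n
    have key : ∀ n, ((c (n + 1) : ℝ) : UnitAddCircle) = (2 ^ N) • ((c n : ℝ) : UnitAddCircle) := by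
      intro n
      simp only [hc]
      rw [coe_arc, coe_arc, Function.iterate_succ_apply', smul_sub, ← sigma_iterate,
        ← sigma_iterate, ← hf, hq]
    have h0 : ((2 ^ N * (c (n + 1) - c n) - (c (n + 2) - c (n + 1)) : ℝ) : UnitAddCircle) = 0 := by
      have e : (2 ^ N * (c (n + 1) - c n) : ℝ) = (2 ^ N) • (c (n + 1) - c n) := by
        rw [nsmul_eq_mul]; push_cast; rfl
      rw [e, AddCircle.coe_sub, AddCircle.coe_nsmul, AddCircle.coe_sub, AddCircle.coe_sub, key n,
        key (n + 1), key n, smul_sub]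
      abel
    obtain ⟨z, hz⟩ := (AddCircle.coe_eq_zero_iff (1 : ℝ)).1 h0
    exact ⟨z, by simpa using hz.symm⟩
  have h2N : (2 : ℝ) ≤ 2 ^ N := by
    calc (2 : ℝ) = 2 ^ 1 := (pow_one 2).symm
      _ ≤ 2 ^ N := pow_le_pow_right₀ one_le_two hN
  have hε : (0 : ℝ) < 1 / (2 * 2 ^ N) := by positivity
  obtain ⟨n₀, hn₀⟩ := Metric.tendsto_atTop.1 hdiff _ hε
  have hsm : ∀ n ≥ n₀, |2 ^ N * (c (n + 1) - c n)| < 1 / 2 := by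
    intro n hn
    have := hn₀ n hn
    rw [dist_zero_right, Real.norm_eq_abs, lt_div_iff₀ (by positivity)] at this
    rw [abs_mul, abs_of_pos (by positivity : (0 : ℝ) < 2 ^ N)]
    linarith
  have hexp : ∀ n ≥ n₀, c (n + 2) - c (n + 1) = 2 ^ N * (c (n + 1) - c n) := by
    intro n hn
    obtain ⟨z, hz⟩ := hint n
    have h1 := abs_lt.1 (hsm n hn)
    have h2 := hsm (n + 1) (by omega)
    rw [abs_mul, abs_of_pos (by positivity : (0 : ℝ) < 2 ^ N)] at h2
    have h3 : |c (n + 2) - c (n + 1)| < 1 / 2 := by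
      have := abs_nonneg (c (n + 2) - c (n + 1))
      have h2 : 2 ^ N * |c (n + 2) - c (n + 1)| < 1 / 2 := h2
      nlinarith
    have h3 := abs_lt.1 h3
    have hz1 : ((z : ℤ) : ℝ) < 1 := by linarith [h1.2, h3.1]
    have hz2 : (-1 : ℝ) < (z : ℤ) := by linarith [h1.1, h3.2]
    have hz3 : z < 1 := by exact_mod_cast hz1
    have hz4 : -1 < z := by exact_mod_cast hz2
    have hz0 : z = 0 := by omega
    rw [hz0] at hz
    push_cast at hz
    linarith
  have hgrow : ∀ k, c (n₀ + k + 1) - c (n₀ + k) = (2 ^ N) ^ k * (c (n₀ + 1) - c n₀) := by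
    intro k
    induction k with
    | zero => simp
    | succ k ih =>
      have := hexp (n₀ + k) (by omega)
      rw [ih] at this
      rw [show n₀ + (k + 1) + 1 = n₀ + k + 2 by ring, show n₀ + (k + 1) = n₀ + k + 1 by ring, this]
      ring
  have hzero : c (n₀ + 1) - c n₀ = 0 := by
    by_contra h0
    have hpos := abs_pos.2 h0
    obtain ⟨k, hk⟩ := pow_unbounded_of_one_lt (1 / |c (n₀ + 1) - c n₀|)
      (lt_of_lt_of_le one_lt_two h2N)
    rw [div_lt_iff₀ hpos] at hk
    have h1 := hgrow k
    have h2 : |c (n₀ + k + 1) - c (n₀ + k)| < 1 := by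
      rw [abs_lt]
      have := arc_nonneg q (f^[n₀ + k + 1] x)
      have := arc_nonneg q (f^[n₀ + k] x)
      have := arc_lt_one q (f^[n₀ + k + 1] x)
      have := arc_lt_one q (f^[n₀ + k] x)
      constructor <;> simp only [hc] <;> linarith
    rw [h1, abs_mul, abs_of_pos (by positivity)] at h2
    linarith
  -- Some point of the orbit is not fixed although its image is.
  have hfix : f (f^[n₀] x) = f^[n₀] x := by
    rw [← Function.iterate_succ_apply' f]
    exact arc_inj.1 (by linarith : c (n₀ + 1) = c n₀)
  have hex : ∃ n, f (f^[n] x) = f^[n] x := ⟨n₀, hfix⟩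
  classical
  have h1 := Nat.find_spec hex
  have h2 := fun i => Nat.find_min (m := i) hex
  generalize Nat.find hex = j at h1 h2
  cases j with
  | zero => exact hne h1
  | succ j =>
    have h3 := h2 j (Nat.lt_succ_self j)
    rw [Function.iterate_succ_apply'] at h1
    have hlf := leaf_of_iterate_eq (n := N) (hmem j) (hmem (j + 1))
      (by rw [Function.iterate_succ_apply']; exact Ne.symm h3)
      (by rw [Function.iterate_succ_apply']; exact h1.symm)
    refine hlf.symm.not_periodic hper hN ?_
    rw [Function.iterate_succ_apply']
    exact h1

theorem fixed_finite (hN : 0 < N) : {x | sigma^[N] x = x}.Finite := by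
  have hpos : 0 < 2 ^ N - 1 := by
    have := Nat.one_lt_two_pow hN.ne'
    omega
  refine (AddCircle.finite_torsion (1 : ℝ) hpos).subset fun x hx => ?_
  have hx : sigma^[N] x = x := hx
  rw [sigma_iterate] at hx
  have h1 : (2 ^ N - 1) • x + x = (2 ^ N) • x := by
    rw [← succ_nsmul]
    congr 1
    have := Nat.one_lt_two_pow hN.ne'
    omega
  rw [hx] at h1
  simpa using h1

theorem shift_iterate_add_mul (h : shift^[m] s = shift^[m + k] s) (j : ℕ) (hj : m ≤ j) (i : ℕ) :
    shift^[j + i * k] s = shift^[j] s := by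
  have key : ∀ j, m ≤ j → shift^[j + k] s = shift^[j] s := by
    intro j hj
    obtain ⟨r, rfl⟩ := Nat.exists_eq_add_of_le hj
    rw [show m + r + k = r + (m + k) by ring, Function.iterate_add_apply, ← h,
      ← Function.iterate_add_apply, add_comm]
  induction i with
  | zero => simp
  | succ i ih =>
    rw [show j + (i + 1) * k = j + i * k + k by ring, key _ (by omega), ih]

/-- All edges of an infinite gap are precritical leaves. -/
theorem leaf_of_edge (hper : sigma θ ∉ Function.periodicPts sigma)
    (hs : (fiber θ s).Infinite) (h : Edge θ s p q) : Leaf θ p q := by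
  by_contra hl
  obtain ⟨m, k, hmk, heq⟩ := exists_shift_eq hper hs
  obtain ⟨k, rfl⟩ := Nat.exists_eq_add_of_lt hmk
  rw [add_assoc] at heq
  -- The edge has images with a long hole at infinitely many times.
  have hinf : {j | m ≤ j ∧ 1 / 2 < arc (sigma^[j] p) (sigma^[j] q)}.Infinite := by
    rw [Set.infinite_iff_exists_gt]
    intro j
    obtain ⟨h1, h2⟩ := h.iterate hl (m + j + 1)
    obtain ⟨r, hr⟩ := h1.exists_major h2
    rw [← Function.iterate_add_apply, ← Function.iterate_add_apply] at hr
    exact ⟨r + (m + j + 1), ⟨by omega, hr⟩, by omega⟩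
  obtain ⟨i, hi, j, hj, hij, hmod⟩ := hinf.exists_ne_map_eq_of_mapsTo
    (f := fun j => j % (k + 1)) (t := Set.Iio (k + 1))
    (fun j _ => Nat.mod_lt j k.succ_pos) (Set.finite_Iio _)
  wlog hlt : i < j generalizing i j
  · exact this j hj i hi hij.symm hmod.symm (by omega)
  obtain ⟨r, hr⟩ := (Nat.modEq_iff_dvd' hlt.le).1 hmod
  have hj' : j = i + r * (k + 1) := by rw [mul_comm]; omega
  have hsh : shift^[j] s = shift^[i] s := by
    rw [hj']; exact shift_iterate_add_mul heq i hi.1 r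
  obtain ⟨h1, h2⟩ := h.iterate hl i
  obtain ⟨h3, -⟩ := h.iterate hl j
  rw [hsh] at h3
  obtain ⟨-, h5⟩ := h1.major_unique h3 hi.2 hj.2
  have hN : 0 < j - i := by omega
  have hadd : j - i + i = j := by omega
  refine fiber_infinite_iterate hs i ((fixed_finite hN).subset fun x hx => ?_)
  refine h1.iterate_fixed hper h2 hN ?_ ?_ hx
  · rw [← Function.iterate_add_apply, hadd, hsh]
  · rw [← Function.iterate_add_apply, hadd, ← h5]

/-! ### Edges of gaps are limits of precritical leaves -/

/-- A leaf that crosses a side of the triangle `p, z, q`, but not the side `p, q`, cuts off `z`. -/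
theorem exists_leaf_around (hper : sigma θ ∉ Function.periodicPts sigma) (h : Edge θ s p q)
    (hl : ¬ Leaf θ p q) (hz : Btw p z q) :
    ∃ α β, Leaf θ α β ∧ arc p α < arc p z ∧ arc p z < arc p β ∧ arc p β ≤ arc p q := by
  have hpq : Comp θ p q := ⟨s, h.left_mem, h.right_mem⟩
  have hnot : ¬ (Comp θ p z ∧ Comp θ q z) := by
    rintro ⟨h1, h2⟩
    obtain ⟨t, ht⟩ := exists_fiber_of_pairwise (θ := θ) (A := {p, q, z}) (by
      rintro u (rfl | rfl | rfl) v (rfl | rfl | rfl) <;>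
        first | exact comp_self _ _ | assumption | (apply Comp.symm; assumption))
    by_cases hst : s = t
    · exact h.hole z (hst ▸ ht (by simp)) hz
    · exact hl (leaf_of_two_fibers hst h.left_mem h.right_mem (ht (by simp)) (ht (by simp)) h.ne)
  have hz' := hz
  rw [btw_iff p, arc_self] at hz'
  have n1 := arc_nonneg p z
  have n2 := arc_nonneg p q
  have key : ∃ α β, Leaf θ α β ∧ (Cross p z α β ∨ Cross q z α β) := by
    by_cases h1 : Comp θ p z
    · obtain ⟨α, β, h2, h3⟩ := exists_leaf_cross hper (fun h2 => hnot ⟨h1, h2⟩)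
      exact ⟨α, β, h2, Or.inr h3⟩
    · obtain ⟨α, β, h2, h3⟩ := exists_leaf_cross hper h1
      exact ⟨α, β, h2, Or.inl h3⟩
  obtain ⟨α, β, h1, h2⟩ := key
  have h3 := h1.not_cross_comp hper hpq
  rw [cross_iff p, arc_self] at h3
  rw [cross_iff p, cross_iff p, arc_self] at h2
  have n3 := arc_nonneg p α
  have n4 := arc_nonneg p β
  unfold CrossR at h2 h3
  by_cases h4 : arc p α < arc p z
  · refine ⟨α, β, h1, h4, ?_⟩
    constructor <;> grind (splits := 40)
  · refine ⟨β, α, h1.symm, ?_⟩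
    refine ⟨?_, ?_, ?_⟩ <;> grind (splits := 40)

theorem continuous_add_coe (p : UnitAddCircle) :
    Continuous fun l : ℝ × ℝ => (p + (l.1 : UnitAddCircle), p + (l.2 : UnitAddCircle)) :=
  (continuous_const.add ((AddCircle.continuous_mk' (1 : ℝ)).comp continuous_fst)).prodMk
    (continuous_const.add ((AddCircle.continuous_mk' (1 : ℝ)).comp continuous_snd))

/-- Limits of precritical leaves, in coordinates. -/
theorem mem_lamination_of_closure (hper : sigma θ ∉ Function.periodicPts sigma) {Q : Set (ℝ × ℝ)}
    (hQ : ∀ l ∈ Q, Leaf θ (p + (l.1 : UnitAddCircle)) (p + (l.2 : UnitAddCircle))) {l : ℝ × ℝ}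
    (hl : l ∈ closure Q) :
    (p + (l.1 : UnitAddCircle), p + (l.2 : UnitAddCircle)) ∈ pullbackLamination θ := by
  rw [pullbackLamination_eq hper]
  exact map_mem_closure (f := fun l : ℝ × ℝ =>
    (p + (l.1 : UnitAddCircle), p + (l.2 : UnitAddCircle))) (continuous_add_coe p) hl hQ

/-- A set of intervals inside `[0, 1]` has an interval of maximal length in its closure (take
`r = 1`), and also one of minimal length (take `r = -1`). -/
theorem exists_extremal {Q : Set (ℝ × ℝ)} (h : Q.Nonempty)
    (hQ : Q ⊆ Set.Icc (0 : ℝ) 1 ×ˢ Set.Icc (0 : ℝ) 1) (r : ℝ) :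
    ∃ l ∈ closure Q, ∀ m ∈ Q, r * (m.2 - m.1) ≤ r * (l.2 - l.1) := by
  have hc : IsCompact (closure Q) :=
    (isCompact_Icc.prod isCompact_Icc).of_isClosed_subset isClosed_closure
      (closure_minimal hQ (isClosed_Icc.prod isClosed_Icc))
  obtain ⟨l, hl, hmax⟩ := hc.exists_isMaxOn h.closure
    (f := fun l : ℝ × ℝ => r * (l.2 - l.1)) (by fun_prop)
  exact ⟨l, hl, fun m hm => hmax (subset_closure hm)⟩

/-- Every edge of a gap is a limit of precritical leaves, or precritical itself: the leaves that cut
off points of its hole exhaust the hole. -/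
theorem Edge.mem_lamination (hper : sigma θ ∉ Function.periodicPts sigma) (h : Edge θ s p q) :
    (p, q) ∈ pullbackLamination θ := by
  by_cases hl : Leaf θ p q
  · exact hl.mem_lamination hper
  have hA : 0 < arc p q := arc_pos.2 h.ne.symm
  have hA1 := arc_lt_one p q
  -- Consider the leaves around the midpoint of the hole.
  set Q : Set (ℝ × ℝ) := {l | Leaf θ (p + (l.1 : UnitAddCircle)) (p + (l.2 : UnitAddCircle)) ∧
    0 ≤ l.1 ∧ l.1 ≤ arc p q / 2 ∧ arc p q / 2 ≤ l.2 ∧ l.2 ≤ arc p q} with hQ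
  have hcov : ∀ t, 0 < t → t < arc p q → ∃ l : ℝ × ℝ,
      Leaf θ (p + (l.1 : UnitAddCircle)) (p + (l.2 : UnitAddCircle)) ∧
      0 ≤ l.1 ∧ l.1 < t ∧ t < l.2 ∧ l.2 ≤ arc p q := by
    intro t h0 h1
    have ht : arc p (p + (t : UnitAddCircle)) = t := arc_add_coe h0.le (h1.trans hA1)
    obtain ⟨α, β, h2, h3, h4, h5⟩ := exists_leaf_around hper h hl
      (z := p + (t : UnitAddCircle)) ⟨by rwa [ht], by rwa [ht]⟩
    rw [ht] at h3 h4
    exact ⟨(arc p α, arc p β), by simpa only [add_coe_arc] using h2, arc_nonneg _ _, h3, h4, h5⟩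
  have hQne : ∃ l ∈ Q, l.1 < l.2 := by
    obtain ⟨l, h1, h2, h3, h4, h5⟩ := hcov (arc p q / 2) (by linarith) (by linarith)
    exact ⟨l, ⟨h1, h2, h3.le, h4.le, h5⟩, h3.trans h4⟩
  obtain ⟨l, hlQ, hmax⟩ := exists_extremal (Q := Q) (let ⟨l, h, _⟩ := hQne; ⟨l, h⟩) (by
    rintro l ⟨-, h1, h2, h3, h4⟩
    exact ⟨⟨h1, by linarith⟩, ⟨by linarith, by linarith⟩⟩) 1
  simp only [one_mul] at hmax
  have hbd : l ∈ Set.Icc (0 : ℝ) (arc p q / 2) ×ˢ Set.Icc (arc p q / 2) (arc p q) :=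
    closure_minimal (t := Set.Icc (0 : ℝ) (arc p q / 2) ×ˢ Set.Icc (arc p q / 2) (arc p q))
      (fun l hl => ⟨⟨hl.2.1, hl.2.2.1⟩, ⟨hl.2.2.2.1, hl.2.2.2.2⟩⟩)
      (isClosed_Icc.prod isClosed_Icc) hlQ
  obtain ⟨⟨b1, b2⟩, ⟨b3, b4⟩⟩ := hbd
  have hlL := mem_lamination_of_closure hper (fun l hl => hl.1) hlQ
  have hlt : l.1 < l.2 := by
    obtain ⟨m, hm, h1⟩ := hQne
    linarith [hmax m hm]
  -- No leaf around an endpoint of the longest limit leaf can be longer or cross it.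
  have hno : ∀ t, (t = l.1 ∨ t = l.2) → 0 < t → t < arc p q → False := by
    intro t ht h0 h1
    obtain ⟨m, h2, h3, h4, h5, h6⟩ := hcov t h0 h1
    have hcr := not_cross_of_mem_lamination hper hlL h2.comp
    rw [cross_iff p, arc_add_coe b1 (by linarith), arc_add_coe (by linarith) (by linarith),
      arc_add_coe h3 (by linarith), arc_add_coe (by linarith) (by linarith)] at hcr
    unfold CrossR at hcr
    have h7 : m.1 ≤ l.1 ∧ l.2 ≤ m.2 := by
      rcases ht with rfl | rfl
      · refine ⟨h4.le, ?_⟩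
        by_contra h8
        exact hcr (by grind)
      · refine ⟨?_, h5.le⟩
        by_contra h8
        exact hcr (by grind)
    have := hmax m ⟨h2, h3, by linarith, by linarith, h6⟩
    rcases ht with rfl | rfl <;> linarith [h7.1, h7.2]
  have e1 : l.1 = 0 := by
    by_contra h1
    exact hno l.1 (Or.inl rfl) (lt_of_le_of_ne b1 (Ne.symm h1)) (by linarith)
  have e2 : l.2 = arc p q := by
    by_contra h1
    exact hno l.2 (Or.inr rfl) (by linarith) (lt_of_le_of_ne b4 h1)
  rw [e1, e2, add_coe_arc] at hlL
  simpa using hlL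

/-- All points of a finite gap are equivalent: otherwise a shortest arc from a point of one class
to a point of another class would be an edge. -/
theorem rel_of_finite (hper : sigma θ ∉ Function.periodicPts sigma) (hs : (fiber θ s).Finite)
    (hx : x ∈ fiber θ s) (hy : y ∈ fiber θ s) : inducedSetoid (pullbackLamination θ) x y := by
  by_contra hxy
  set R := inducedSetoid (pullbackLamination θ)
  have hfin : (fiber θ s ×ˢ fiber θ s ∩ {l | R x l.1 ∧ ¬ R x l.2}).Finite :=
    (hs.prod hs).subset Set.inter_subset_left
  obtain ⟨⟨a, b⟩, ⟨⟨ha, hb⟩, ha', hb'⟩, hmin⟩ := Set.exists_min_image _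
    (fun l : UnitAddCircle × UnitAddCircle => arc l.1 l.2) hfin ⟨(x, y), ⟨hx, hy⟩, R.refl x, hxy⟩
  have hedge : Edge θ s a b := by
    refine ⟨ha, hb, fun h => hb' (h ▸ ha'), fun z hz hb => ?_⟩
    obtain ⟨h1, h2⟩ := hb
    by_cases hR : R x z
    · have h3 := hmin (z, b) ⟨⟨hz, ‹_›⟩, hR, hb'⟩
      have h3 : arc a b ≤ arc z b := h3
      rcases arc_cases a z b with h4 | h4 <;> linarith
    · have h3 := hmin (a, z) ⟨⟨ha, hz⟩, ha', hR⟩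
      have h3 : arc a b ≤ arc a z := h3
      linarith
  exact hb' (R.trans ha' (rel_of_mem_lamination (hedge.mem_lamination hper)))

/-! ### The relation generated by leaves and finite gaps -/

/-- Points are directly related if they coincide, bound a precritical leaf, or belong to a common
finite gap. -/
def Rel (θ x y : UnitAddCircle) : Prop :=
  x = y ∨ Leaf θ x y ∨ ∃ s, (fiber θ s).Finite ∧ x ∈ fiber θ s ∧ y ∈ fiber θ s

theorem Rel.symm (h : Rel θ x y) : Rel θ y x := by
  rcases h with h | h | ⟨s, h, hx, hy⟩
  · exact Or.inl h.symm
  · exact Or.inr (Or.inl h.symm)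
  · exact Or.inr (Or.inr ⟨s, h, hy, hx⟩)

theorem Rel.comp (h : Rel θ x y) : Comp θ x y := by
  rcases h with rfl | h | ⟨s, h, hx, hy⟩
  · exact comp_self _ _
  · exact h.comp
  · exact ⟨s, hx, hy⟩

theorem Rel.rel (hper : sigma θ ∉ Function.periodicPts sigma) (h : Rel θ x y) :
    inducedSetoid (pullbackLamination θ) x y := by
  rcases h with rfl | h | ⟨s, h, hx, hy⟩
  · exact Setoid.refl' _ _
  · exact rel_of_mem_lamination (h.mem_lamination hper)
  · exact rel_of_finite hper h hx hy

/-- A pair of distinct points of an infinite gap that is not a precritical leaf separates points of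
the gap. -/
theorem exists_cross_of_infinite (hper : sigma θ ∉ Function.periodicPts sigma)
    (hs : (fiber θ s).Infinite) (hx : x ∈ fiber θ s) (hy : y ∈ fiber θ s) (hxy : x ≠ y)
    (hl : ¬ Leaf θ x y) : ∃ z ∈ fiber θ s, ∃ w ∈ fiber θ s, Btw x z y ∧ Btw y w x := by
  by_contra hc
  push Not at hc
  by_cases h1 : ∃ z ∈ fiber θ s, Btw x z y
  · obtain ⟨z, hz, hz'⟩ := h1
    exact hl (leaf_of_edge hper hs ⟨hy, hx, hxy.symm, fun w hw => hc z hz w hw hz'⟩).symm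
  · push Not at h1
    exact hl (leaf_of_edge hper hs ⟨hx, hy, hxy, h1⟩)

/-- A directly related pair that crosses a diagonal of a gap belongs to this gap, which is then
finite. -/
theorem Rel.finite_of_cross (hper : sigma θ ∉ Function.periodicPts sigma) (h : Rel θ x y)
    (hz : z ∈ fiber θ s) (hw : w ∈ fiber θ s) (hc : Cross x y z w) :
    (fiber θ s).Finite ∧ x ∈ fiber θ s ∧ y ∈ fiber θ s := by
  rcases h with rfl | h | ⟨t, h, hx, hy⟩
  · exact absurd rfl hc.ne.1
  · exact absurd hc (h.not_cross_comp hper ⟨s, hz, hw⟩)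
  · obtain rfl := fiber_eq_of_cross hper hx hy hz hw hc
    exact ⟨h, hx, hy⟩

/-- The direct relation is closed: a limit pair inside an infinite gap that is not a precritical
leaf would be crossed by a diagonal of that gap, and so would be the pairs close to it. -/
theorem isClosed_rel (hper : sigma θ ∉ Function.periodicPts sigma) :
    IsClosed {l : UnitAddCircle × UnitAddCircle | Rel θ l.1 l.2} := by
  refine isClosed_of_closure_subset ?_
  rintro ⟨x, y⟩ hl
  have hcomp : Comp θ x y :=
    closure_minimal (t := {l : UnitAddCircle × UnitAddCircle | Comp θ l.1 l.2})
      (fun l (h : Rel θ l.1 l.2) => h.comp) (isClosed_comp θ) hl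
  by_cases hxy : x = y
  · exact Or.inl hxy
  by_cases hlf : Leaf θ x y
  · exact Or.inr (Or.inl hlf)
  obtain ⟨s, hx, hy⟩ := hcomp
  by_cases hs : (fiber θ s).Finite
  · exact Or.inr (Or.inr ⟨s, hs, hx, hy⟩)
  exfalso
  obtain ⟨z, hz, w, hw, h1, h2⟩ := exists_cross_of_infinite hper hs hx hy hxy hlf
  obtain ⟨⟨x', y'⟩, hc, hR⟩ := mem_closure_iff.1 hl _ (isOpen_cross z w) (Or.inl ⟨h1, h2⟩)
  exact hs (Rel.finite_of_cross hper hR hz hw hc).1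

/-- The graph is the projection of a closed subset of a compact space. -/
theorem isClosed_rel_comp_rel (hper : sigma θ ∉ Function.periodicPts sigma) :
    IsClosed {l : UnitAddCircle × UnitAddCircle | ∃ z, Rel θ l.1 z ∧ Rel θ z l.2} := by
  have h1 : IsClosed {l : (UnitAddCircle × UnitAddCircle) × UnitAddCircle |
      Rel θ l.1.1 l.2 ∧ Rel θ l.2 l.1.2} :=
    ((isClosed_rel hper).preimage
      (f := fun l : (UnitAddCircle × UnitAddCircle) × UnitAddCircle => (l.1.1, l.2))
      (by fun_prop)).inter ((isClosed_rel hper).preimage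
      (f := fun l : (UnitAddCircle × UnitAddCircle) × UnitAddCircle => (l.2, l.1.2)) (by fun_prop))
  have h2 := (h1.isCompact.image continuous_fst).isClosed
  convert h2 using 1
  ext ⟨x, y⟩
  simp

theorem Rel.map (h : Rel θ x y) : Rel θ (sigma x) (sigma y) := by
  rcases h with rfl | ⟨n, h⟩ | ⟨s, h, hx, hy⟩
  · exact Or.inl rfl
  · cases n with
    | zero =>
      left
      rcases h with ⟨rfl, rfl⟩ | ⟨rfl, rfl⟩ <;> simp [sigma_opp]
    | succ n => exact Or.inr (Or.inl ⟨n, h.2⟩)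
  · exact Or.inr (Or.inr ⟨shift s, shift_finite_of_fiber h, (mem_fiber_iff.1 hx).2,
      (mem_fiber_iff.1 hy).2⟩)

theorem Rel.exists_lift (hper : sigma θ ∉ Function.periodicPts sigma)
    (h : Rel θ (sigma x) y) : ∃ z, sigma z = y ∧ Rel θ x z := by
  rcases h with rfl | h | ⟨s, h, hx, hy⟩
  · exact ⟨x, rfl, Or.inl rfl⟩
  · obtain ⟨i, hi⟩ : ∃ i, x ∈ half θ i := by
      rcases mem_half_or θ x true with h | h
      exacts [⟨_, h⟩, ⟨_, h⟩]
    refine ⟨lift θ i y, sigma_lift _ _ _, Or.inr (Or.inl ?_)⟩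
    have := h.lift i
    rwa [lift_sigma hi (h.ne_value hper)] at this
  · obtain ⟨i, hi⟩ : ∃ i, x ∈ half θ i := by
      rcases mem_half_or θ x true with h | h
      exacts [⟨_, h⟩, ⟨_, h⟩]
    refine ⟨lift θ i y, sigma_lift _ _ _, Or.inr (Or.inr ⟨consSeq i s, ?_, ?_, ?_⟩)⟩
    · exact fiber_finite_of_shift (by rwa [shift_consSeq])
    · exact mem_fiber_iff.2 ⟨hi, by rwa [shift_consSeq]⟩
    · exact mem_fiber_iff.2 ⟨lift_mem_half _ _ _, by rwa [shift_consSeq, sigma_lift]⟩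

theorem Cross.split (h : Cross x y z w) (k : UnitAddCircle) (hz : k ≠ z) (hw : k ≠ w) :
    Cross x k z w ∨ Cross k y z w := by
  rcases h.symm with ⟨h1, h2⟩ | ⟨h1, h2⟩ <;>
      rcases btw_cases z k w hz hw h.ne.2.2.2.2.2 with h3 | h3
  · exact Or.inr (Cross.symm (Or.inl ⟨h3, h2⟩))
  · exact Or.inl (Cross.symm (Or.inl ⟨h1, h3⟩))
  · exact Or.inl (Cross.symm (Or.inr ⟨h3, h2⟩))
  · exact Or.inr (Cross.symm (Or.inr ⟨h1, h3⟩))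

/-- Crossing directly related pairs belong to a common finite gap. -/
theorem Rel.of_cross (hper : sigma θ ∉ Function.periodicPts sigma) (h : Rel θ x y)
    (h' : Rel θ z w) (hc : Cross x y z w) : Rel θ x z := by
  obtain ⟨s, hz, hw⟩ := h'.comp
  obtain ⟨h1, h2, h3⟩ := h.finite_of_cross hper hz hw hc
  exact Or.inr (Or.inr ⟨s, h1, h2, hz⟩)

/-! ### Chains of two direct relations -/

/-- Chains of two direct relations that cross belong to one class. -/
theorem rel_of_cross (hper : sigma θ ∉ Function.periodicPts sigma) (hxe : Rel θ x e)
    (hey : Rel θ e y) (hzd : Rel θ z d) (hdw : Rel θ d w) (hc : Cross x y z w) :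
    inducedSetoid (pullbackLamination θ) x z := by
  set R := inducedSetoid (pullbackLamination θ)
  have e1 : R x e := hxe.rel hper
  have e2 : R e y := hey.rel hper
  have e3 : R z d := hzd.rel hper
  have e4 : R d w := hdw.rel hper
  by_cases h1 : e = z
  · exact h1 ▸ e1
  by_cases h2 : e = w
  · subst h2
    exact R.trans e1 (R.symm (R.trans e3 e4))
  have key : ∀ u v, Rel θ u v → R x u → Cross u v z w → R x z := by
    intro u v huv hu hcr
    by_cases h3 : d = u
    · subst h3
      exact R.trans hu (R.symm e3)
    by_cases h4 : d = v
    · subst h4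
      exact R.trans hu (R.trans (huv.rel hper) (R.symm e3))
    rcases hcr.symm.split d h3 h4 with h5 | h5
    · exact R.trans hu ((huv.of_cross hper hzd h5.symm).rel hper)
    · exact R.trans hu (R.trans ((huv.of_cross hper hdw h5.symm).rel hper) (R.symm e3))
  rcases hc.split e h1 h2 with h3 | h3
  · exact key x e hxe (R.refl x) h3
  · exact key e y hey e1 h3

/-- Points separated by two precritical leaves are not related by a chain of two direct
relations. -/
theorem exists_not_rel_comp_rel (hper : sigma θ ∉ Function.periodicPts sigma) :
    ∃ x y, ¬ ∃ z, Rel θ x z ∧ Rel θ z y := by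
  have h0 : Leaf θ θ (opp θ) := ⟨0, Or.inl ⟨rfl, rfl⟩⟩
  have hvtx : vtx θ false = θ := rfl
  -- The diameter and one of its preimages.
  set α := lift θ false θ with hα
  set β := lift θ false (opp θ) with hβ
  have h1 : Leaf θ α β := h0.lift false
  have hαθ : arc θ α = arc (sigma θ) θ / 2 := arc_lift θ false θ
  have hβθ : arc θ β = arc (sigma θ) (opp θ) / 2 := arc_lift θ false (opp θ)
  have n1 : 0 < arc θ α := by
    rw [hαθ]; exact half_pos (arc_pos.2 (h0.ne_value hper))
  have n2 : 0 < arc θ β := by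
    rw [hβθ]; exact half_pos (arc_pos.2 (h0.symm.ne_value hper))
  have n3 : arc θ α < 1 / 2 := by rw [hαθ]; linarith [arc_lt_one (sigma θ) θ]
  have n4 : arc θ β < 1 / 2 := by rw [hβθ]; linarith [arc_lt_one (sigma θ) (opp θ)]
  have n5 : arc θ α ≠ arc θ β := fun h => h1.ne (arc_inj.1 h)
  have k1 := arc_add_coe (a := θ) (t := (arc θ α + arc θ β) / 2) (by linarith) (by linarith)
  have k2 := arc_add_coe (a := θ) (t := 3 / 4) (by norm_num) (by norm_num)
  refine ⟨θ + (((arc θ α + arc θ β) / 2 : ℝ) : UnitAddCircle), θ + ((3 / 4 : ℝ) : UnitAddCircle),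
    ?_⟩
  rintro ⟨z, hxz, hzy⟩
  have hend : ∀ a b, Leaf θ a b →
      Cross (θ + (((arc θ α + arc θ β) / 2 : ℝ) : UnitAddCircle))
        (θ + ((3 / 4 : ℝ) : UnitAddCircle)) a b → z = a ∨ z = b := by
    intro a b hab hc
    by_contra hz
    push Not at hz
    rcases hc.split z hz.1 hz.2 with h | h
    · exact hab.not_cross_comp hper hxz.comp h.symm
    · exact hab.not_cross_comp hper hzy.comp h.symm
  have c1 := hend θ (opp θ) h0 (by
    rw [cross_iff θ, k1, k2, arc_self, arc_opp_self]
    unfold CrossR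
    right; left
    refine ⟨?_, ?_, Or.inl ?_⟩ <;> linarith)
  have c2 := hend α β h1 (by
    rw [cross_iff θ, k1, k2]
    unfold CrossR
    rcases lt_or_gt_of_ne n5 with h | h
    · right; left
      refine ⟨?_, ?_, Or.inl ?_⟩ <;> linarith
    · left
      refine ⟨?_, ?_, Or.inl ?_⟩ <;> linarith)
  have e1 : arc θ z = 0 ∨ arc θ z = 1 / 2 := by
    rcases c1 with rfl | rfl
    · exact Or.inl (arc_self _)
    · exact Or.inr (arc_opp_self _)
  have e2 : arc θ z = arc θ α ∨ arc θ z = arc θ β := by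
    rcases c2 with h | h <;> simp [h]
  rcases e1 with e1 | e1 <;> rcases e2 with e2 | e2 <;> linarith

/-! ### Infinite gaps and connected sets with countable trace -/

/-- An isolated point of an infinite gap has a neighbor: the next point of the gap after it (take
`r = 1`) or before it (take `r = -1`). -/
theorem exists_next (hV : IsClosed (fiber θ s)) {U : Set UnitAddCircle} (hU : IsOpen U)
    (hxU : x ∈ U) (hiso : ∀ y ∈ fiber θ s, y ∈ U → y = x)
    (hs : (fiber θ s).Infinite) (r : ℝ) :
    ∃ y ∈ fiber θ s, y ≠ x ∧ ∀ z ∈ fiber θ s, z ≠ x → r * arc x y ≤ r * arc x z := by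
  have hc : IsCompact (fiber θ s ∩ Uᶜ) := (hV.inter hU.isClosed_compl).isCompact
  have hne : (fiber θ s ∩ Uᶜ).Nonempty := by
    obtain ⟨y, hy, hy'⟩ := (hs.sdiff (Set.finite_singleton x)).nonempty
    exact ⟨y, hy, fun h => hy' (hiso y hy h)⟩
  obtain ⟨y, ⟨hy, hyU⟩, hmin⟩ := hc.exists_isMinOn hne (f := fun y => r * arc x y) (by
    rintro y ⟨hy, hyU⟩
    exact (continuousAt_const.mul
      (continuousAt_arc (fun h : y = x => hyU (by rwa [h])))).continuousWithinAt)
  exact ⟨y, hy, fun h => hyU (h ▸ hxU),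
    fun z hz hzx => hmin ⟨hz, fun h => hzx (hiso z hz h)⟩⟩

/-- Infinite gaps have no isolated points: an isolated point would be the endpoint of two edges,
hence of two precritical leaves. -/
theorem preperfect_fiber (hper : sigma θ ∉ Function.periodicPts sigma)
    (hs : (fiber θ s).Infinite) : Preperfect (fiber θ s) := by
  rw [preperfect_iff_nhds]
  intro x hx U' hU'
  by_contra hc
  push Not at hc
  obtain ⟨U, hUU', hU, hxU⟩ := mem_nhds_iff.1 hU'
  have hiso : ∀ y ∈ fiber θ s, y ∈ U → y = x := fun y hy hyU => hc y ⟨hUU' hyU, hy⟩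
  obtain ⟨q, hq, hqx, hmin⟩ := exists_next (isClosed_fiber θ s) hU hxU hiso hs 1
  obtain ⟨p, hp, hpx, hmax⟩ := exists_next (isClosed_fiber θ s) hU hxU hiso hs (-1)
  have h1 : Leaf θ x q := leaf_of_edge hper hs ⟨hx, hq, hqx.symm, fun z hz hb => by
    have := hmin z hz hb.ne.1.symm
    linarith [hb.2]⟩
  have h2 : Leaf θ p x := leaf_of_edge hper hs ⟨hp, hx, hpx, fun z hz hb => by
    have h3 := hmax z hz hb.ne.2.1
    have hb' := hb
    rw [btw_iff x, arc_self] at hb'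
    have := arc_nonneg x z
    have := arc_nonneg x p
    grind⟩
  have h3 := h1.unique hper h2.symm
  subst h3
  refine hs (((Set.finite_singleton x).union (Set.finite_singleton q)).subset fun z hz => ?_)
  by_cases hzx : z = x
  · exact Or.inl hzx
  · right
    have h4 := hmin z hz hzx
    have h5 := hmax z hz hzx
    exact (arc_inj.1 (by linarith : arc x z = arc x q))

/-- An open arc that meets an infinite gap contains uncountably many points of it. -/
theorem exists_mem_not_mem_countable (hper : sigma θ ∉ Function.periodicPts sigma)
    (hs : (fiber θ s).Infinite) {S : Set UnitAddCircle} (hS : S.Countable)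
    (hz : z ∈ fiber θ s) (hb : Btw x z y) : ∃ u ∈ fiber θ s, Btw x u y ∧ u ∉ S := by
  by_contra hc
  push Not at hc
  have hP := ((preperfect_fiber hper hs).open_inter (isOpen_btw x y)).perfect_closure
  obtain ⟨f, hf, -, hinj⟩ := hP.exists_nat_bool_injection
    (Set.Nonempty.closure (s := {z | Btw x z y} ∩ fiber θ s) ⟨z, hb, hz⟩)
  have hsub : closure ({z | Btw x z y} ∩ fiber θ s) ⊆ S ∪ {x, y} := by
    intro u hu
    have hu1 : u ∈ fiber θ s :=
      closure_minimal Set.inter_subset_right (isClosed_fiber θ s) hu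
    by_cases h1 : u = x
    · exact Or.inr (Or.inl h1)
    by_cases h2 : u = y
    · exact Or.inr (Or.inr h2)
    rcases btw_cases x u y h1 h2 hb.ne.2.2 with h3 | h3
    · exact Or.inl (hc u hu1 h3)
    · obtain ⟨v, hv, hv', -⟩ := mem_closure_iff.1 hu _ (isOpen_btw y x) h3
      exact absurd hv hv'.not_symm
  have hcount : (Set.range f).Countable :=
    (hS.union ((Set.finite_singleton y).insert x).countable).mono (hf.trans hsub)
  have : Countable (ℕ → Bool) := Set.countable_univ_iff.1
    (Set.countable_of_injective_of_countable_image hinj.injOn (by rwa [Set.image_univ]))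
  obtain ⟨g, hg⟩ := exists_injective_nat (ℕ → Bool)
  classical
  refine Function.cantor_injective (fun A : Set ℕ => g fun n => decide (n ∈ A)) fun A B h => ?_
  ext n
  simpa using congrFun (hg h) n

/-- A connected subset of the support of the lamination with countable trace on the circle cannot
join points that are separated by a chord of an infinite gap: it would contain one of the endpoints
of each of the uncountably many separating chords. -/
theorem finite_of_cross (hper : sigma θ ∉ Function.periodicPts sigma) {K : Set ℂ}
    (hK : IsOmegaContinuum (pullbackLamination θ) K) (hx : pt x ∈ K) (hy : pt y ∈ K)
    (hz : z ∈ fiber θ s) (hw : w ∈ fiber θ s) (h : Cross x y z w) : (fiber θ s).Finite := by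
  by_contra hs
  have hs : (fiber θ s).Infinite := hs
  wlog h1 : Btw x z y ∧ Btw y w x generalizing z w
  · exact this hw hz h.swap_right (h.resolve_left h1)
  have hS : (pt ⁻¹' (K ∩ Metric.sphere 0 1)).Countable :=
    hK.countable.preimage pt_injective
  obtain ⟨u, hu, hu1, hu2⟩ := exists_mem_not_mem_countable hper hs hS hz h1.1
  obtain ⟨v, hv, hv1, hv2⟩ := exists_mem_not_mem_countable hper hs hS hw h1.2
  obtain ⟨c, hc, hc'⟩ := (hs.sdiff ((Set.finite_singleton u).insert v)).nonempty
  simp only [Set.mem_insert_iff, Set.mem_singleton_iff, not_or] at hc'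
  rcases mem_of_cross_gap hper hK.isConnected.isPreconnected hK.subset_support hu hv hc hc'.2 hc'.1
    hx hy (Or.inl ⟨hu1, hv1⟩) with h2 | h2
  · exact hu2 ⟨h2, pt_mem_sphere u⟩
  · exact hv2 ⟨h2, pt_mem_sphere v⟩

/-! ### Nested strips -/

/-- A densely ordered family of nested pairs of reals has too many strips for a countable closed
set to meet all of them: some nested sequence of strips avoids each point of the set. -/
theorem false_of_strips {Q : Set (ℝ × ℝ)} {C : Set ℝ} (hC : IsClosed C) (hC' : C.Countable)
    (hne : ∃ l ∈ Q, ∃ m ∈ Q, l.1 < m.1)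
    (hchain : ∀ l ∈ Q, ∀ m ∈ Q, l.1 < m.1 → m.2 < l.2)
    (hdisj : ∀ l ∈ Q, ∀ m ∈ Q, l.1 < m.2)
    (hdense : ∀ l ∈ Q, ∀ m ∈ Q, l.1 < m.1 → ∃ k ∈ Q, l.1 < k.1 ∧ k.1 < m.1)
    (hmeet : ∀ l ∈ Q, ∀ m ∈ Q, l.1 < m.1 →
      (C ∩ (Set.Icc l.1 m.1 ∪ Set.Icc m.2 l.2)).Nonempty) : False := by
  set T := {k : (ℝ × ℝ) × (ℝ × ℝ) // k.1 ∈ Q ∧ k.2 ∈ Q ∧ k.1.1 < k.2.1} with hT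
  set strip : T → Set ℝ := fun k => Set.Icc k.1.1.1 k.1.2.1 ∪ Set.Icc k.1.2.2 k.1.1.2 with hstrip
  have hstep : ∀ (r : ℝ) (k : T), ∃ k' : T, strip k' ⊆ strip k ∧ r ∉ strip k' := by
    rintro r ⟨⟨l, m⟩, hl, hm, hlm⟩
    obtain ⟨u, hu, h1, h2⟩ := hdense l hl m hm hlm
    obtain ⟨v, hv, h3, h4⟩ := hdense u hu m hm h2
    have g1 := hchain _ hl _ hu h1
    have g2 := hchain _ hu _ hv h3
    have g3 := hchain _ hv _ hm h4
    have g4 := hdisj _ hm _ hm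
    by_cases hr : r ∈ Set.Icc l.1 u.1 ∪ Set.Icc u.2 l.2
    · refine ⟨⟨(v, m), hv, hm, h4⟩, ?_, ?_⟩
      · exact Set.union_subset_union (Set.Icc_subset_Icc (by linarith) le_rfl)
          (Set.Icc_subset_Icc le_rfl (by linarith))
      · simp only [hstrip, Set.mem_union, Set.mem_Icc] at hr ⊢
        rintro (⟨i1, i2⟩ | ⟨i1, i2⟩) <;> rcases hr with ⟨j1, j2⟩ | ⟨j1, j2⟩ <;> linarith
    · refine ⟨⟨(l, u), hl, hu, h1⟩, ?_, hr⟩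
      exact Set.union_subset_union (Set.Icc_subset_Icc le_rfl (by linarith))
        (Set.Icc_subset_Icc (by linarith) le_rfl)
  choose next hsub hnot using hstep
  obtain ⟨l, hl, m, hm, hlm⟩ := hne
  obtain ⟨f, hf⟩ := hC'.exists_eq_range (let ⟨r, h, _⟩ := hmeet l hl m hm hlm; ⟨r, h⟩)
  set g : ℕ → T := fun n => Nat.rec ⟨(l, m), hl, hm, hlm⟩ (fun n k => next (f n) k) n with hg
  have hgs : ∀ n, g (n + 1) = next (f n) (g n) := fun n => rfl
  have hcl : ∀ k, IsClosed (strip k) := fun k => isClosed_Icc.union isClosed_Icc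
  obtain ⟨r, hr⟩ := IsCompact.nonempty_iInter_of_sequence_nonempty_isCompact_isClosed
    (fun n => C ∩ strip (g n))
    (fun n => Set.inter_subset_inter_right _ (by rw [hgs]; exact hsub _ _))
    (fun n => hmeet _ (g n).2.1 _ (g n).2.2.1 (g n).2.2.2)
    ((isCompact_Icc.union isCompact_Icc).inter_left hC)
    (fun n => hC.inter (hcl _))
  rw [Set.mem_iInter] at hr
  obtain ⟨n, hn⟩ : r ∈ Set.range f := hf ▸ (hr 0).1
  have := (hr (n + 1)).2
  rw [hgs, ← hn] at this
  exact hnot _ _ this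

/-! ### Precritical leaves that separate two points -/

/-- The precritical leaves that separate `x` and `y`, in coordinates based at `x`: the first
endpoint lies on the arc from `x` to `y`, the second one on the arc from `y` to `x`. -/
def separators (θ x y : UnitAddCircle) : Set (ℝ × ℝ) :=
  {l | Leaf θ (x + (l.1 : UnitAddCircle)) (x + (l.2 : UnitAddCircle)) ∧
    0 < l.1 ∧ l.1 < arc x y ∧ arc x y < l.2 ∧ l.2 < 1}

theorem Leaf.mem_separators (h : Leaf θ a b) (h1 : 0 < arc x a) (h2 : arc x a < arc x y)
    (h3 : arc x y < arc x b) : (arc x a, arc x b) ∈ separators θ x y :=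
  ⟨by simpa only [add_coe_arc] using h, h1, h2, h3, arc_lt_one _ _⟩

theorem arc_separators {l : ℝ × ℝ} (hl : l ∈ separators θ x y) :
    arc x (x + (l.1 : UnitAddCircle)) = l.1 ∧ arc x (x + (l.2 : UnitAddCircle)) = l.2 := by
  obtain ⟨-, h1, h2, h3, h4⟩ := hl
  exact ⟨arc_add_coe h1.le (by linarith), arc_add_coe (by linarith) h4⟩

theorem cross_separators {l : ℝ × ℝ} (hl : l ∈ separators θ x y) :
    Cross x y (x + (l.1 : UnitAddCircle)) (x + (l.2 : UnitAddCircle)) := by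
  obtain ⟨h1, h2⟩ := arc_separators hl
  rw [cross_iff x, h1, h2, arc_self]
  exact Or.inl ⟨hl.2.1, hl.2.2.1, Or.inr hl.2.2.2.1⟩

/-- A precritical leaf is equal to a given separator, or disjoint from it. -/
theorem Leaf.separators_cases (hper : sigma θ ∉ Function.periodicPts sigma) {l : ℝ × ℝ}
    (hl : l ∈ separators θ x y) (h : Leaf θ a b) :
    ¬ CrossR l.1 l.2 (arc x a) (arc x b) ∧ (arc x a = l.1 ↔ arc x b = l.2) ∧
      (arc x a = l.2 ↔ arc x b = l.1) := by
  obtain ⟨h1, h2⟩ := arc_separators hl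
  have h3 := hl.1.not_cross hper h
  rw [cross_iff x, h1, h2] at h3
  refine ⟨h3, ⟨fun h4 => ?_, fun h4 => ?_⟩, ⟨fun h4 => ?_, fun h4 => ?_⟩⟩
  · rw [← h1, arc_inj] at h4
    subst h4
    rw [h.unique hper hl.1, h2]
  · rw [← h2, arc_inj] at h4
    subst h4
    rw [h.symm.unique hper hl.1.symm, h1]
  · rw [← h2, arc_inj] at h4
    subst h4
    rw [h.unique hper hl.1.symm, h1]
  · rw [← h1, arc_inj] at h4
    subst h4
    rw [h.symm.unique hper hl.1, h2]

/-- The separators are linearly ordered: their endpoints move in opposite directions. -/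
theorem separators_nested (hper : sigma θ ∉ Function.periodicPts sigma) {l m : ℝ × ℝ}
    (hl : l ∈ separators θ x y) (hm : m ∈ separators θ x y) :
    (l.1 < m.1 → m.2 < l.2) ∧ (l.1 = m.1 → l.2 = m.2) := by
  obtain ⟨h1, h2⟩ := arc_separators hm
  have h3 := hm.1.separators_cases hper hl
  rw [h1, h2] at h3
  obtain ⟨-, h4, h5, h6, h7⟩ := hl
  obtain ⟨-, h8, h9, h10, h11⟩ := hm
  unfold CrossR at h3
  grind

/-- The order-theoretic content of `exists_fiber_of_gap`: if a pair `F, E` crosses neither `A, B`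
nor `A', B'` and does not pass between them, then it crosses no side or diagonal of the
quadrilateral `A, A', B', B`. -/
theorem not_crossR_of_gap {A B A' B' Y u v F E : ℝ} (h1 : A ≤ A') (h2 : A' < Y) (h3 : Y < B')
    (h4 : B' ≤ B) (h0 : 0 < A) (hAB : ¬ CrossR A B F E) (hAB' : ¬ CrossR A' B' F E)
    (hF : 0 < F → F < Y → Y < E → (F ≤ A ∧ B ≤ E) ∨ (A' ≤ F ∧ E ≤ B'))
    (hE : 0 < E → E < Y → Y < F → (E ≤ A ∧ B ≤ F) ∨ (A' ≤ E ∧ F ≤ B'))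
    (hu : u = A ∨ u = B ∨ u = A' ∨ u = B') (hv : v = A ∨ v = B ∨ v = A' ∨ v = B') :
    ¬ CrossR u v F E := by
  unfold CrossR at *
  rcases hu with rfl | rfl | rfl | rfl <;> rcases hv with rfl | rfl | rfl | rfl <;>
    grind (splits := 40)

/-- Two limit leaves without separators between them belong to a common gap. -/
theorem exists_fiber_of_gap (hper : sigma θ ∉ Function.periodicPts sigma) {l m : ℝ × ℝ}
    (hl : (x + (l.1 : UnitAddCircle), x + (l.2 : UnitAddCircle)) ∈ pullbackLamination θ)
    (hm : (x + (m.1 : UnitAddCircle), x + (m.2 : UnitAddCircle)) ∈ pullbackLamination θ)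
    (h0 : 0 < l.1) (h1 : l.1 ≤ m.1) (h2 : m.1 < arc x y) (h3 : arc x y < m.2) (h4 : m.2 ≤ l.2)
    (h5 : l.2 < 1)
    (hgap : ∀ k ∈ separators θ x y, (k.1 ≤ l.1 ∧ l.2 ≤ k.2) ∨ (m.1 ≤ k.1 ∧ k.2 ≤ m.2)) :
    ∃ s, x + (l.1 : UnitAddCircle) ∈ fiber θ s ∧ x + (l.2 : UnitAddCircle) ∈ fiber θ s ∧
      x + (m.1 : UnitAddCircle) ∈ fiber θ s ∧ x + (m.2 : UnitAddCircle) ∈ fiber θ s := by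
  have key : ∀ u v : ℝ, (u = l.1 ∨ u = l.2 ∨ u = m.1 ∨ u = m.2) →
      (v = l.1 ∨ v = l.2 ∨ v = m.1 ∨ v = m.2) →
      Comp θ (x + (u : UnitAddCircle)) (x + (v : UnitAddCircle)) := by
    intro u v hu hv
    refine comp_of_not_cross hper fun a b hab => ?_
    have e1 := not_cross_of_mem_lamination hper hl hab.comp
    have e2 := not_cross_of_mem_lamination hper hm hab.comp
    have hu' : 0 ≤ u ∧ u < 1 := by
      rcases hu with h | h | h | h <;> constructor <;> linarith
    have hv' : 0 ≤ v ∧ v < 1 := by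
      rcases hv with h | h | h | h <;> constructor <;> linarith
    rw [cross_iff x, arc_add_coe (by linarith) (by linarith),
      arc_add_coe (by linarith) (by linarith)] at e1 e2
    rw [cross_iff x, arc_add_coe hu'.1 hu'.2, arc_add_coe hv'.1 hv'.2]
    exact not_crossR_of_gap h1 h2 h3 h4 h0 e1 e2
      (fun g1 g2 g3 => hgap _ (hab.mem_separators g1 g2 g3))
      (fun g1 g2 g3 => hgap _ (hab.symm.mem_separators g1 g2 g3)) hu hv
  obtain ⟨s, hs⟩ := exists_fiber_of_pairwise (θ := θ)
    (A := (fun r : ℝ => x + (r : UnitAddCircle)) '' {l.1, l.2, m.1, m.2}) (by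
      rintro _ ⟨u, hu, rfl⟩ _ ⟨v, hv, rfl⟩
      exact key u v hu hv)
  exact ⟨s, hs ⟨l.1, by simp, rfl⟩, hs ⟨l.2, by simp, rfl⟩, hs ⟨m.1, by simp, rfl⟩,
    hs ⟨m.2, by simp, rfl⟩⟩

/-- Between two separators there is a precritical leaf with both endpoints on the same side:
otherwise the leaves between them would form a strip. -/
theorem exists_leaf_side (hper : sigma θ ∉ Function.periodicPts sigma)
    (hvert : θ ≠ ((1 / 4 : ℝ) : UnitAddCircle) ∧ θ ≠ ((3 / 4 : ℝ) : UnitAddCircle))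
    {l m : ℝ × ℝ} (hl : l ∈ separators θ x y) (hm : m ∈ separators θ x y) (hlm : l.1 < m.1) :
    ∃ a b, Leaf θ a b ∧ arc x a < arc x b ∧ ((l.1 < arc x a ∧ arc x b < m.1) ∨
      (m.2 < arc x a ∧ arc x b < l.2)) := by
  by_contra hc
  push Not at hc
  have hno : ∀ a b, Leaf θ a b → ¬ (l.1 < arc x a ∧ arc x a < m.1 ∧ l.1 < arc x b ∧ arc x b < m.1)
      ∧ ¬ (m.2 < arc x a ∧ arc x a < l.2 ∧ m.2 < arc x b ∧ arc x b < l.2) := by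
    intro a b hab
    have h1 : arc x a ≠ arc x b := fun h => hab.ne (arc_inj.1 h)
    rcases lt_or_gt_of_ne h1 with h1 | h1
    · have := hc a b hab h1
      constructor <;> rintro ⟨i1, i2, i3, i4⟩
      · linarith [this.1 i1]
      · linarith [this.2 i1]
    · have := hc b a hab.symm h1
      constructor <;> rintro ⟨i1, i2, i3, i4⟩
      · linarith [this.1 i3]
      · linarith [this.2 i3]
  have hml := (separators_nested hper hl hm).1 hlm
  obtain ⟨el1, el2⟩ := arc_separators hl
  obtain ⟨-, l1, l2, l3, l4⟩ := id hl
  obtain ⟨-, m1, m2, m3, m4⟩ := id hm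
  have hA : ∀ p, 0 < arc (x + (l.1 : UnitAddCircle)) p ∧
      arc (x + (l.1 : UnitAddCircle)) p < m.1 - l.1 ↔ l.1 < arc x p ∧ arc x p < m.1 := by
    intro p
    have h1 := arc_cases x (x + (l.1 : UnitAddCircle)) p
    rw [el1] at h1
    have h2 := arc_nonneg x p
    rcases h1 with ⟨h1, h3⟩ | ⟨h1, h3⟩ <;> rw [h3] <;> constructor <;> rintro ⟨h4, h5⟩ <;>
      constructor <;> linarith
  have hB : ∀ p, 0 < arc p (x + (l.2 : UnitAddCircle)) ∧
      arc p (x + (l.2 : UnitAddCircle)) < l.2 - m.2 ↔ m.2 < arc x p ∧ arc x p < l.2 := by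
    intro p
    have h1 := arc_cases x p (x + (l.2 : UnitAddCircle))
    rw [el2] at h1
    have h2 := arc_lt_one x p
    rcases h1 with ⟨h1, h3⟩ | ⟨h1, h3⟩ <;> rw [h3] <;> constructor <;> rintro ⟨h4, h5⟩ <;>
      constructor <;> linarith
  refine not_strip hper hvert (θ := θ) (a := x + (l.1 : UnitAddCircle)) (u := m.1 - l.1)
    (b := x + (l.2 : UnitAddCircle)) (w := l.2 - m.2)
    ⟨by linarith, by linarith, by linarith, by linarith, ?_, ?_, ?_⟩
  · intro p h1 h2 h3 h4
    have h5 := (hA p).1 ⟨h1, h2⟩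
    have h6 := (hB p).1 ⟨h3, h4⟩
    linarith [h5.2, h6.1]
  · intro p q hpq h1 h2
    rw [hB]
    have h3 := (hA p).1 ⟨h1, h2⟩
    have h4 := hpq.separators_cases hper hl
    have h5 := hpq.separators_cases hper hm
    have h6 := hno p q hpq
    unfold CrossR at h4 h5
    grind
  · intro p q hpq h1 h2
    rw [hA]
    have h3 := (hB p).1 ⟨h1, h2⟩
    have h4 := hpq.separators_cases hper hl
    have h5 := hpq.separators_cases hper hm
    have h6 := hno p q hpq
    unfold CrossR at h4 h5
    grind

/-! ### Continua with countable trace meet every strip between separators -/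

theorem longer_of_not_crossR {A B F E : ℝ} (h : ¬ CrossR A B F E) (h1 : F < B) (h2 : A < E)
    (h3 : B - A ≤ E - F) : F ≤ A ∧ B ≤ E := by
  unfold CrossR at h
  grind

/-- If the separators fall into two parts, with a jump in length in between, then a connected subset
of the support that joins `x` and `y` contains a point of the circle in each strip around the jump,
namely an endpoint of the last limit leaf before the jump: this leaf lies in a common gap with the
first limit leaf after the jump. -/
theorem exists_mem_of_jump (hper : sigma θ ∉ Function.periodicPts sigma) {K : Set ℂ}
    (hK : IsOmegaContinuum (pullbackLamination θ) K) (hx : pt x ∈ K) (hy : pt y ∈ K)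
    {l m : ℝ × ℝ} {U V : Set (ℝ × ℝ)} (hU : U ⊆ separators θ x y) (hV : V ⊆ separators θ x y)
    (hUV : separators θ x y ⊆ U ∪ V) (hl : l ∈ U) (hm : m ∈ V)
    (hlt : ∀ k ∈ U, ∀ j ∈ V, k.1 < j.1) {δ : ℝ} (hδ : 0 < δ)
    (hjump : ∀ k ∈ U, ∀ j ∈ V, δ ≤ (k.2 - k.1) - (j.2 - j.1)) :
    ∃ r ∈ Set.Icc l.1 m.1 ∪ Set.Icc m.2 l.2, pt (x + (r : UnitAddCircle)) ∈ K := by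
  have hlQ := hU hl
  have hmQ := hV hm
  obtain ⟨-, l1, l2, l3, l4⟩ := id hlQ
  obtain ⟨-, m1, m2, m3, m4⟩ := id hmQ
  have hgt : ∀ k ∈ U, ∀ j ∈ V, j.2 < k.2 := fun k hk j hj =>
    (separators_nested hper (hU hk) (hV hj)).1 (hlt k hk j hj)
  have hmono : ∀ k ∈ separators θ x y, ∀ j ∈ separators θ x y, k.1 ≤ j.1 → j.2 ≤ k.2 := by
    intro k hk j hj h
    rcases h.lt_or_eq with h | h
    · exact ((separators_nested hper hk hj).1 h).le
    · exact ((separators_nested hper hk hj).2 h).ge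
  -- The two parts, restricted to the strip.
  set U' : Set (ℝ × ℝ) := {k | k ∈ U ∧ l.1 ≤ k.1} with hU'
  set V' : Set (ℝ × ℝ) := {k | k ∈ V ∧ k.1 ≤ m.1} with hV'
  have hbox : ∀ k ∈ U' ∪ V', k ∈ Set.Icc l.1 m.1 ×ˢ Set.Icc m.2 l.2 := by
    rintro k (⟨h1, h2⟩ | ⟨h1, h2⟩)
    · exact ⟨⟨h2, (hlt k h1 m hm).le⟩, ⟨(hgt k h1 m hm).le, hmono _ hlQ _ (hU h1) h2⟩⟩
    · exact ⟨⟨(hlt l hl k h1).le, h2⟩, ⟨hmono _ (hV h1) _ hmQ h2, (hgt l hl k h1).le⟩⟩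
  have hsub : Set.Icc l.1 m.1 ×ˢ Set.Icc m.2 l.2 ⊆ Set.Icc (0 : ℝ) 1 ×ˢ Set.Icc (0 : ℝ) 1 :=
    Set.prod_mono (Set.Icc_subset_Icc (by linarith) (by linarith))
      (Set.Icc_subset_Icc (by linarith) (by linarith))
  obtain ⟨α, hα, hαmin⟩ := exists_extremal (Q := U') ⟨l, hl, le_rfl⟩
    (fun k hk => hsub (hbox k (Or.inl hk))) (-1)
  obtain ⟨β, hβ, hβmax⟩ := exists_extremal (Q := V') ⟨m, hm, le_rfl⟩
    (fun k hk => hsub (hbox k (Or.inr hk))) 1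
  have hαL := mem_lamination_of_closure hper (p := x) (fun k hk => (hU hk.1).1) hα
  have hβL := mem_lamination_of_closure hper (p := x) (fun k hk => (hV hk.1).1) hβ
  obtain ⟨⟨a1, a2⟩, ⟨a3, a4⟩⟩ := closure_minimal (fun k hk => hbox k (Or.inl hk))
    (isClosed_Icc.prod isClosed_Icc) hα
  obtain ⟨⟨b1, b2⟩, ⟨b3, b4⟩⟩ := closure_minimal (fun k hk => hbox k (Or.inr hk))
    (isClosed_Icc.prod isClosed_Icc) hβ
  have hαβ : α.1 ≤ β.1 ∧ β.2 ≤ α.2 ∧ δ ≤ (α.2 - α.1) - (β.2 - β.1) := by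
    have h1 : (α, β) ∈ closure (U' ×ˢ V') := by
      rw [closure_prod_eq]
      exact ⟨hα, hβ⟩
    exact closure_minimal (t := {k : (ℝ × ℝ) × (ℝ × ℝ) | k.1.1 ≤ k.2.1 ∧ k.2.2 ≤ k.1.2 ∧
        δ ≤ (k.1.2 - k.1.1) - (k.2.2 - k.2.1)})
      (fun k hk => ⟨(hlt _ hk.1.1 _ hk.2.1).le, (hgt _ hk.1.1 _ hk.2.1).le,
        hjump _ hk.1.1 _ hk.2.1⟩)
      (IsClosed.inter (s₁ := {k : (ℝ × ℝ) × (ℝ × ℝ) | k.1.1 ≤ k.2.1})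
        (s₂ := {k : (ℝ × ℝ) × (ℝ × ℝ) | k.2.2 ≤ k.1.2 ∧ δ ≤ (k.1.2 - k.1.1) - (k.2.2 - k.2.1)})
        (isClosed_le (by fun_prop) (by fun_prop))
        (IsClosed.inter (s₁ := {k : (ℝ × ℝ) × (ℝ × ℝ) | k.2.2 ≤ k.1.2})
          (s₂ := {k : (ℝ × ℝ) × (ℝ × ℝ) | δ ≤ (k.1.2 - k.1.1) - (k.2.2 - k.2.1)})
          (isClosed_le (by fun_prop) (by fun_prop)) (isClosed_le (by fun_prop) (by fun_prop)))) h1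
  obtain ⟨c1, c2, c3⟩ := hαβ
  have hαU : ∀ k ∈ U, k.1 ≤ α.1 ∧ α.2 ≤ k.2 := by
    intro k hk
    by_cases h1 : l.1 ≤ k.1
    · have h2 := hαmin k ⟨hk, h1⟩
      have h3 := not_cross_of_mem_lamination hper hαL (hU hk).1.comp
      obtain ⟨e1, e2⟩ := arc_separators (hU hk)
      rw [cross_iff x, arc_add_coe (by linarith) (by linarith),
        arc_add_coe (by linarith) (by linarith), e1, e2] at h3
      obtain ⟨-, g1, g2, g3, g4⟩ := hU hk
      exact longer_of_not_crossR h3 (by linarith) (by linarith) (by linarith)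
    · have h2 := hmono _ (hU hk) _ hlQ (by linarith)
      exact ⟨by linarith, by linarith⟩
  have hβV : ∀ k ∈ V, β.1 ≤ k.1 ∧ k.2 ≤ β.2 := by
    intro k hk
    by_cases h1 : k.1 ≤ m.1
    · have h2 := hβmax k ⟨hk, h1⟩
      have h3 := not_cross_of_mem_lamination hper hβL (hV hk).1.comp
      obtain ⟨e1, e2⟩ := arc_separators (hV hk)
      rw [cross_iff x, arc_add_coe (by linarith) (by linarith),
        arc_add_coe (by linarith) (by linarith), e1, e2] at h3
      obtain ⟨-, g1, g2, g3, g4⟩ := hV hk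
      exact longer_of_not_crossR (fun h => h3 (by unfold CrossR at *; grind)) (by linarith)
        (by linarith) (by linarith)
    · have h2 := hmono _ hmQ _ (hV hk) (by linarith)
      exact ⟨by linarith, by linarith⟩
  obtain ⟨s, s1, s2, s3, s4⟩ := exists_fiber_of_gap hper hαL hβL (by linarith) c1
    (by linarith) (by linarith) c2 (by linarith)
    (fun k hk => (hUV hk).imp (hαU k) (hβV k))
  have hne : ∀ u v : ℝ, 0 ≤ u → u < 1 → 0 ≤ v → v < 1 → u ≠ v →
      x + (u : UnitAddCircle) ≠ x + (v : UnitAddCircle) := by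
    intro u v h1 h2 h3 h4 h5 h6
    rw [← arc_inj (c := x), arc_add_coe h1 h2, arc_add_coe h3 h4] at h6
    exact h5 h6
  obtain ⟨r, hr, hr1, hr2⟩ : ∃ r ∈ fiber θ s, r ≠ x + (α.1 : UnitAddCircle) ∧
      r ≠ x + (α.2 : UnitAddCircle) := by
    by_cases h1 : α.1 < β.1
    · exact ⟨_, s3, hne _ _ (by linarith) (by linarith) (by linarith) (by linarith) (by linarith),
        hne _ _ (by linarith) (by linarith) (by linarith) (by linarith) (by linarith)⟩
    · exact ⟨_, s4, hne _ _ (by linarith) (by linarith) (by linarith) (by linarith) (by linarith),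
        hne _ _ (by linarith) (by linarith) (by linarith) (by linarith) (by linarith)⟩
  have hcross : Cross x y (x + (α.1 : UnitAddCircle)) (x + (α.2 : UnitAddCircle)) := by
    rw [cross_iff x, arc_self, arc_add_coe (by linarith) (by linarith),
      arc_add_coe (by linarith) (by linarith)]
    exact Or.inl ⟨by linarith, by linarith, Or.inr (by linarith)⟩
  rcases mem_of_cross_gap hper hK.isConnected.isPreconnected hK.subset_support s1 s2 hr hr1 hr2
    hx hy hcross with h | h
  · exact ⟨α.1, Or.inl ⟨a1, a2⟩, h⟩
  · exact ⟨α.2, Or.inr ⟨a3, a4⟩, h⟩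

/-- A continuum with countable trace that joins `x` and `y` contains a point of the circle in each
strip between separators. -/
theorem exists_mem_strip (hper : sigma θ ∉ Function.periodicPts sigma)
    (hvert : θ ≠ ((1 / 4 : ℝ) : UnitAddCircle) ∧ θ ≠ ((3 / 4 : ℝ) : UnitAddCircle)) {K : Set ℂ}
    (hK : IsOmegaContinuum (pullbackLamination θ) K) (hx : pt x ∈ K) (hy : pt y ∈ K)
    {l m : ℝ × ℝ} (hl : l ∈ separators θ x y) (hm : m ∈ separators θ x y) (hlm : l.1 < m.1) :
    ∃ r ∈ Set.Icc l.1 m.1 ∪ Set.Icc m.2 l.2, pt (x + (r : UnitAddCircle)) ∈ K := by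
  obtain ⟨a, b, hab, hlt, h | h⟩ := exists_leaf_side hper hvert hl hm hlm
  · -- The leaf divides the separators according to their first endpoints.
    have hdiv : ∀ k ∈ separators θ x y, k.1 < arc x a ∨ arc x b < k.1 := by
      intro k hk
      have h1 := hab.separators_cases hper hk
      obtain ⟨-, k1, k2, k3, k4⟩ := hk
      obtain ⟨-, m1, m2, m3, m4⟩ := hm
      unfold CrossR at h1
      grind
    refine exists_mem_of_jump hper hK hx hy (U := {k | k ∈ separators θ x y ∧ k.1 < arc x a})
      (V := {k | k ∈ separators θ x y ∧ arc x b < k.1}) (fun k hk => hk.1) (fun k hk => hk.1)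
      (fun k hk => (hdiv k hk).imp (fun h => ⟨hk, h⟩) (fun h => ⟨hk, h⟩)) ⟨hl, h.1⟩ ⟨hm, h.2⟩
      (fun k hk j hj => by linarith [hk.2, hj.2]) (sub_pos.2 hlt) ?_
    rintro k ⟨hk, hk'⟩ j ⟨hj, hj'⟩
    linarith [(separators_nested hper hk hj).1 (by linarith)]
  · -- The leaf divides the separators according to their second endpoints.
    have hdiv : ∀ k ∈ separators θ x y, arc x b < k.2 ∨ k.2 < arc x a := by
      intro k hk
      have h1 := hab.separators_cases hper hk
      obtain ⟨-, k1, k2, k3, k4⟩ := hk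
      obtain ⟨-, m1, m2, m3, m4⟩ := hm
      unfold CrossR at h1
      grind
    have hlt' : ∀ k ∈ separators θ x y, ∀ j ∈ separators θ x y, j.2 < k.2 → k.1 < j.1 := by
      intro k hk j hj h1
      by_contra h2
      rcases (not_lt.1 h2).lt_or_eq with h3 | h3
      · linarith [(separators_nested hper hj hk).1 h3]
      · linarith [(separators_nested hper hj hk).2 h3]
    refine exists_mem_of_jump hper hK hx hy (U := {k | k ∈ separators θ x y ∧ arc x b < k.2})
      (V := {k | k ∈ separators θ x y ∧ k.2 < arc x a}) (fun k hk => hk.1) (fun k hk => hk.1)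
      (fun k hk => (hdiv k hk).imp (fun h => ⟨hk, h⟩) (fun h => ⟨hk, h⟩)) ⟨hl, h.2⟩ ⟨hm, h.1⟩
      (fun k hk j hj => hlt' k hk.1 j hj.1 (by linarith [hk.2, hj.2])) (sub_pos.2 hlt) ?_
    rintro k ⟨hk, hk'⟩ j ⟨hj, hj'⟩
    linarith [hlt' k hk j hj (by linarith)]

/-- The separators of two points of a continuum with countable trace are not densely ordered, since
the trace of the continuum cannot meet all of their strips. -/
theorem exists_adjacent (hper : sigma θ ∉ Function.periodicPts sigma)
    (hvert : θ ≠ ((1 / 4 : ℝ) : UnitAddCircle) ∧ θ ≠ ((3 / 4 : ℝ) : UnitAddCircle)) {K : Set ℂ}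
    (hK : IsOmegaContinuum (pullbackLamination θ) K) (hx : pt x ∈ K) (hy : pt y ∈ K)
    (hne : ∃ l ∈ separators θ x y, ∃ m ∈ separators θ x y, l.1 < m.1) :
    ∃ l ∈ separators θ x y, ∃ m ∈ separators θ x y, l.1 < m.1 ∧
      ∀ k ∈ separators θ x y, ¬ (l.1 < k.1 ∧ k.1 < m.1) := by
  by_contra hc
  push Not at hc
  set f : ℝ → ℂ := fun r => pt (x + (r : UnitAddCircle)) with hf
  have hfc : Continuous f :=
    continuous_pt.comp (continuous_const.add (AddCircle.continuous_mk' (1 : ℝ)))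
  refine false_of_strips (Q := separators θ x y) (C := Set.Ioo 0 1 ∩ f ⁻¹' K ∪ {0, 1}) ?_ ?_ hne
    (fun l hl m hm => (separators_nested hper hl hm).1)
    (fun l hl m hm => hl.2.2.1.trans hm.2.2.2.1) hc ?_
  · have : Set.Ioo 0 1 ∩ f ⁻¹' K ∪ {0, 1} = (Set.Icc 0 1 ∩ f ⁻¹' K) ∪ {0, 1} := by
      ext r
      simp only [Set.mem_union, Set.mem_inter_iff, Set.mem_Ioo, Set.mem_Icc, Set.mem_insert_iff,
        Set.mem_singleton_iff]
      grind
    rw [this]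
    exact (isClosed_Icc.inter (hK.isCompact.isClosed.preimage hfc)).union
      ((Set.finite_singleton _).insert _).isClosed
  · refine Set.Countable.union ?_ ((Set.finite_singleton _).insert _).countable
    refine Set.countable_of_injective_of_countable_image (f := f) ?_
      (hK.countable.mono ?_)
    · intro u hu v hv huv
      have h1 := pt_injective huv
      rw [← arc_inj (c := x), arc_add_coe hu.1.1.le hu.1.2, arc_add_coe hv.1.1.le hv.1.2] at h1
      exact h1
    · rintro _ ⟨u, hu, rfl⟩
      exact ⟨hu.2, pt_mem_sphere _⟩
  · intro l hl m hm hlm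
    obtain ⟨r, hr, hrK⟩ := exists_mem_strip hper hvert hK hx hy hl hm hlm
    refine ⟨r, Or.inl ⟨?_, hrK⟩, hr⟩
    obtain ⟨-, l1, l2, l3, l4⟩ := hl
    obtain ⟨-, m1, m2, m3, m4⟩ := hm
    rcases hr with ⟨h1, h2⟩ | ⟨h1, h2⟩ <;> constructor <;> linarith

/-- Points in a continuum with countable trace are related by a chain of two direct relations. -/
theorem exists_rel_rel (hper : sigma θ ∉ Function.periodicPts sigma)
    (hvert : θ ≠ ((1 / 4 : ℝ) : UnitAddCircle) ∧ θ ≠ ((3 / 4 : ℝ) : UnitAddCircle))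
    (h : inducedSetoid (pullbackLamination θ) x y) : ∃ z, Rel θ x z ∧ Rel θ z y := by
  obtain ⟨K, hK, hx, hy⟩ := h
  by_cases hxy : x = y
  · exact ⟨x, Or.inl rfl, Or.inl hxy⟩
  by_cases hQ : ∃ l ∈ separators θ x y, ∃ m ∈ separators θ x y, l.1 < m.1
  · -- Adjacent separators would be sides of a gap that separates `x` and `y`.
    exfalso
    obtain ⟨l, hl, m, hm, hlm, hadj⟩ := exists_adjacent hper hvert hK hx hy hQ
    have hlt := (separators_nested hper hl hm).1 hlm
    obtain ⟨s, s1, s2, s3, s4⟩ := exists_fiber_of_gap hper (hl.1.mem_lamination hper)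
      (hm.1.mem_lamination hper) hl.2.1 hlm.le hm.2.2.1 hm.2.2.2.1 hlt.le hl.2.2.2.2
      (fun k hk => by
        have h1 := separators_nested hper hk hl
        have h2 := separators_nested hper hm hk
        have h3 := hadj k hk
        grind)
    have hs := finite_of_cross hper hK hx hy s1 s2 (cross_separators hl)
    obtain ⟨e1, e2⟩ := arc_separators hl
    obtain ⟨e3, e4⟩ := arc_separators hm
    rcases leaf_eq_of_finite hper hs hl.1 hm.1 s1 s2 s3 with h1 | h1
    · rw [← arc_inj (c := x), e1, e3] at h1
      linarith
    · rw [← arc_inj (c := x), e2, e3] at h1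
      linarith [hm.2.2.1, hl.2.2.2.1]
  push Not at hQ
  have hY : 0 < arc x y := arc_pos.2 (Ne.symm hxy)
  by_cases hne : (separators θ x y).Nonempty
  · -- The only separator lies in a common finite gap with either point.
    obtain ⟨l, hl⟩ := hne
    obtain ⟨e1, e2⟩ := arc_separators hl
    have huniq : ∀ k ∈ separators θ x y, k.1 = l.1 ∧ k.2 = l.2 := by
      intro k hk
      have h1 := le_antisymm (hQ l hl k hk) (hQ k hk l hl)
      exact ⟨h1, (separators_nested hper hk hl).2 h1⟩
    have key : ∀ u v, (u = x ∨ u = y ∨ u = x + (l.1 : UnitAddCircle)) →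
        (v = x + (l.1 : UnitAddCircle) ∨ v = x + (l.2 : UnitAddCircle)) → Comp θ u v := by
      intro u v hu hv
      refine comp_of_not_cross hper fun a b hab => ?_
      have h1 := hab.separators_cases hper hl
      have h2 : 0 < arc x a → arc x a < arc x y → arc x y < arc x b → _ := fun g1 g2 g3 =>
        huniq _ (hab.mem_separators g1 g2 g3)
      have h3 : 0 < arc x b → arc x b < arc x y → arc x y < arc x a → _ := fun g1 g2 g3 =>
        huniq _ (hab.symm.mem_separators g1 g2 g3)
      obtain ⟨-, l1, l2, l3, l4⟩ := hl
      have n1 := arc_nonneg x a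
      have n2 := arc_nonneg x b
      have hu' : arc x u = 0 ∨ arc x u = arc x y ∨ arc x u = l.1 := by
        rcases hu with rfl | rfl | rfl
        · simp
        · simp
        · simp [e1]
      have hv' : arc x v = l.1 ∨ arc x v = l.2 := by
        rcases hv with rfl | rfl
        · simp [e1]
        · simp [e2]
      rw [cross_iff x]
      unfold CrossR at *
      rcases hu' with h | h | h <;> rcases hv' with h' | h' <;> rw [h, h'] <;>
        grind (splits := 40)
    have hfib : ∀ u, (u = x ∨ u = y) → ∃ s, (fiber θ s).Finite ∧ u ∈ fiber θ s ∧
        x + (l.1 : UnitAddCircle) ∈ fiber θ s := by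
      intro u hu
      obtain ⟨s, hs⟩ := exists_fiber_of_pairwise (θ := θ)
        (A := {u, x + (l.1 : UnitAddCircle), x + (l.2 : UnitAddCircle)}) (by
          have hu' : u = x ∨ u = y ∨ u = x + (l.1 : UnitAddCircle) := by tauto
          rintro _ (rfl | rfl | rfl) _ (rfl | rfl | rfl)
          · exact comp_self _ _
          · exact key _ _ hu' (Or.inl rfl)
          · exact key _ _ hu' (Or.inr rfl)
          · exact (key _ _ hu' (Or.inl rfl)).symm
          · exact comp_self _ _
          · exact key _ _ (Or.inr (Or.inr rfl)) (Or.inr rfl)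
          · exact (key _ _ hu' (Or.inr rfl)).symm
          · exact (key _ _ (Or.inr (Or.inr rfl)) (Or.inr rfl)).symm
          · exact comp_self _ _)
      exact ⟨s, finite_of_cross hper hK hx hy (hs (by simp)) (hs (by simp)) (cross_separators hl),
        hs (by simp), hs (by simp)⟩
    obtain ⟨s, h1, h2, h3⟩ := hfib x (Or.inl rfl)
    obtain ⟨t, h4, h5, h6⟩ := hfib y (Or.inr rfl)
    exact ⟨_, Or.inr (Or.inr ⟨s, h1, h2, h3⟩), Or.inr (Or.inr ⟨t, h4, h6, h5⟩)⟩
  · -- Without separators, the points lie in a common gap.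
    refine ⟨x, Or.inl rfl, ?_⟩
    have hcomp : Comp θ x y := by
      refine comp_of_not_cross hper fun a b hab hc => hne ?_
      rw [cross_iff x, arc_self] at hc
      have n1 := arc_nonneg x a
      have n2 := arc_nonneg x b
      by_cases h1 : arc x a < arc x y
      · refine ⟨_, hab.mem_separators (y := y) ?_ h1 ?_⟩ <;> unfold CrossR at hc <;> grind
      · refine ⟨_, hab.symm.mem_separators (y := y) ?_ ?_ ?_⟩ <;> unfold CrossR at hc <;> grind
    by_cases hlf : Leaf θ x y
    · exact Or.inr (Or.inl hlf)
    obtain ⟨s, h1, h2⟩ := hcomp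
    by_cases hs : (fiber θ s).Finite
    · exact Or.inr (Or.inr ⟨s, hs, h1, h2⟩)
    obtain ⟨z, hz, w, hw, h3⟩ := exists_cross_of_infinite hper hs h1 h2 hxy hlf
    exact absurd (finite_of_cross hper hK hx hy hz hw (Or.inl h3)) hs

/-- The equivalence relation of the lamination is the composition of the direct relation with
itself. -/
theorem rel_iff (hper : sigma θ ∉ Function.periodicPts sigma)
    (hvert : θ ≠ ((1 / 4 : ℝ) : UnitAddCircle) ∧ θ ≠ ((3 / 4 : ℝ) : UnitAddCircle)) :
    inducedSetoid (pullbackLamination θ) x y ↔ ∃ z, Rel θ x z ∧ Rel θ z y :=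
  ⟨exists_rel_rel hper hvert, fun ⟨_, h1, h2⟩ => Setoid.trans' _ (h1.rel hper) (h2.rel hper)⟩

/-! ### Invariance, closedness and nondegeneracy -/

/-- The image of the class of `y` is the class of `σ(y)`, since direct relations can be pushed
forward and lifted. -/
theorem isInvariant (hper : sigma θ ∉ Function.periodicPts sigma)
    (hvert : θ ≠ ((1 / 4 : ℝ) : UnitAddCircle) ∧ θ ≠ ((3 / 4 : ℝ) : UnitAddCircle)) :
    IsInvariant (inducedSetoid (pullbackLamination θ)) := by
  rintro _ ⟨y, rfl⟩
  refine ⟨sigma y, ?_⟩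
  ext u
  constructor
  · rintro ⟨x, hx, rfl⟩
    obtain ⟨z, h1, h2⟩ := (rel_iff hper hvert).1 hx
    exact (rel_iff hper hvert).2 ⟨sigma z, h1.map, h2.map⟩
  · intro hu
    obtain ⟨z, h1, h2⟩ := (rel_iff hper hvert).1 hu
    obtain ⟨z, rfl, h3⟩ := h2.symm.exists_lift hper
    obtain ⟨x, rfl, h4⟩ := h1.symm.exists_lift hper
    exact ⟨x, (rel_iff hper hvert).2 ⟨z, h4.symm, h3.symm⟩, rfl⟩

theorem isNondegenerate (hper : sigma θ ∉ Function.periodicPts sigma)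
    (hvert : θ ≠ ((1 / 4 : ℝ) : UnitAddCircle) ∧ θ ≠ ((3 / 4 : ℝ) : UnitAddCircle)) :
    IsNondegenerate (inducedSetoid (pullbackLamination θ)) := by
  obtain ⟨x, y, h⟩ := exists_not_rel_comp_rel hper
  exact ⟨x, y, fun h' => h ((rel_iff hper hvert).1 h')⟩

theorem isClosed_graph (hper : sigma θ ∉ Function.periodicPts sigma)
    (hvert : θ ≠ ((1 / 4 : ℝ) : UnitAddCircle) ∧ θ ≠ ((3 / 4 : ℝ) : UnitAddCircle)) :
    IsClosed {l : UnitAddCircle × UnitAddCircle |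
      inducedSetoid (pullbackLamination θ) l.1 l.2} := by
  simp only [rel_iff hper hvert]
  exact isClosed_rel_comp_rel hper

theorem isClosed_class {R : Setoid UnitAddCircle}
    (hR : IsClosed {l : UnitAddCircle × UnitAddCircle | R l.1 l.2}) {C : Set UnitAddCircle}
    (hC : C ∈ R.classes) : IsClosed C := by
  obtain ⟨y, rfl⟩ := hC
  exact hR.preimage (f := fun x => (x, y)) (by fun_prop)

/-- Iterated doubling maps sets with interior points onto the circle. -/
theorem exists_image_eq_univ {C : Set UnitAddCircle} (hx : x ∈ interior C) :
    ∃ n, sigma^[n] '' C = Set.univ := by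
  have hcont : Continuous fun r : ℝ => x + (r : UnitAddCircle) :=
    continuous_const.add (AddCircle.continuous_mk' (1 : ℝ))
  have h0 : (fun r : ℝ => x + (r : UnitAddCircle)) ⁻¹' interior C ∈ nhds (0 : ℝ) :=
    hcont.continuousAt.preimage_mem_nhds (by simpa using isOpen_interior.mem_nhds hx)
  obtain ⟨ε, hε, hball⟩ := Metric.mem_nhds_iff.1 h0
  obtain ⟨n, hn⟩ := pow_unbounded_of_one_lt (1 / ε) (one_lt_two : (1 : ℝ) < 2)
  rw [div_lt_iff₀ hε] at hn
  refine ⟨n, Set.eq_univ_of_forall fun y => ?_⟩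
  have hpos : (0 : ℝ) < 2 ^ n := by positivity
  set r := arc (sigma^[n] x) y with hr
  refine ⟨x + ((r / 2 ^ n : ℝ) : UnitAddCircle), interior_subset (hball ?_), ?_⟩
  · rw [Metric.mem_ball, dist_zero_right, Real.norm_eq_abs,
      abs_of_nonneg (div_nonneg (arc_nonneg _ _) hpos.le), div_lt_iff₀ hpos]
    linarith [arc_lt_one (sigma^[n] x) y]
  · have h1 : (2 ^ n) • ((r / 2 ^ n : ℝ) : UnitAddCircle) = (r : UnitAddCircle) := by
      rw [← AddCircle.coe_nsmul, nsmul_eq_mul]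
      push_cast
      rw [mul_div_cancel₀ _ hpos.ne']
    rw [sigma_iterate, smul_add, h1, ← sigma_iterate, hr, add_coe_arc]

/-- A class with interior points would be mapped onto the circle, which is not a class. -/
theorem isNowhereDense_class {R : Setoid UnitAddCircle}
    (hR : IsClosed {l : UnitAddCircle × UnitAddCircle | R l.1 l.2}) (hinv : IsInvariant R)
    (hnon : IsNondegenerate R) {C : Set UnitAddCircle} (hC : C ∈ R.classes) :
    IsNowhereDense C := by
  rw [(isClosed_class hR hC).isNowhereDense_iff, Set.eq_empty_iff_forall_notMem]
  intro x hx
  obtain ⟨n, hn⟩ := exists_image_eq_univ hx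
  have h1 : ∀ n, sigma^[n] '' C ∈ R.classes := by
    intro n
    induction n with
    | zero => simpa using hC
    | succ n ih =>
      rw [Function.iterate_succ', Set.image_comp]
      exact hinv _ ih
  obtain ⟨u, v, huv⟩ := hnon
  have h2 := h1 n
  rw [hn] at h2
  obtain ⟨y, hy⟩ := h2
  have hu : u ∈ {z | R z y} := hy ▸ Set.mem_univ u
  have hv : v ∈ {z | R z y} := hy ▸ Set.mem_univ v
  exact huv (R.trans hu (R.symm hv))

/-- Distinct classes are not linked, hence have disjoint convex hulls. -/
theorem disjoint_hull_class (hper : sigma θ ∉ Function.periodicPts sigma)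
    (hvert : θ ≠ ((1 / 4 : ℝ) : UnitAddCircle) ∧ θ ≠ ((3 / 4 : ℝ) : UnitAddCircle))
    {A B : Set UnitAddCircle} (hA : A ∈ (inducedSetoid (pullbackLamination θ)).classes)
    (hB : B ∈ (inducedSetoid (pullbackLamination θ)).classes) (hAB : A ≠ B) :
    Disjoint (convexHull ℝ (pt '' A)) (convexHull ℝ (pt '' B)) := by
  have hcl := isClosed_class (isClosed_graph hper hvert) hA
  set R := inducedSetoid (pullbackLamination θ)
  obtain ⟨u, rfl⟩ := hA
  obtain ⟨v, rfl⟩ := hB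
  have hne : ∀ x z, R x u → R z v → ¬ R x z := by
    intro x z hx hz hxz
    have huv : R u v := R.trans (R.symm hx) (R.trans hxz hz)
    refine hAB (Set.ext fun w => ⟨fun h => R.trans h huv, fun h => R.trans h (R.symm huv)⟩)
  refine disjoint_convexHull hcl ⟨u, R.refl u⟩ ?_ ?_
  · rw [Set.disjoint_left]
    exact fun x hx hx' => hne x x hx hx' (R.refl x)
  · intro a ha b hb c hc d hd hcr
    obtain ⟨e, h1, h2⟩ := (rel_iff hper hvert).1 (R.trans ha (R.symm hb))
    obtain ⟨f, h3, h4⟩ := (rel_iff hper hvert).1 (R.trans hc (R.symm hd))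
    exact hne a c ha hc (rel_of_cross hper h1 h2 h3 h4 hcr)

end QuadLam

theorem mainTheorem5 (θ : UnitAddCircle)
    (hvert : θ ≠ ((1 / 4 : ℝ) : UnitAddCircle) ∧ θ ≠ ((3 / 4 : ℝ) : UnitAddCircle))
    (hper : QuadLam.sigma θ ∉ Function.periodicPts QuadLam.sigma) :
    QuadLam.IsLamination (QuadLam.inducedSetoid (QuadLam.pullbackLamination θ)) ∧
      QuadLam.IsInvariant (QuadLam.inducedSetoid (QuadLam.pullbackLamination θ)) ∧
      QuadLam.IsNondegenerate (QuadLam.inducedSetoid (QuadLam.pullbackLamination θ)) := by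
  have hcl := QuadLam.isClosed_graph hper hvert
  have hinv := QuadLam.isInvariant hper hvert
  have hnon := QuadLam.isNondegenerate hper hvert
  exact ⟨⟨hcl, fun C hC => QuadLam.isNowhereDense_class hcl hinv hnon hC,
    fun A hA B hB hAB => QuadLam.disjoint_hull_class hper hvert hA hB hAB⟩, hinv, hnon⟩
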